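/- Let $0<a<1$, $0<\kappa\le 1$, and for $p\in(-1,1)$ put $\underline a(p)=\min\{a,\ \kappa|p-1|,\ \kappa|p+1|\}$. Let $f_I\in C^2([-1,1])$ satisfy (i) $f_I$ has exactly one zero $p_I$ in $[-1,1]$, $f_I>0$ for $x<p_I$ and $f_I<0$ for $x>p_I$; (ii) $f_I'(-1)=f_I'(1)=0$; (iii) $\lambda_I:=-f_I'(p_I)>0$, and $-f_I'>\tfrac12\lambda_I$ on $(p_I-a_0,p_I+a_0)\cap[-1,1]$ for some $0<a_0<a/4$. Consider the free boundary problem $$ f_t-f_{xx}=\lambda(t)\left[\delta_{p(t)-\underline a(p(t))}-\delta_{p(t)+\underline a(p(t))}\right]\ \text{ in }(-1,1),\qquad f_x(\pm1,t)=0,\qquad f(\cdot,0)=f_I,\tag{P} $$ where $p(t)$ is the zero of $f(\cdot,t)$ and $\lambda(t)=-f_x(p(t),t)$ is the flux through the free boundary. Let $$\Gamma(x,y;t)=\sum_{k\in\mathbb Z}K\big(x-2k-(-1)^{|k|}y,\,t\big),\qquad K(x,t)=\frac{1}{\sqrt{4\pi t}}\,e^{-x^2/(4t)},$$ be the Neumann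 heat kernel of $(-1,1)$. For $0<T<\infty$, a solution of (P) on $[0,T)$ is a pair $(f,p)$ such that - for each $t\in(0,T)$, $p(t)\in(-1,1)$ is the only zero of $f(\cdot,t)$ in $[-1,1]$, $f$ is $C^\infty$ in a space-time neighbourhood of $(p(t),t)$, and $\lambda(t)>0$; - for each $T'\in(0,T)$, $f$ is bounded on $[-1,1]\times(0,T']$ and $\lambda\in L^1(0,T')$ (with no uniformity as $T'\to T$); - for all $t\in(0,T)$ and $x\in[-1,1]$, Duhamel's formula holds: $$f(x,t)=\int_{-1}^{1}\Gamma(x,y;t)f_I(y)\,dy+\int_0^t\Big[\Gamma\big(x,p(s)-\underline a(p(s));t-s\big)-\Gamma\big(x,p(s)+\underline a(p(s));t-s\big)\Big]\lambda(s)\,ds;$$ - $f(\cdot,t)\to f_I$ uniformly on $[-1,1]$ as $t\downarrow0$. **Proposition.** If $(f,p)$ is a solution of (P) on $[0,T)$ with $T<\infty$, then $$\int_0^T\lambda(t)\,dt<\infty .$$ -/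

import Mathlib

open MeasureTheory Set Filter Topology
open scoped ContDiff

noncomputable section

namespace PriceFormation

/-- The heat kernel `K(x,t) = (4πt)^{-1/2} exp(-x²/(4t))` of the line (`t > 0`). -/
def heatKernel (x t : ℝ) : ℝ :=
  1 / Real.sqrt (4 * Real.pi * t) * Real.exp (-x ^ 2 / (4 * t))

/-- The fundamental solution `Γ(x,y;t)` of the heat equation on `(-1,1)` with homogeneous Neumann
conditions at `±1`, by the method of images: the images of `y` are `2k + (-1)^{|k|} y`. -/
def neumannKernel (x y t : ℝ) : ℝ :=
  ∑' k : ℤ, heatKernel (x - (2 * (k : ℝ) + (-1) ^ k.natAbs * y)) t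

/-- The distance `min {a, κ|p-1|, κ|p+1|}` between the free boundary `p` and the source / sink. -/
def offset (a κ p : ℝ) : ℝ := min a (min (κ * |p - 1|) (κ * |p + 1|))

/-- The flux `λ(t) = -∂ₓ f(p(t),t)` through the free boundary. -/
def flux (f : ℝ → ℝ → ℝ) (p : ℝ → ℝ) (t : ℝ) : ℝ := -deriv (fun x => f x t) (p t)

/-- Admissible initial data: `C²` on `[-1,1]`, with the single zero `pI`, positive to the left and
negative to the right of it, Neumann conditions at `±1`, and nondegenerate near `pI`.
(One-sided derivatives are meant at `±1`.) -/
structure IsInitialDatum (a : ℝ) (fI : ℝ → ℝ) (pI : ℝ) : Prop where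
  contDiffOn : ContDiffOn ℝ 2 fI (Icc (-1) 1)
  zeroSet : {x ∈ Icc (-1 : ℝ) 1 | fI x = 0} = {pI}
  pos_left : ∀ x ∈ Icc (-1 : ℝ) 1, x < pI → 0 < fI x
  neg_right : ∀ x ∈ Icc (-1 : ℝ) 1, pI < x → fI x < 0
  neumann_left : derivWithin fI (Icc (-1) 1) (-1) = 0
  neumann_right : derivWithin fI (Icc (-1) 1) 1 = 0
  slope_pos : 0 < -derivWithin fI (Icc (-1) 1) pI
  slope_near : ∃ a₀, 0 < a₀ ∧ a₀ < a / 4 ∧ ∀ x ∈ Icc (-1 : ℝ) 1 ∩ Ioo (pI - a₀) (pI + a₀),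
    (1 / 2) * (-derivWithin fI (Icc (-1) 1) pI) < -derivWithin fI (Icc (-1) 1) x

/-- `(f, p)` solves, on the time interval `[0,T)`, the problem
`f_t - f_xx = λ(t) (δ_{p(t)-a̲} - δ_{p(t)+a̲})` on `(-1,1)`, `f_x(±1,t) = 0`, `f(·,0) = fI`,
where `p(t)` is the only zero of `f(·,t)`, `λ(t) = -f_x(p(t),t)` and `a̲ = offset a κ (p t)`.
The equation and the Neumann conditions are expressed by Duhamel's formula. -/
structure IsSolutionOn (a κ : ℝ) (fI : ℝ → ℝ) (T : ℝ) (f : ℝ → ℝ → ℝ) (p : ℝ → ℝ) : Prop where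
  /-- `p t` is the only zero of `f(·,t)` in `[-1,1]`, and it is an interior point. -/
  zeroSet : ∀ t ∈ Ioo 0 T, {x ∈ Icc (-1 : ℝ) 1 | f x t = 0} = {p t}
  mem_Ioo : ∀ t ∈ Ioo 0 T, p t ∈ Ioo (-1 : ℝ) 1
  /-- `f` is smooth, jointly in `(x,t)`, across the free boundary. -/
  smooth : ∀ t ∈ Ioo 0 T, ∃ U ∈ 𝓝 (p t, t), ContDiffOn ℝ ∞ (fun z : ℝ × ℝ => f z.1 z.2) U
  /-- The free boundary is nondegenerate at each time. -/
  flux_pos : ∀ t ∈ Ioo 0 T, 0 < flux f p t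
  /-- Up to each time `T' < T` (with no uniformity as `T' → T`), `f` is bounded. -/
  bounded : ∀ T' ∈ Ioo 0 T, ∃ C, ∀ t ∈ Ioc 0 T', ∀ x ∈ Icc (-1 : ℝ) 1, |f x t| ≤ C
  /-- Up to each time `T' < T` (with no uniformity as `T' → T`), the flux is integrable, so that
  the integral in Duhamel's formula is meaningful. -/
  flux_integrable : ∀ T' ∈ Ioo 0 T, IntegrableOn (flux f p) (Ioc 0 T')
  duhamel : ∀ t ∈ Ioo 0 T, ∀ x ∈ Icc (-1 : ℝ) 1,
    f x t = (∫ y in (-1 : ℝ)..1, neumannKernel x y t * fI y)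
      + ∫ s in (0 : ℝ)..t,
          (neumannKernel x (p s - offset a κ (p s)) (t - s)
            - neumannKernel x (p s + offset a κ (p s)) (t - s)) * flux f p s
  /-- The initial datum is attained uniformly on `[-1,1]`. -/
  initial : TendstoUniformlyOn (fun t x => f x t) fI (𝓝[>] 0) (Icc (-1) 1)

end PriceFormation

end

/-! ### The Neumann heat kernel: majorant, singularity, continuity. -/

namespace PriceFormation

/-! Write `a̲` for the offset. For smooth `Φ`, even about `1` and `-1`, the positive part of `f`
obeys `d/dt ∫_{-1}^{p} f Φ = ∫_{-1}^{p} f Φ'' + (Φ(p - a̲) - Φ(p)) λ`, and the negative part a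
similar identity with the jump from `p` to `p + a̲` (`hasDerivAt_left`, `hasDerivAt_right`). Mass
that leaves through the free boundary is put back at the source or the sink, so both masses are
conserved. The identities combine the weak equation, extracted from Duhamel's formula (`weak_form`),
with the classical heat equation near `p`.

The function `zed x = 1 - sin (π x / 2)` decreases on `[-1,1]` and is comparable to `(1 - x)²`.
Every transfer moves positive mass to the left and negative mass to the right. Hence the difference
of the two pairings with `zed`, corrected by a linear function of time, is a bounded nondecreasing
quantity `S` with `S' ≥ (zed (p - a̲) - zed (p + a̲)) λ` (`exists_monotone_quantity`). So this
weighted flux has a finite integral, and so has `λ` once `p` is confined to a compact subset of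
`(-1,1)`. By the symmetry `f ↦ -f(-x)` it is enough to keep `p` away from `1`
(`exists_boundary_le`).

Two effects do this. The positive part cannot concentrate at `1`: transfers only push it away from
`1`, so it is controlled there as for the heat equation, by pairing it with backward Gaussians
centred at `1`. The pairing with `exp (-r zed)` is at most `C / √r` (`exists_leftPair_exp_le`), and
summing over a lacunary sequence of `r` bounds the pairing with `(zed + h)^(-1/4)` uniformly in `h >
0` (`exists_leftPair_rpow_le`).

The negative part, on the other hand, must spread. Let `E` be its pairing with `zed / (zed + h)`,
which measures the mass lying farther from `1` than the scale `zed ~ h`. Diffusion drives `E` at a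
rate of order `1/h` towards a fixed fraction of the mass, whereas transfers lower it. By
`exists_jump_le` that loss is paid for by the gain of `A`, the pairing of the positive part with
`log ((zed + h) / (zed + d))`, and by the growth of `S / d`. Nonconcentration gives `-const *
d^(1/4) ≤ A ≤ 0` uniformly in `h`. Thus `Y = E + C A + (S - S t₀) / d` satisfies a linear
differential inequality that relaxes to a positive level. With `d` small, then `t₀` so late that `S`
hardly grows after it, then `h` small against `T - t₀`, the functional `E` is bounded below near
time `T`. As `E` is at most the mass times the value of `zed / (zed + h)` at `p`, this bounds `zed
(p t)` below. -/

lemma heatKernel_nonneg (x t : ℝ) : 0 ≤ heatKernel x t := by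
  unfold heatKernel; positivity

lemma heatKernel_neg (x t : ℝ) : heatKernel (-x) t = heatKernel x t := by
  simp [heatKernel]

lemma neumannKernel_neg (x y t : ℝ) : neumannKernel (-x) (-y) t = neumannKernel x y t := by
  unfold neumannKernel
  rw [← (Equiv.neg ℤ).tsum_eq]
  refine tsum_congr fun k => ?_
  rw [← heatKernel_neg]
  congr 1
  simp
  ring

/-- A summable majorant of the exponentials in the image series, for times up to `T`. -/
noncomputable def imageBound (T : ℝ) (k : ℤ) : ℝ := (if k = 0 then 1 else 0) + (1 + 4 * T) * (1 / (k : ℝ) ^ 2)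

lemma summable_imageBound (T : ℝ) : Summable (imageBound T) := by
  apply Summable.add
  · exact summable_of_hasFiniteSupport ((finite_singleton (0 : ℤ)).subset fun k hk => by
      by_contra h; simp at h; simp [h] at hk)
  · exact (Real.summable_one_div_int_pow.mpr one_lt_two).mul_left _

lemma exp_image_le {T x y t : ℝ} (hx : x ∈ Icc (-1 : ℝ) 1) (hy : y ∈ Icc (-1 : ℝ) 1)
    (ht : t ∈ Ioc 0 T) (k : ℤ) :
    Real.exp (-(x - (2 * (k : ℝ) + (-1) ^ k.natAbs * y)) ^ 2 / (4 * t)) ≤ imageBound T k := by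
  obtain ⟨ht0, htT⟩ := ht
  have hle1 : Real.exp (-(x - (2 * (k : ℝ) + (-1) ^ k.natAbs * y)) ^ 2 / (4 * t)) ≤ 1 := by
    rw [Real.exp_le_one_iff]
    exact div_nonpos_of_nonpos_of_nonneg (by simp; positivity) (by positivity)
  unfold imageBound
  rcases eq_or_ne k 0 with rfl | hk
  · simpa using hle1
  have hk1 : (1 : ℝ) ≤ (k : ℝ) ^ 2 := by
    have : 1 ≤ k ^ 2 := by
      have := sq_pos_of_ne_zero hk (R := ℤ); omega
    exact_mod_cast this
  simp only [hk, if_false, zero_add]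
  -- For `|k| ≥ 2` the image is at distance at least `2|k| - 2 ≥ |k|` from `x`, and `exp (-u) ≤ 1/u`
  -- gives `4T / k²`. The images `k = ±1` can be at distance zero and are bounded by `1`.
  rcases le_or_gt |k| 1 with hk2 | hk2
  · have : k ^ 2 = 1 := by
      have h1 : |k| = 1 := le_antisymm hk2 (Int.one_le_abs hk)
      rw [← sq_abs, h1]; norm_num
    have : (k : ℝ) ^ 2 = 1 := by exact_mod_cast this
    rw [this]; linarith
  · have hk3 : (2 : ℝ) ≤ |(k : ℝ)| := by exact_mod_cast hk2
    set w := x - (2 * (k : ℝ) + (-1) ^ k.natAbs * y) with hw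
    have hxy : |x - (-1) ^ k.natAbs * y| ≤ 2 := by
      have h1 : |(-1 : ℝ) ^ k.natAbs * y| ≤ 1 := by
        rw [abs_mul, abs_pow]; simpa using abs_le.mpr hy
      have h2 : |x| ≤ 1 := abs_le.mpr hx
      exact (abs_sub _ _).trans (by linarith)
    have hwk : |(k : ℝ)| ≤ |w| := by
      have h3 : |2 * (k : ℝ)| ≤ |w| + |x - (-1) ^ k.natAbs * y| := by
        have : 2 * (k : ℝ) = (x - (-1) ^ k.natAbs * y) - w := by rw [hw]; ring
        rw [this]; exact (abs_sub _ _).trans (by linarith)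
      rw [abs_mul, abs_two] at h3
      linarith
    have hsq : (k : ℝ) ^ 2 ≤ w ^ 2 := sq_le_sq.mpr hwk
    have hu : 0 < w ^ 2 / (4 * t) := by apply div_pos <;> nlinarith
    have h4 : Real.exp (-w ^ 2 / (4 * t)) ≤ 1 / (w ^ 2 / (4 * t)) := by
      rw [neg_div, Real.exp_neg, ← one_div]
      exact one_div_le_one_div_of_le hu ((Real.add_one_le_exp _).trans' (by linarith))
    refine h4.trans ?_
    rw [one_div_div, mul_one_div]
    apply div_le_div₀ <;> nlinarith

lemma neumannKernel_eq (x y t : ℝ) : neumannKernel x y t = 1 / Real.sqrt (4 * Real.pi * t) *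
    ∑' k : ℤ, Real.exp (-(x - (2 * (k : ℝ) + (-1) ^ k.natAbs * y)) ^ 2 / (4 * t)) := by
  unfold neumannKernel heatKernel
  rw [tsum_mul_left]

lemma neumannKernel_nonneg (x y t : ℝ) : 0 ≤ neumannKernel x y t :=
  tsum_nonneg fun _ => heatKernel_nonneg _ _

/-- The majorant of the image series does not depend on `t ≤ T`, so only the prefactor `t^(-1/2)` is
singular. It is integrable in time, which is what the Duhamel integrals require. -/
lemma exists_neumannKernel_le (T : ℝ) : ∃ C, 0 ≤ C ∧ ∀ x ∈ Icc (-1 : ℝ) 1, ∀ y ∈ Icc (-1 : ℝ) 1,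
    ∀ t ∈ Ioc 0 T, neumannKernel x y t ≤ C / Real.sqrt t := by
  rcases le_or_gt T 0 with hT | hT
  · exact ⟨0, le_rfl, fun x _ y _ t ht => by linarith [ht.1, ht.2]⟩
  have hnn : ∀ k, 0 ≤ imageBound T k := fun k => by
    unfold imageBound; split_ifs <;> positivity
  refine ⟨1 / Real.sqrt (4 * Real.pi) * ∑' k, imageBound T k,
    mul_nonneg (by positivity) (tsum_nonneg hnn), fun x hx y hy t ht => ?_⟩
  rw [neumannKernel_eq, Real.sqrt_mul (by positivity)]
  have h : ∑' k : ℤ, Real.exp (-(x - (2 * (k : ℝ) + (-1) ^ k.natAbs * y)) ^ 2 / (4 * t)) ≤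
      ∑' k, imageBound T k :=
    Summable.tsum_le_tsum (exp_image_le hx hy ht)
      (Summable.of_nonneg_of_le (fun _ => (Real.exp_pos _).le) (exp_image_le hx hy ht)
        (summable_imageBound T)) (summable_imageBound T)
  calc _ ≤ 1 / (Real.sqrt (4 * Real.pi) * Real.sqrt t) * ∑' k, imageBound T k := by gcongr
    _ = _ := by field_simp

lemma continuousOn_neumannKernel (T : ℝ) :
    ContinuousOn (fun q : ℝ × ℝ × ℝ => neumannKernel q.1 q.2.1 q.2.2)
      (Icc (-1) 1 ×ˢ Icc (-1) 1 ×ˢ Ioc 0 T) := by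
  simp only [neumannKernel_eq]
  have hne : ∀ q ∈ Icc (-1 : ℝ) 1 ×ˢ Icc (-1 : ℝ) 1 ×ˢ Ioc 0 T, (0 : ℝ) < q.2.2 :=
    fun q hq => hq.2.2.1
  apply ContinuousOn.mul
  · apply ContinuousOn.div continuousOn_const (by fun_prop)
    intro q hq
    have := hne q hq
    have := Real.pi_pos
    positivity
  · refine continuousOn_tsum (u := imageBound T) (fun k => ?_) (summable_imageBound T)
      (fun k q hq => ?_)
    · apply Real.continuous_exp.comp_continuousOn
      apply ContinuousOn.div (by fun_prop) (by fun_prop)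
      intro q hq
      have := hne q hq
      positivity
    · rw [Real.norm_of_nonneg (Real.exp_pos _).le]
      exact exp_image_le hq.1 hq.2.1 hq.2.2 k

end PriceFormation

/-! ### Neumann test functions and unfolding of the image series. -/

namespace PriceFormation
open ProbabilityTheory

/-- Smooth functions on the line that are even about `1` and about `-1`; their restrictions to
`[-1,1]` satisfy the Neumann conditions. -/
structure NeumannTest (Φ : ℝ → ℝ) : Prop where
  smooth : ContDiff ℝ ∞ Φ
  symm_right : ∀ x, Φ (2 - x) = Φ x
  symm_left : ∀ x, Φ (-2 - x) = Φ x

lemma exists_bound_of_continuous_of_periodic {g : ℝ → ℝ} {c : ℝ} (hc : c ≠ 0)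
    (hg : Continuous g) (hp : Function.Periodic g c) : ∃ C, ∀ x, |g x| ≤ C := by
  obtain ⟨C, hC⟩ := (hp.isBounded_of_continuous hc hg).exists_norm_le
  exact ⟨C, fun x => hC _ (mem_range_self x)⟩

namespace NeumannTest

variable {Φ Ψ : ℝ → ℝ}

/-- The reflections about `1` and `-1` compose to a translation by `4`. Periodicity turns continuity
into global boundedness. -/
lemma periodic (h : NeumannTest Φ) : Function.Periodic Φ 4 := fun x => by
  rw [← h.symm_right, ← h.symm_left x]; congr 1; ring

lemma continuous (h : NeumannTest Φ) : Continuous Φ := h.smooth.continuous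

lemma exists_bound (h : NeumannTest Φ) : ∃ C, ∀ x, |Φ x| ≤ C :=
  exists_bound_of_continuous_of_periodic (by norm_num) h.continuous h.periodic

lemma differentiable (h : NeumannTest Φ) : Differentiable ℝ Φ := h.smooth.differentiable (by simp)

lemma smooth_deriv (h : NeumannTest Φ) : ContDiff ℝ ∞ (deriv Φ) :=
  (contDiff_infty_iff_deriv.mp h.smooth).2

lemma deriv_symm_right (h : NeumannTest Φ) (x : ℝ) : deriv Φ (2 - x) = -deriv Φ x := by
  have : deriv (fun x => Φ (2 - x)) x = deriv Φ x := by rw [funext h.symm_right]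
  rw [deriv_comp_const_sub] at this
  linarith

lemma deriv_symm_left (h : NeumannTest Φ) (x : ℝ) : deriv Φ (-2 - x) = -deriv Φ x := by
  have : deriv (fun x => Φ (-2 - x)) x = deriv Φ x := by rw [funext h.symm_left]
  rw [deriv_comp_const_sub] at this
  linarith

lemma exists_bound_deriv (h : NeumannTest Φ) : ∃ C, ∀ x, |deriv Φ x| ≤ C := by
  refine exists_bound_of_continuous_of_periodic (c := 4) (by norm_num) h.smooth_deriv.continuous
    fun x => ?_
  rw [← neg_neg (deriv Φ (x + 4)), ← h.deriv_symm_right, ← neg_neg (deriv Φ x),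
    ← h.deriv_symm_left x]
  congr 2; ring

lemma deriv_deriv (h : NeumannTest Φ) : NeumannTest (deriv (deriv Φ)) where
  smooth := (contDiff_infty_iff_deriv.mp h.smooth_deriv).2
  symm_right x := by
    have : deriv (fun x => deriv Φ (2 - x)) x = deriv (fun x => -deriv Φ x) x := by
      rw [funext h.deriv_symm_right]
    rw [deriv_comp_const_sub, deriv.fun_neg] at this
    linarith
  symm_left x := by
    have : deriv (fun x => deriv Φ (-2 - x)) x = deriv (fun x => -deriv Φ x) x := by
      rw [funext h.deriv_symm_left]
    rw [deriv_comp_const_sub, deriv.fun_neg] at this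
    linarith

lemma mul (h : NeumannTest Φ) (h' : NeumannTest Ψ) : NeumannTest (fun x => Φ x * Ψ x) where
  smooth := h.smooth.mul h'.smooth
  symm_right x := by simp only [h.symm_right, h'.symm_right]
  symm_left x := by simp only [h.symm_left, h'.symm_left]

lemma hasDerivAt (h : NeumannTest Φ) (x : ℝ) : HasDerivAt Φ (deriv Φ x) x :=
  (h.differentiable x).hasDerivAt

lemma hasDerivAt_deriv (h : NeumannTest Φ) (x : ℝ) : HasDerivAt (deriv Φ) (deriv (deriv Φ) x) x :=
  (h.smooth_deriv.differentiable (by simp) x).hasDerivAt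

end NeumannTest

/-- The heat semigroup of the line, as an average over standard Gaussian increments. -/
noncomputable def gaussSmooth (Φ : ℝ → ℝ) (τ y : ℝ) : ℝ :=
  ∫ z, Φ (y + Real.sqrt (2 * τ) * z) ∂gaussianReal 0 1

lemma integral_heatKernel_mul (Φ : ℝ → ℝ) {t : ℝ} (ht : 0 < t) (y : ℝ) :
    ∫ w, heatKernel (w - y) t * Φ w = gaussSmooth Φ t y := by
  have hs : 0 < Real.sqrt (2 * t) := by positivity
  unfold gaussSmooth
  rw [integral_gaussianReal_eq_integral_smul one_ne_zero,
    ← integral_add_right_eq_self _ y]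
  simp only [add_sub_cancel_right]
  have h := Measure.integral_comp_mul_left (fun w => heatKernel w t * Φ (w + y)) (Real.sqrt (2 * t))
  rw [abs_of_pos (inv_pos.mpr hs), smul_eq_mul, ← mul_right_inj' hs.ne', mul_inv_cancel_left₀ hs.ne']
    at h
  rw [← h, ← integral_const_mul]
  refine integral_congr_ae (ae_of_all _ fun z => ?_)
  simp only [heatKernel, gaussianPDFReal, smul_eq_mul, ← mul_assoc, NNReal.coe_one, mul_one,
    sub_zero]
  rw [add_comm y]
  congr 1
  have h1 : Real.sqrt (4 * Real.pi * t) = Real.sqrt (2 * t) * Real.sqrt (2 * Real.pi) := by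
    rw [← Real.sqrt_mul (by positivity)]; congr 1; ring
  rw [h1, mul_pow, Real.sq_sqrt (by positivity)]
  have h2 : -(2 * t * z ^ 2) / (4 * t) = -z ^ 2 / 2 := by
    rw [div_eq_div_iff (by positivity) (by norm_num)]; ring
  rw [h2]
  field_simp

lemma integrable_heatKernel {t : ℝ} (ht : 0 < t) (y : ℝ) :
    Integrable (fun w => heatKernel (w - y) t) := by
  have h : (fun w => heatKernel (w - y) t) = gaussianPDFReal y (2 * t).toNNReal := by
    ext w
    simp only [heatKernel, gaussianPDFReal, Real.coe_toNNReal _ (by positivity : (0 : ℝ) ≤ 2 * t), one_div]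
    ring_nf
  rw [h]
  exact integrable_gaussianPDFReal _ _

/-- Matches images with the intervals `[2n - 1, 2n + 1]` of the line: an even image `k` is a
translation into the interval `n = -k`, an odd image a reflection into the interval `n = k`. -/
lemma involutive_neg_of_even :
    Function.Involutive (fun k : ℤ => if Even k then -k else k) := fun k => by
  by_cases hk : Even k <;> simp [hk]

/-- Unfolding: `Φ` is invariant under the reflections that generate the images, so the image series
integrated over `[-1,1]` reassembles into a single integral of the kernel of the line. -/
lemma integral_neumannKernel_mul {Φ : ℝ → ℝ} (hΦ : NeumannTest Φ) {t y : ℝ} (ht : 0 < t)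
    (hy : y ∈ Icc (-1 : ℝ) 1) :
    ∫ x in (-1 : ℝ)..1, neumannKernel x y t * Φ x = gaussSmooth Φ t y := by
  obtain ⟨C, hC⟩ := hΦ.exists_bound
  have hC0 : 0 ≤ C := (abs_nonneg _).trans (hC 0)
  rw [← integral_heatKernel_mul Φ ht]
  set F : ℝ → ℝ := fun w => heatKernel (w - y) t * Φ w with hF
  have hFint : Integrable F := by
    refine (integrable_heatKernel ht y).mul_bdd hΦ.continuous.aestronglyMeasurable
      (c := C) (ae_of_all _ fun x => hC x)
  -- the sum of the images
  have hc : ∀ k : ℤ, Continuous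
      fun x => heatKernel (x - (2 * (k : ℝ) + (-1) ^ k.natAbs * y)) t * Φ x := fun k => by
    have := hΦ.continuous
    unfold heatKernel
    fun_prop
  have h1 : HasSum (fun k : ℤ => ∫ x in (-1 : ℝ)..1,
      heatKernel (x - (2 * (k : ℝ) + (-1) ^ k.natAbs * y)) t * Φ x)
      (∫ x in (-1 : ℝ)..1, neumannKernel x y t * Φ x) := by
    refine intervalIntegral.hasSum_integral_of_dominated_convergence
      (fun k _ => 1 / Real.sqrt (4 * Real.pi * t) * imageBound t k * C)
      (fun k => (hc k).aestronglyMeasurable) (fun k => ae_of_all _ fun x hx => ?_)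
      (ae_of_all _ fun x _ => ((summable_imageBound t).mul_left _).mul_right _) (by simp)
      (ae_of_all _ fun x hx => ?_)
    · rw [uIoc_of_le (by norm_num)] at hx
      rw [norm_mul, Real.norm_of_nonneg (heatKernel_nonneg _ _)]
      have := exp_image_le ⟨hx.1.le, hx.2⟩ hy ⟨ht, le_rfl⟩ k
      have h0 := (Real.exp_pos _).le.trans this
      unfold heatKernel
      gcongr
      exact hC x
    · rw [uIoc_of_le (by norm_num)] at hx
      refine HasSum.mul_right _ (Summable.hasSum ?_)
      unfold heatKernel
      exact (Summable.of_nonneg_of_le (fun _ => (Real.exp_pos _).le)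
        (exp_image_le ⟨hx.1.le, hx.2⟩ hy ⟨ht, le_rfl⟩) (summable_imageBound t)).mul_left _
  -- the line cut into intervals of length two
  have h2 : HasSum (fun n : ℤ => ∫ x in (-1 : ℝ)..1, F (x + 2 * n)) (∫ w, F w) := by
    have hG : Integrable (fun u => 2 * F (2 * u - 1)) :=
      ((hFint.comp_sub_right 1).comp_mul_left' (two_ne_zero)).const_mul 2
    have h3 := hG.hasSum_intervalIntegral_comp_add_int
    have e1 : ∀ n : ℤ, ∫ u in (0 : ℝ)..1, 2 * F (2 * (u + n) - 1) =
        ∫ x in (-1 : ℝ)..1, F (x + 2 * n) := fun n => by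
      have h4 := intervalIntegral.mul_integral_comp_mul_sub (a := 0) (b := 1) (c := 2) (d := 1)
        (f := fun x => F (x + 2 * n))
      rw [show (2 : ℝ) * 0 - 1 = -1 by norm_num, show (2 : ℝ) * 1 - 1 = 1 by norm_num] at h4
      rw [← h4, ← intervalIntegral.integral_const_mul]
      congr 1; ext u; congr 2; ring
    have e2 : ∫ u, 2 * F (2 * u - 1) = ∫ w, F w := by
      rw [integral_const_mul, Measure.integral_comp_mul_left (fun w => F (w - 1)) 2,
        integral_sub_right_eq_self]
      norm_num
      ring
    rwa [funext e1, e2] at h3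
  refine (h2.unique ?_).symm
  rw [← (involutive_neg_of_even.toPerm _).hasSum_iff]
  convert h1 using 1
  ext k
  have hper : ∀ (m : ℤ) (x : ℝ), Φ (x + m * 4) = Φ x := fun m x => by
    simpa using (hΦ.periodic.int_mul m) x
  simp only [Function.comp, Function.Involutive.coe_toPerm]
  by_cases hk : Even k
  · have hk' : (-1 : ℝ) ^ k.natAbs = 1 := (Int.natAbs_even.mpr hk).neg_one_pow
    obtain ⟨m, rfl⟩ := id hk
    simp only [hk, if_true, hF]
    congr 1; ext x
    rw [hk', ← hper (-m) x]
    push_cast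
    congr 2
    · ring
    · ring
  · have hk' : (-1 : ℝ) ^ k.natAbs = -1 :=
      (Int.natAbs_odd.mpr (Int.not_even_iff_odd.mp hk)).neg_one_pow
    obtain ⟨m, hm⟩ := Int.not_even_iff_odd.mp hk
    simp only [hk, if_false, hF]
    have h4 := intervalIntegral.integral_comp_neg (a := -1) (b := 1)
      (fun x => heatKernel (x + 2 * (k : ℝ) - y) t * Φ (x + 2 * k))
    rw [neg_neg] at h4
    rw [← h4]
    congr 1; ext x
    rw [hk', ← heatKernel_neg, ← hper (-m) x, ← hΦ.symm_right, hm]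
    push_cast
    congr 2
    · ring
    · ring

end PriceFormation

/-! ### The heat semigroup on test functions: bounds and time derivative. -/

namespace PriceFormation
open ProbabilityTheory

lemma continuous_gaussSmooth {Φ : ℝ → ℝ} (hΦ : NeumannTest Φ) :
    Continuous fun q : ℝ × ℝ => gaussSmooth Φ q.1 q.2 := by
  obtain ⟨C, hC⟩ := hΦ.exists_bound
  have := hΦ.continuous
  refine continuous_of_dominated (bound := fun _ => C) (fun q => ?_) (fun q => ae_of_all _ fun z => hC _)
    (integrable_const _) (ae_of_all _ fun z => by fun_prop)
  exact Continuous.aestronglyMeasurable (by fun_prop)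

lemma abs_gaussSmooth_le {Φ : ℝ → ℝ} {C : ℝ} (hC : ∀ x, |Φ x| ≤ C) (τ y : ℝ) :
    |gaussSmooth Φ τ y| ≤ C := by
  have := norm_integral_le_of_norm_le_const (μ := gaussianReal 0 1)
    (f := fun z => Φ (y + Real.sqrt (2 * τ) * z)) (C := C) (ae_of_all _ fun z => hC _)
  simpa only [gaussSmooth, Real.norm_eq_abs, probReal_univ, mul_one] using this

/-- Gaussian integration by parts. -/
lemma integral_id_mul_gaussianReal {h h' : ℝ → ℝ} {C : ℝ} (hh : ∀ z, HasDerivAt h (h' z) z)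
    (hc' : Continuous h') (hC : ∀ z, |h z| ≤ C) (hC' : ∀ z, |h' z| ≤ C) :
    ∫ z, z * h z ∂gaussianReal 0 1 = ∫ z, h' z ∂gaussianReal 0 1 := by
  have hc : Continuous h := continuous_iff_continuousAt.mpr fun z => (hh z).continuousAt
  have hpdf : ∀ z : ℝ, HasDerivAt (fun z => -gaussianPDFReal 0 1 z) (z * gaussianPDFReal 0 1 z) z := by
    intro z
    unfold gaussianPDFReal
    have : HasDerivAt (fun z : ℝ => -(z - 0) ^ 2 / (2 * ((1 : NNReal) : ℝ))) (-z) z := by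
      refine ((((hasDerivAt_id z).sub_const 0).pow 2).neg.div_const
        (2 * ((1 : NNReal) : ℝ))).congr_deriv ?_
      simp
      ring
    refine ((this.exp).const_mul _).neg.congr_deriv ?_
    ring
  have hid : Integrable (fun z : ℝ => z * gaussianPDFReal 0 1 z) := by
    have h1 : Integrable (id : ℝ → ℝ) (gaussianReal 0 1) :=
      (memLp_id_gaussianReal 1).integrable (by norm_num)
    rw [gaussianReal_of_var_ne_zero _ one_ne_zero, integrable_withDensity_iff_integrable_smul'
      (measurable_gaussianPDF _ _) (ae_of_all _ fun _ => gaussianPDF_lt_top)] at h1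
    simpa [toReal_gaussianPDF, mul_comm] using h1
  rw [integral_gaussianReal_eq_integral_smul one_ne_zero,
    integral_gaussianReal_eq_integral_smul one_ne_zero]
  have key := integral_mul_deriv_eq_deriv_mul_of_integrable (u := h) (u' := h')
    (v := fun z => -gaussianPDFReal 0 1 z) (v' := fun z => z * gaussianPDFReal 0 1 z)
    (fun z _ => hh z) (fun z _ => hpdf z)
    (hid.bdd_mul hc.aestronglyMeasurable (c := C) (ae_of_all _ hC))
    ((integrable_gaussianPDFReal 0 1).neg.bdd_mul hc'.aestronglyMeasurable (c := C)
      (ae_of_all _ hC'))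
    ((integrable_gaussianPDFReal 0 1).neg.bdd_mul hc.aestronglyMeasurable (c := C) (ae_of_all _ hC))
  simp only [smul_eq_mul, mul_neg, integral_neg, neg_neg] at key ⊢
  calc _ = ∫ z, h z * (z * gaussianPDFReal 0 1 z) := by congr 1; ext z; ring
    _ = _ := key
    _ = _ := by congr 1; ext z; ring

/-- Differentiation under the integral produces `Φ'` times `z / √(2τ)`. Gaussian integration by
parts trades the factor `z` for one more derivative, which brings out a factor `√(2τ)` and cancels
the singularity. -/
lemma hasDerivAt_gaussSmooth {Φ : ℝ → ℝ} (hΦ : NeumannTest Φ) {τ : ℝ} (hτ : 0 < τ) (y : ℝ) :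
    HasDerivAt (fun τ => gaussSmooth Φ τ y) (gaussSmooth (deriv (deriv Φ)) τ y) τ := by
  obtain ⟨C, hC⟩ := hΦ.exists_bound
  obtain ⟨C1, hC1⟩ := hΦ.exists_bound_deriv
  obtain ⟨C2, hC2⟩ := hΦ.deriv_deriv.exists_bound
  have hc := hΦ.continuous
  have hc1 := hΦ.smooth_deriv.continuous
  have hc2 := hΦ.deriv_deriv.continuous
  have hid : Integrable (fun z : ℝ => z) (gaussianReal 0 1) :=
    (memLp_id_gaussianReal 1).integrable (by norm_num)
  have hsq : ∀ r : ℝ, 0 < r → HasDerivAt (fun r => Real.sqrt (2 * r)) (1 / Real.sqrt (2 * r)) r := by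
    intro r hr
    refine (((hasDerivAt_id r).const_mul 2).sqrt (by simp; positivity)).congr_deriv ?_
    simp only [id]
    field_simp
  have key := (hasDerivAt_integral_of_dominated_loc_of_deriv_le (μ := gaussianReal 0 1) (𝕜 := ℝ)
    (F := fun r z => Φ (y + Real.sqrt (2 * r) * z))
    (F' := fun r z => deriv Φ (y + Real.sqrt (2 * r) * z) * (1 / Real.sqrt (2 * r) * z))
    (x₀ := τ) (s := Ioi (τ / 2)) (bound := fun z => C1 * (1 / Real.sqrt τ * |z|))
    (Ioi_mem_nhds (by linarith)) ?_ ?_ ?_ ?_ ?_ ?_).2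
  · refine HasDerivAt.congr_deriv key ?_
    unfold gaussSmooth
    have hs : 0 < Real.sqrt (2 * τ) := by positivity
    have h1 : ∀ z, HasDerivAt (fun z => deriv Φ (y + Real.sqrt (2 * τ) * z))
        (deriv (deriv Φ) (y + Real.sqrt (2 * τ) * z) * Real.sqrt (2 * τ)) z := fun z => by
      have h2 : HasDerivAt (fun z => y + Real.sqrt (2 * τ) * z) (Real.sqrt (2 * τ)) z := by
        simpa using ((hasDerivAt_id z).const_mul (Real.sqrt (2 * τ))).const_add y
      exact (hΦ.hasDerivAt_deriv _).comp z h2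
    have h3 := integral_id_mul_gaussianReal (C := max C1 (C2 * Real.sqrt (2 * τ))) h1 (by fun_prop)
      (fun z => (hC1 _).trans (le_max_left _ _)) (fun z => by
        rw [abs_mul, abs_of_pos hs]
        exact (mul_le_mul_of_nonneg_right (hC2 _) hs.le).trans (le_max_right _ _))
    rw [integral_mul_const] at h3
    rw [← mul_left_inj' hs.ne', ← h3, ← integral_mul_const]
    congr 1; ext z; field_simp
  · exact Eventually.of_forall fun r => Continuous.aestronglyMeasurable (by fun_prop)
  · exact (integrable_const C).mono' (Continuous.aestronglyMeasurable (by fun_prop))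
      (ae_of_all _ fun z => hC _)
  · exact Continuous.aestronglyMeasurable (by fun_prop)
  · refine ae_of_all _ fun z r hr => ?_
    have hr' : τ < 2 * r := by simp only [mem_Ioi] at hr; linarith
    rw [norm_mul, norm_mul, Real.norm_of_nonneg (by positivity : 0 ≤ 1 / Real.sqrt (2 * r))]
    have hC10 : 0 ≤ C1 := (abs_nonneg _).trans (hC1 0)
    gcongr
    · exact hC1 _
    · exact le_rfl
  · exact (hid.abs.const_mul _).const_mul _
  · refine ae_of_all _ fun z r hr => ?_
    have hr' : 0 < r := by simp only [mem_Ioi] at hr; linarith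
    exact (hΦ.hasDerivAt _).comp r (((hsq r hr').mul_const z).const_add y)

/-- The Gaussian average is continuous down to `τ = 0`, where it is evaluation at `y`, so the
derivative for `τ > 0` integrates from `0`. -/
lemma gaussSmooth_eq {Φ : ℝ → ℝ} (hΦ : NeumannTest Φ) {t : ℝ} (ht : 0 ≤ t) (y : ℝ) :
    gaussSmooth Φ t y = Φ y + ∫ r in (0 : ℝ)..t, gaussSmooth (deriv (deriv Φ)) r y := by
  have h := intervalIntegral.integral_eq_sub_of_hasDerivAt_of_le (f := fun τ => gaussSmooth Φ τ y) ht
    ((continuous_gaussSmooth hΦ).comp (by fun_prop : Continuous fun τ : ℝ => (τ, y))).continuousOn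
    (fun r hr => hasDerivAt_gaussSmooth hΦ hr.1 y)
    (((continuous_gaussSmooth hΦ.deriv_deriv).comp
      (by fun_prop : Continuous fun τ : ℝ => (τ, y))).intervalIntegrable _ _)
  have h0 : gaussSmooth Φ 0 y = Φ y := by simp [gaussSmooth]
  rw [h, h0]; ring

/-! ### Source and sink positions; continuity of the free boundary and of the flux. -/

lemma offset_pos {a κ p : ℝ} (ha : 0 < a) (hκ : 0 < κ) (hp : p ∈ Ioo (-1 : ℝ) 1) :
    0 < offset a κ p := by
  have h1 : 0 < |p - 1| := abs_pos.mpr (by linarith [hp.2])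
  have h2 : 0 < |p + 1| := abs_pos.mpr (by linarith [hp.1])
  unfold offset
  positivity

lemma offset_le_right {a κ p : ℝ} (hκ1 : κ ≤ 1) (hp : p ∈ Ioo (-1 : ℝ) 1) :
    offset a κ p ≤ 1 - p := by
  have h1 : |p - 1| = 1 - p := by rw [abs_sub_comm, abs_of_pos]; linarith [hp.2]
  have h2 : 0 < 1 - p := by linarith [hp.2]
  calc offset a κ p ≤ κ * |p - 1| := (min_le_right _ _).trans (min_le_left _ _)
    _ ≤ 1 - p := by rw [h1]; nlinarith

lemma offset_neg (a κ p : ℝ) : offset a κ (-p) = offset a κ p := by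
  unfold offset
  rw [min_comm (κ * |-p - 1|), show -p - 1 = -(p + 1) by ring, show -p + 1 = -(p - 1) by ring,
    abs_neg, abs_neg]

lemma offset_le_left {a κ p : ℝ} (hκ1 : κ ≤ 1) (hp : p ∈ Ioo (-1 : ℝ) 1) :
    offset a κ p ≤ 1 + p := by
  rw [← offset_neg]
  have := offset_le_right (a := a) hκ1 (p := -p) ⟨by linarith [hp.2], by linarith [hp.1]⟩
  linarith

lemma continuous_offset (a κ : ℝ) : Continuous (offset a κ) := by
  unfold offset; fun_prop

/-- A solution of the free boundary problem on `[0,T)`, without the conditions on the initial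
datum that play no role for the integrability of the flux. -/
structure DuhamelSolution (a κ T : ℝ) (fI : ℝ → ℝ) (f : ℝ → ℝ → ℝ) (p : ℝ → ℝ) : Prop where
  a_pos : 0 < a
  κ_pos : 0 < κ
  κ_le : κ ≤ 1
  T_pos : 0 < T
  continuousOn_initial : ContinuousOn fI (Icc (-1) 1)
  zeroSet : ∀ t ∈ Ioo 0 T, {x ∈ Icc (-1 : ℝ) 1 | f x t = 0} = {p t}
  mem_Ioo : ∀ t ∈ Ioo 0 T, p t ∈ Ioo (-1 : ℝ) 1
  smooth : ∀ t ∈ Ioo 0 T, ∃ U ∈ 𝓝 (p t, t), ContDiffOn ℝ ∞ (fun z : ℝ × ℝ => f z.1 z.2) U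
  flux_pos : ∀ t ∈ Ioo 0 T, 0 < flux f p t
  bounded : ∀ T' ∈ Ioo 0 T, ∃ C, ∀ t ∈ Ioc 0 T', ∀ x ∈ Icc (-1 : ℝ) 1, |f x t| ≤ C
  flux_integrable : ∀ T' ∈ Ioo 0 T, IntegrableOn (flux f p) (Ioc 0 T')
  duhamel : ∀ t ∈ Ioo 0 T, ∀ x ∈ Icc (-1 : ℝ) 1,
    f x t = (∫ y in (-1 : ℝ)..1, neumannKernel x y t * fI y)
      + ∫ s in (0 : ℝ)..t,
          (neumannKernel x (p s - offset a κ (p s)) (t - s)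
            - neumannKernel x (p s + offset a κ (p s)) (t - s)) * flux f p s

/-- `f` is smooth on the closed square of half-width `ε` around `(x₀,t₀)`. -/
def SmoothBox (f : ℝ → ℝ → ℝ) (x₀ t₀ ε : ℝ) : Prop :=
  ∀ x ∈ Icc (x₀ - ε) (x₀ + ε), ∀ t ∈ Icc (t₀ - ε) (t₀ + ε),
    ContDiffAt ℝ ∞ (fun z : ℝ × ℝ => f z.1 z.2) (x, t)

/-- The partial derivative in the first variable. -/
noncomputable def dx (f : ℝ → ℝ → ℝ) (x t : ℝ) : ℝ := fderiv ℝ (fun z : ℝ × ℝ => f z.1 z.2) (x, t) (1, 0)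

/-- The partial derivative in the second variable. -/
noncomputable def dt (f : ℝ → ℝ → ℝ) (x t : ℝ) : ℝ := fderiv ℝ (fun z : ℝ × ℝ => f z.1 z.2) (x, t) (0, 1)

lemma hasDerivAt_dx {f : ℝ → ℝ → ℝ} {x t : ℝ}
    (h : ContDiffAt ℝ ∞ (fun z : ℝ × ℝ => f z.1 z.2) (x, t)) :
    HasDerivAt (fun x => f x t) (dx f x t) x := by
  have h1 : HasDerivAt (fun x : ℝ => (x, t)) ((1 : ℝ), (0 : ℝ)) x :=
    (hasDerivAt_id x).prodMk (hasDerivAt_const x t)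
  exact ((h.differentiableAt (by simp)).hasFDerivAt).comp_hasDerivAt x h1

lemma hasDerivAt_dt {f : ℝ → ℝ → ℝ} {x t : ℝ}
    (h : ContDiffAt ℝ ∞ (fun z : ℝ × ℝ => f z.1 z.2) (x, t)) :
    HasDerivAt (fun t => f x t) (dt f x t) t := by
  have h1 : HasDerivAt (fun t : ℝ => (x, t)) ((0 : ℝ), (1 : ℝ)) t :=
    (hasDerivAt_const t x).prodMk (hasDerivAt_id t)
  exact ((h.differentiableAt (by simp)).hasFDerivAt).comp_hasDerivAt t h1

lemma contDiffAt_dx {f : ℝ → ℝ → ℝ} {q : ℝ × ℝ}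
    (h : ContDiffAt ℝ ∞ (fun z : ℝ × ℝ => f z.1 z.2) q) :
    ContDiffAt ℝ ∞ (fun z : ℝ × ℝ => dx f z.1 z.2) q :=
  (h.fderiv_right (m := ∞) (by simp)).clm_apply contDiffAt_const

lemma contDiffAt_dt {f : ℝ → ℝ → ℝ} {q : ℝ × ℝ}
    (h : ContDiffAt ℝ ∞ (fun z : ℝ × ℝ => f z.1 z.2) q) :
    ContDiffAt ℝ ∞ (fun z : ℝ × ℝ => dt f z.1 z.2) q :=
  (h.fderiv_right (m := ∞) (by simp)).clm_apply contDiffAt_const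

lemma SmoothBox.mono {f : ℝ → ℝ → ℝ} {x₀ t₀ ε ε' : ℝ} (h : SmoothBox f x₀ t₀ ε) (hε : ε' ≤ ε) :
    SmoothBox f x₀ t₀ ε' := fun x hx t ht =>
  h x ⟨by linarith [hx.1], by linarith [hx.2]⟩ t ⟨by linarith [ht.1], by linarith [ht.2]⟩

lemma SmoothBox.dx {f : ℝ → ℝ → ℝ} {x₀ t₀ ε : ℝ} (h : SmoothBox f x₀ t₀ ε) :
    SmoothBox (dx f) x₀ t₀ ε := fun x hx t ht => contDiffAt_dx (h x hx t ht)

lemma SmoothBox.dt {f : ℝ → ℝ → ℝ} {x₀ t₀ ε : ℝ} (h : SmoothBox f x₀ t₀ ε) :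
    SmoothBox (dt f) x₀ t₀ ε := fun x hx t ht => contDiffAt_dt (h x hx t ht)

lemma SmoothBox.continuousOn {f : ℝ → ℝ → ℝ} {x₀ t₀ ε : ℝ} (h : SmoothBox f x₀ t₀ ε) :
    ContinuousOn (fun z : ℝ × ℝ => f z.1 z.2)
      (Icc (x₀ - ε) (x₀ + ε) ×ˢ Icc (t₀ - ε) (t₀ + ε)) := fun z hz =>
  (h z.1 hz.1 z.2 hz.2).continuousAt.continuousWithinAt

lemma SmoothBox.continuousOn_left {f : ℝ → ℝ → ℝ} {x₀ t₀ ε t : ℝ} (h : SmoothBox f x₀ t₀ ε)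
    (ht : t ∈ Icc (t₀ - ε) (t₀ + ε)) : ContinuousOn (fun x => f x t) (Icc (x₀ - ε) (x₀ + ε)) :=
  fun x hx => (hasDerivAt_dx (h x hx t ht)).continuousAt.continuousWithinAt

namespace DuhamelSolution

variable {a κ T : ℝ} {fI : ℝ → ℝ} {f : ℝ → ℝ → ℝ} {p : ℝ → ℝ} {t : ℝ}

lemma source_mem (h : DuhamelSolution a κ T fI f p) (ht : t ∈ Ioo 0 T) :
    p t - offset a κ (p t) ∈ Icc (-1 : ℝ) 1 := by
  have h1 := offset_pos h.a_pos h.κ_pos (h.mem_Ioo t ht)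
  have h2 := offset_le_left (a := a) h.κ_le (h.mem_Ioo t ht)
  have h3 := h.mem_Ioo t ht
  constructor <;> linarith [h3.1, h3.2]

lemma sink_mem (h : DuhamelSolution a κ T fI f p) (ht : t ∈ Ioo 0 T) :
    p t + offset a κ (p t) ∈ Icc (-1 : ℝ) 1 := by
  have h1 := offset_pos h.a_pos h.κ_pos (h.mem_Ioo t ht)
  have h2 := offset_le_right (a := a) h.κ_le (h.mem_Ioo t ht)
  have h3 := h.mem_Ioo t ht
  constructor <;> linarith [h3.1, h3.2]

lemma eq_zero (h : DuhamelSolution a κ T fI f p) (ht : t ∈ Ioo 0 T) : f (p t) t = 0 := by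
  have : p t ∈ {x ∈ Icc (-1 : ℝ) 1 | f x t = 0} := by rw [h.zeroSet t ht]; rfl
  exact this.2

lemma eq_of_eq_zero (h : DuhamelSolution a κ T fI f p) (ht : t ∈ Ioo 0 T) {x : ℝ}
    (hx : x ∈ Icc (-1 : ℝ) 1) (h0 : f x t = 0) : x = p t := by
  have : x ∈ {x ∈ Icc (-1 : ℝ) 1 | f x t = 0} := ⟨hx, h0⟩
  rwa [h.zeroSet t ht] at this

lemma exists_smoothBox (h : DuhamelSolution a κ T fI f p) (ht : t ∈ Ioo 0 T) :
    ∃ ε, 0 < ε ∧ SmoothBox f (p t) t ε := by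
  obtain ⟨U, hU, hf⟩ := h.smooth t ht
  obtain ⟨ε, hε, hb⟩ := Metric.nhds_basis_closedBall.mem_iff.mp (interior_mem_nhds.mpr hU)
  refine ⟨ε, hε, fun x hx s hs => hf.contDiffAt (mem_interior_iff_mem_nhds.mp (hb ?_))⟩
  rw [← closedBall_prod_same, Real.closedBall_eq_Icc, Real.closedBall_eq_Icc]
  exact ⟨hx, hs⟩

/-- The slope at the zero is strictly negative, so `f` changes sign between `p t - r` and `p t + r`.
The two signs persist for nearby times, the intermediate value theorem gives a zero in between, and
uniqueness of the zero identifies it with `p s`. -/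
lemma continuousAt_boundary (h : DuhamelSolution a κ T fI f p) (ht : t ∈ Ioo 0 T) :
    ContinuousAt p t := by
  obtain ⟨ε, hε, hb⟩ := h.exists_smoothBox ht
  have hp := h.mem_Ioo t ht
  have hcen : ContDiffAt ℝ ∞ (fun z : ℝ × ℝ => f z.1 z.2) (p t, t) :=
    hb _ ⟨by linarith, by linarith⟩ _ ⟨by linarith, by linarith⟩
  have hd : HasDerivAt (fun x => f x t) (-flux f p t) (p t) := by
    have := hasDerivAt_dx hcen
    rwa [flux, neg_neg, this.deriv]
  have hneg : -flux f p t < 0 := neg_lt_zero.mpr (h.flux_pos t ht)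
  rw [Metric.continuousAt_iff']
  intro η hη
  have hslope := hasDerivAt_iff_tendsto_slope.mp hd
  have hev := (hslope.eventually (gt_mem_nhds hneg))
  rw [eventually_nhdsWithin_iff, Metric.eventually_nhds_iff] at hev
  obtain ⟨δ, hδ, hev⟩ := hev
  set r := min (min ε (η / 2)) (min (δ / 2) (min (p t + 1) (1 - p t))) with hr
  have hr0 : 0 < r := by
    simp only [hr, lt_min_iff]
    exact ⟨⟨hε, by linarith⟩, by linarith, by linarith [hp.1], by linarith [hp.2]⟩
  have hr1 : r ≤ ε := (min_le_left _ _).trans (min_le_left _ _)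
  have hr2 : r ≤ η / 2 := (min_le_left _ _).trans (min_le_right _ _)
  have hr3 : r ≤ δ / 2 := (min_le_right _ _).trans (min_le_left _ _)
  have hr4 : r ≤ p t + 1 := (min_le_right _ _).trans ((min_le_right _ _).trans (min_le_left _ _))
  have hr5 : r ≤ 1 - p t := (min_le_right _ _).trans ((min_le_right _ _).trans (min_le_right _ _))
  have hL : 0 < f (p t - r) t := by
    have := hev (y := p t - r) (by rw [Real.dist_eq]; simp [abs_of_pos hr0]; linarith)
      (by simp; exact hr0.ne')
    rw [slope_def_field, h.eq_zero ht] at this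
    by_contra hc
    have : 0 ≤ (f (p t - r) t - 0) / (p t - r - p t) :=
      div_nonneg_of_nonpos (by linarith) (by linarith)
    linarith
  have hR : f (p t + r) t < 0 := by
    have := hev (y := p t + r) (by rw [Real.dist_eq]; simp [abs_of_pos hr0]; linarith)
      (by simp; exact hr0.ne')
    rw [slope_def_field, h.eq_zero ht] at this
    by_contra hc
    have : 0 ≤ (f (p t + r) t - 0) / (p t + r - p t) :=
      div_nonneg (by linarith) (by linarith)
    linarith
  have htt : t ∈ Icc (t - ε) (t + ε) := ⟨by linarith, by linarith⟩
  have hcL := (hasDerivAt_dt (hb (p t - r) ⟨by linarith, by linarith⟩ t htt)).continuousAt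
  have hcR := (hasDerivAt_dt (hb (p t + r) ⟨by linarith, by linarith⟩ t htt)).continuousAt
  filter_upwards [hcL.eventually (lt_mem_nhds hL), hcR.eventually (gt_mem_nhds hR),
    Icc_mem_nhds (show t - ε < t by linarith) (show t < t + ε by linarith),
    Ioo_mem_nhds ht.1 ht.2] with s h1 h2 h3 h4
  have hivt := intermediate_value_Icc' (show p t - r ≤ p t + r by linarith)
    ((hb.continuousOn_left h3).mono (Icc_subset_Icc (by linarith) (by linarith)))
  obtain ⟨x, hx, hx0⟩ := hivt ⟨h2.le, h1.le⟩
  have hxp := h.eq_of_eq_zero h4 (x := x) ⟨by linarith [hx.1], by linarith [hx.2]⟩ hx0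
  rw [← hxp, Real.dist_eq, abs_lt]
  constructor <;> linarith [hx.1, hx.2]

lemma flux_eq_neg_dx (h : DuhamelSolution a κ T fI f p) (ht : t ∈ Ioo 0 T) :
    flux f p t = -dx f (p t) t := by
  obtain ⟨ε, hε, hb⟩ := h.exists_smoothBox ht
  rw [flux, (hasDerivAt_dx (hb _ ⟨by linarith, by linarith⟩ _ ⟨by linarith, by linarith⟩)).deriv]

lemma continuousAt_flux (h : DuhamelSolution a κ T fI f p) (ht : t ∈ Ioo 0 T) :
    ContinuousAt (flux f p) t := by
  obtain ⟨ε, hε, hb⟩ := h.exists_smoothBox ht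
  have h1 : ContinuousAt (fun s => -dx f (p s) s) t := by
    have := (hb.dx (p t) ⟨by linarith, by linarith⟩ t ⟨by linarith, by linarith⟩).continuousAt
    exact (this.comp (f := fun s => (p s, s)) ((h.continuousAt_boundary ht).prodMk continuousAt_id)).neg
  refine h1.congr ?_
  filter_upwards [Ioo_mem_nhds ht.1 ht.2] with s hs
  exact (h.flux_eq_neg_dx hs).symm

lemma continuousOn_boundary (h : DuhamelSolution a κ T fI f p) : ContinuousOn p (Ioo 0 T) :=
  fun _ ht => (h.continuousAt_boundary ht).continuousWithinAt

lemma continuousOn_flux (h : DuhamelSolution a κ T fI f p) : ContinuousOn (flux f p) (Ioo 0 T) :=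
  fun _ ht => (h.continuousAt_flux ht).continuousWithinAt

end DuhamelSolution

/-! ### Duhamel integrals along a path, paired with test functions. -/

namespace DuhamelSolution

variable {a κ T : ℝ} {fI : ℝ → ℝ} {f : ℝ → ℝ → ℝ} {p : ℝ → ℝ} {t : ℝ}

lemma integrableOn_flux (h : DuhamelSolution a κ T fI f p) (ht : t ∈ Ioo 0 T) :
    IntegrableOn (flux f p) (Ioo 0 t) :=
  (h.flux_integrable t ht).mono_set Ioo_subset_Ioc_self

/-- The two singularities are separated: up to `t/2` the flux is integrable and the square root is
bounded below, while on `[t/2, t]` the flux is continuous, hence bounded, and `(t - s)^(-1/2)` is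
integrable. -/
lemma integrableOn_flux_mul_inv_sqrt (h : DuhamelSolution a κ T fI f p) (ht : t ∈ Ioo 0 T) :
    IntegrableOn (fun s => flux f p s * (1 / Real.sqrt (t - s))) (Ioo 0 t) := by
  obtain ⟨ht0, htT⟩ := ht
  have hcont : ContinuousOn (fun s => flux f p s * (1 / Real.sqrt (t - s))) (Ioo 0 t) := by
    apply (h.continuousOn_flux.mono (Ioo_subset_Ioo_right htT.le)).mul
    apply ContinuousOn.div continuousOn_const (by fun_prop)
    intro s hs
    have : 0 < t - s := by linarith [hs.2]
    positivity
  have hmeas := hcont.aestronglyMeasurable (μ := volume) measurableSet_Ioo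
  have hsplit : Ioo 0 t ⊆ Ioc 0 (t / 2) ∪ Ioo (t / 2) t := fun s hs => by
    rcases le_or_gt s (t / 2) with h1 | h1
    · exact Or.inl ⟨hs.1, h1⟩
    · exact Or.inr ⟨h1, hs.2⟩
  refine IntegrableOn.mono_set (IntegrableOn.union ?_ ?_) hsplit
  · have h1 := (h.flux_integrable (t / 2) ⟨by linarith, by linarith⟩).norm.mul_const
      (1 / Real.sqrt (t / 2))
    refine Integrable.mono' h1 (hmeas.mono_set (show Ioc 0 (t / 2) ⊆ Ioo 0 t from
      fun s hs => ⟨hs.1, by linarith [hs.2]⟩)) ?_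
    rw [ae_restrict_iff' measurableSet_Ioc]
    refine ae_of_all _ fun s hs => ?_
    rw [norm_mul, Real.norm_of_nonneg (by positivity : 0 ≤ 1 / Real.sqrt (t - s))]
    gcongr
    linarith [hs.2]
  · obtain ⟨C, hC⟩ := isCompact_Icc.exists_bound_of_continuousOn
      (h.continuousOn_flux.mono (s := Ioo 0 T) (t := Icc (t / 2) t)
        fun s hs => ⟨by linarith [hs.1], by linarith [hs.2]⟩)
    have h1 : IntegrableOn (fun s => C * (t - s) ^ (-(1 / 2) : ℝ)) (Ioo (t / 2) t) := by
      have := (intervalIntegral.intervalIntegrable_rpow' (r := -(1 / 2)) (a := t / 2) (b := 0)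
        (by norm_num)).comp_sub_left t
      rw [sub_zero, intervalIntegrable_iff_integrableOn_Ioo_of_le (by linarith)] at this
      refine Integrable.const_mul ?_ C
      rwa [show t - t / 2 = t / 2 by ring] at this
    refine Integrable.mono' h1 (hmeas.mono_set (show Ioo (t / 2) t ⊆ Ioo 0 t from
      fun s hs => ⟨by linarith [hs.1], hs.2⟩)) ?_
    rw [ae_restrict_iff' measurableSet_Ioo]
    refine ae_of_all _ fun s hs => ?_
    have hs' : 0 < t - s := by linarith [hs.2]
    rw [norm_mul, Real.norm_of_nonneg (by positivity : 0 ≤ 1 / Real.sqrt (t - s)),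
      Real.rpow_neg hs'.le, ← Real.sqrt_eq_rpow, one_div]
    gcongr
    exact hC s ⟨hs.1.le, hs.2.le⟩

section path

variable {Y : ℝ → ℝ}

lemma continuousOn_kernel_path (h : DuhamelSolution a κ T fI f p) (ht : t ∈ Ioo 0 T)
    (hY : ContinuousOn Y (Ioo 0 T)) (hYm : ∀ s ∈ Ioo 0 T, Y s ∈ Icc (-1 : ℝ) 1) :
    ContinuousOn (fun q : ℝ × ℝ => neumannKernel q.1 (Y q.2) (t - q.2) * flux f p q.2)
      (Icc (-1) 1 ×ˢ Ioo 0 t) := by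
  have hsub : Ioo 0 t ⊆ Ioo 0 T := Ioo_subset_Ioo_right ht.2.le
  have h2 : MapsTo (Prod.snd : ℝ × ℝ → ℝ) (Icc (-1) 1 ×ˢ Ioo 0 t) (Ioo 0 T) :=
    fun q hq => hsub hq.2
  apply ContinuousOn.mul
  · refine (continuousOn_neumannKernel t).comp
      (f := fun q : ℝ × ℝ => (q.1, Y q.2, t - q.2)) ?_ ?_
    · exact continuousOn_fst.prodMk ((hY.comp continuousOn_snd h2).prodMk (by fun_prop))
    · intro q hq
      exact ⟨hq.1, hYm _ (hsub hq.2), by linarith [hq.2.2], by linarith [hq.2.1]⟩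
  · exact h.continuousOn_flux.comp continuousOn_snd h2

lemma exists_kernel_path_le (h : DuhamelSolution a κ T fI f p) (ht : t ∈ Ioo 0 T)
    (hYm : ∀ s ∈ Ioo 0 T, Y s ∈ Icc (-1 : ℝ) 1) :
    ∃ C, ∀ x ∈ Icc (-1 : ℝ) 1, ∀ s ∈ Ioo 0 t,
      ‖neumannKernel x (Y s) (t - s) * flux f p s‖ ≤
        C * (flux f p s * (1 / Real.sqrt (t - s))) := by
  obtain ⟨C, hC0, hC⟩ := exists_neumannKernel_le t
  refine ⟨C, fun x hx s hs => ?_⟩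
  have hs' : s ∈ Ioo 0 T := ⟨hs.1, hs.2.trans ht.2⟩
  have h1 := hC x hx (Y s) (hYm s hs') (t - s) ⟨by linarith [hs.2], by linarith [hs.1]⟩
  have h2 := h.flux_pos s hs'
  rw [norm_mul, Real.norm_of_nonneg (neumannKernel_nonneg _ _ _), Real.norm_of_nonneg h2.le]
  calc _ ≤ C / Real.sqrt (t - s) * flux f p s := by gcongr
    _ = _ := by ring

lemma intervalIntegrable_kernel_path (h : DuhamelSolution a κ T fI f p) (ht : t ∈ Ioo 0 T)
    (hY : ContinuousOn Y (Ioo 0 T)) (hYm : ∀ s ∈ Ioo 0 T, Y s ∈ Icc (-1 : ℝ) 1) {x : ℝ}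
    (hx : x ∈ Icc (-1 : ℝ) 1) :
    IntervalIntegrable (fun s => neumannKernel x (Y s) (t - s) * flux f p s) volume 0 t := by
  rw [intervalIntegrable_iff_integrableOn_Ioo_of_le ht.1.le]
  obtain ⟨C, hC⟩ := h.exists_kernel_path_le ht hYm
  refine Integrable.mono' ((h.integrableOn_flux_mul_inv_sqrt ht).const_mul C) ?_ ?_
  · refine ContinuousOn.aestronglyMeasurable ?_ measurableSet_Ioo
    exact (h.continuousOn_kernel_path ht hY hYm).comp (f := fun s : ℝ => (x, s)) (by fun_prop)
      fun s hs => ⟨hx, hs⟩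
  · rw [ae_restrict_iff' measurableSet_Ioo]
    exact ae_of_all _ (hC x hx)

lemma continuousOn_integral_kernel_path (h : DuhamelSolution a κ T fI f p) (ht : t ∈ Ioo 0 T)
    (hY : ContinuousOn Y (Ioo 0 T)) (hYm : ∀ s ∈ Ioo 0 T, Y s ∈ Icc (-1 : ℝ) 1) :
    ContinuousOn (fun x => ∫ s in (0 : ℝ)..t, neumannKernel x (Y s) (t - s) * flux f p s)
      (Icc (-1) 1) := by
  obtain ⟨C, hC⟩ := h.exists_kernel_path_le ht hYm
  simp_rw [intervalIntegral.integral_of_le ht.1.le, integral_Ioc_eq_integral_Ioo]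
  refine continuousOn_of_dominated (bound := fun s => C * (flux f p s * (1 / Real.sqrt (t - s))))
    (fun x hx => ?_) (fun x hx => ?_) ((h.integrableOn_flux_mul_inv_sqrt ht).const_mul C) ?_
  · refine ContinuousOn.aestronglyMeasurable ?_ measurableSet_Ioo
    exact (h.continuousOn_kernel_path ht hY hYm).comp (f := fun s : ℝ => (x, s)) (by fun_prop)
      fun s hs => ⟨hx, hs⟩
  · rw [ae_restrict_iff' measurableSet_Ioo]
    exact ae_of_all _ (hC x hx)
  · rw [ae_restrict_iff' measurableSet_Ioo]
    refine ae_of_all _ fun s hs => ?_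
    exact (h.continuousOn_kernel_path ht hY hYm).comp (f := fun x : ℝ => (x, s)) (by fun_prop)
      fun x hx => ⟨hx, hs⟩

lemma integral_integral_kernel_path (h : DuhamelSolution a κ T fI f p) (ht : t ∈ Ioo 0 T)
    (hY : ContinuousOn Y (Ioo 0 T)) (hYm : ∀ s ∈ Ioo 0 T, Y s ∈ Icc (-1 : ℝ) 1) {Φ : ℝ → ℝ}
    (hΦ : NeumannTest Φ) :
    ∫ x in (-1 : ℝ)..1, (∫ s in (0 : ℝ)..t, neumannKernel x (Y s) (t - s) * flux f p s) * Φ x =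
      ∫ s in (0 : ℝ)..t, gaussSmooth Φ (t - s) (Y s) * flux f p s := by
  obtain ⟨C, hC⟩ := h.exists_kernel_path_le ht hYm
  obtain ⟨D, hD⟩ := hΦ.exists_bound
  rw [intervalIntegral.integral_of_le (by norm_num : (-1 : ℝ) ≤ 1),
    intervalIntegral.integral_of_le ht.1.le, integral_Ioc_eq_integral_Ioo,
    integral_Ioc_eq_integral_Ioo]
  simp_rw [intervalIntegral.integral_of_le ht.1.le, integral_Ioc_eq_integral_Ioo,
    ← integral_mul_const]
  rw [integral_integral_swap]
  · refine setIntegral_congr_fun measurableSet_Ioo fun s hs => ?_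
    have hs' : s ∈ Ioo 0 T := ⟨hs.1, hs.2.trans ht.2⟩
    rw [← integral_neumannKernel_mul hΦ (by linarith [hs.2]) (hYm s hs'),
      intervalIntegral.integral_of_le (by norm_num : (-1 : ℝ) ≤ 1), integral_Ioc_eq_integral_Ioo,
      ← integral_mul_const]
    congr 1; ext x; ring
  · have hb : Integrable (fun q : ℝ × ℝ => D * (C * (flux f p q.2 * (1 / Real.sqrt (t - q.2)))))
        ((volume.restrict (Ioo (-1 : ℝ) 1)).prod (volume.restrict (Ioo 0 t))) := by
      have := (integrable_const (μ := volume.restrict (Ioo (-1 : ℝ) 1)) D).mul_prod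
        ((h.integrableOn_flux_mul_inv_sqrt ht).const_mul C)
      exact this
    refine Integrable.mono' hb ?_ ?_
    · rw [Measure.prod_restrict]
      refine ContinuousOn.aestronglyMeasurable ?_ (measurableSet_Ioo.prod measurableSet_Ioo)
      refine ContinuousOn.mul ((h.continuousOn_kernel_path ht hY hYm).mono
        (prod_mono_left Ioo_subset_Icc_self)) ?_
      exact (hΦ.continuous.comp continuous_fst).continuousOn
    · rw [Measure.prod_restrict, ae_restrict_iff' (measurableSet_Ioo.prod measurableSet_Ioo)]
      refine ae_of_all _ fun q hq => ?_
      simp only [Function.uncurry]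
      rw [norm_mul, mul_comm]
      have h1 := hC q.1 (Ioo_subset_Icc_self hq.1) q.2 hq.2
      exact mul_le_mul (hD _) h1 (norm_nonneg _) ((abs_nonneg _).trans (hD 0))

/-- Supplies Fubini on the triangle `s < r`. After smoothing the test function instead of the source
no kernel singularity is left, so integrability of the flux suffices. -/
lemma integrable_triangle (h : DuhamelSolution a κ T fI f p) (ht : t ∈ Ioo 0 T)
    (hY : ContinuousOn Y (Ioo 0 T)) {Φ : ℝ → ℝ} (hΦ : NeumannTest Φ) :
    Integrable ({q : ℝ × ℝ | q.1 < q.2}.indicator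
        fun q => gaussSmooth Φ (q.2 - q.1) (Y q.1) * flux f p q.1)
      ((volume.restrict (Ioo 0 t)).prod (volume.restrict (Ioo 0 t))) := by
  obtain ⟨D, hD⟩ := hΦ.exists_bound
  have hb : Integrable (fun q : ℝ × ℝ => flux f p q.1 * D)
      ((volume.restrict (Ioo 0 t)).prod (volume.restrict (Ioo 0 t))) :=
    (h.integrableOn_flux ht).mul_prod (integrable_const D)
  refine Integrable.indicator (Integrable.mono' hb ?_ ?_) (measurableSet_lt measurable_fst
    measurable_snd)
  · rw [Measure.prod_restrict]
    refine ContinuousOn.aestronglyMeasurable ?_ (measurableSet_Ioo.prod measurableSet_Ioo)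
    have h2 : MapsTo (Prod.fst : ℝ × ℝ → ℝ) (Ioo 0 t ×ˢ Ioo 0 t) (Ioo 0 T) :=
      fun q hq => ⟨hq.1.1, hq.1.2.trans ht.2⟩
    refine ContinuousOn.mul ?_ (h.continuousOn_flux.comp continuousOn_fst h2)
    exact (continuous_gaussSmooth hΦ).comp_continuousOn
      (f := fun q : ℝ × ℝ => (q.2 - q.1, Y q.1))
      (ContinuousOn.prodMk (by fun_prop) (hY.comp continuousOn_fst h2))
  · rw [Measure.prod_restrict, ae_restrict_iff' (measurableSet_Ioo.prod measurableSet_Ioo)]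
    refine ae_of_all _ fun q hq => ?_
    have h2 := h.flux_pos q.1 ⟨hq.1.1, hq.1.2.trans ht.2⟩
    rw [norm_mul, Real.norm_of_nonneg h2.le, mul_comm]
    exact mul_le_mul_of_nonneg_left (abs_gaussSmooth_le hD _ _) h2.le

lemma integral_indicator_triangle (g : ℝ → ℝ → ℝ) {r : ℝ} (hr : r ∈ Ioo 0 t) :
    ∫ s in Ioo 0 t, {q : ℝ × ℝ | q.1 < q.2}.indicator (fun q => g q.1 q.2) (s, r) =
      ∫ s in (0 : ℝ)..r, g s r := by
  rw [intervalIntegral.integral_of_le hr.1.le, integral_Ioc_eq_integral_Ioo,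
    ← integral_indicator measurableSet_Ioo, ← integral_indicator measurableSet_Ioo]
  congr 1; ext s
  by_cases h1 : s ∈ Ioo 0 r
  · have h2 : s ∈ Ioo 0 t := ⟨h1.1, h1.2.trans hr.2⟩
    rw [indicator_of_mem h1, indicator_of_mem h2, indicator_of_mem (show (s, r) ∈ {q : ℝ × ℝ | q.1 < q.2} from h1.2)]
  · rw [indicator_of_notMem h1]
    by_cases h2 : s ∈ Ioo 0 t
    · rw [indicator_of_mem h2, indicator_of_notMem
        (show (s, r) ∉ {q : ℝ × ℝ | q.1 < q.2} from fun h3 => h1 ⟨h2.1, h3⟩)]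
    · rw [indicator_of_notMem h2]

lemma intervalIntegrable_inner (h : DuhamelSolution a κ T fI f p) (ht : t ∈ Ioo 0 T)
    (hY : ContinuousOn Y (Ioo 0 T)) {Φ : ℝ → ℝ} (hΦ : NeumannTest Φ) :
    IntervalIntegrable (fun r => ∫ s in (0 : ℝ)..r, gaussSmooth Φ (r - s) (Y s) * flux f p s)
      volume 0 t := by
  rw [intervalIntegrable_iff_integrableOn_Ioo_of_le ht.1.le]
  have := (h.integrable_triangle ht hY hΦ).integral_prod_right
  refine IntegrableOn.congr_fun (f := _) this (fun r hr => ?_) measurableSet_Ioo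
  exact integral_indicator_triangle (fun s r => gaussSmooth Φ (r - s) (Y s) * flux f p s) hr

/-- Insert `gaussSmooth_eq` under the integral and exchange the order on `s < r < t`: the inner
integral becomes the same path term at time `r`, tested with the second derivative. -/
lemma integral_gaussSmooth_path (h : DuhamelSolution a κ T fI f p) (ht : t ∈ Ioo 0 T)
    (hY : ContinuousOn Y (Ioo 0 T)) {Φ : ℝ → ℝ} (hΦ : NeumannTest Φ) :
    ∫ s in (0 : ℝ)..t, gaussSmooth Φ (t - s) (Y s) * flux f p s =
      (∫ s in (0 : ℝ)..t, Φ (Y s) * flux f p s) + ∫ r in (0 : ℝ)..t,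
        ∫ s in (0 : ℝ)..r, gaussSmooth (deriv (deriv Φ)) (r - s) (Y s) * flux f p s := by
  have hint := h.integrable_triangle ht hY hΦ.deriv_deriv
  have e1 : ∀ s ∈ Ioo 0 t, gaussSmooth Φ (t - s) (Y s) * flux f p s = Φ (Y s) * flux f p s +
      ∫ r in Ioo 0 t, {q : ℝ × ℝ | q.1 < q.2}.indicator
        (fun q => gaussSmooth (deriv (deriv Φ)) (q.2 - q.1) (Y q.1) * flux f p q.1) (s, r) := by
    intro s hs
    have h1 : ∫ r in Ioo 0 t, {q : ℝ × ℝ | q.1 < q.2}.indicator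
        (fun q => gaussSmooth (deriv (deriv Φ)) (q.2 - q.1) (Y q.1) * flux f p q.1) (s, r) =
        ∫ r in s..t, gaussSmooth (deriv (deriv Φ)) (r - s) (Y s) * flux f p s := by
      rw [intervalIntegral.integral_of_le hs.2.le, integral_Ioc_eq_integral_Ioo,
        ← integral_indicator measurableSet_Ioo, ← integral_indicator measurableSet_Ioo]
      congr 1; ext r
      by_cases h1 : r ∈ Ioo s t
      · have h2 : r ∈ Ioo 0 t := ⟨hs.1.trans h1.1, h1.2⟩
        rw [indicator_of_mem h1, indicator_of_mem h2, indicator_of_mem (show (s, r) ∈ {q : ℝ × ℝ | q.1 < q.2} from h1.1)]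
      · rw [indicator_of_notMem h1]
        by_cases h2 : r ∈ Ioo 0 t
        · rw [indicator_of_mem h2, indicator_of_notMem
            (show (s, r) ∉ {q : ℝ × ℝ | q.1 < q.2} from fun h3 => h1 ⟨h3, h2.2⟩)]
        · rw [indicator_of_notMem h2]
    rw [h1, intervalIntegral.integral_mul_const,
      intervalIntegral.integral_comp_sub_right (fun r => gaussSmooth (deriv (deriv Φ)) r (Y s)),
      gaussSmooth_eq hΦ (by linarith [hs.2]), sub_self]
    ring
  obtain ⟨D, hD⟩ := hΦ.exists_bound
  have hΦi : IntegrableOn (fun s => Φ (Y s) * flux f p s) (Ioo 0 t) := by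
    refine Integrable.bdd_mul (h.integrableOn_flux ht) (c := D) ?_ (ae_of_all _ fun s => hD _)
    exact ContinuousOn.aestronglyMeasurable (hΦ.continuous.comp_continuousOn
      (hY.mono (Ioo_subset_Ioo_right ht.2.le))) measurableSet_Ioo
  simp only [intervalIntegral.integral_of_le ht.1.le, integral_Ioc_eq_integral_Ioo]
  rw [setIntegral_congr_fun measurableSet_Ioo e1, integral_add hΦi hint.integral_prod_left,
    integral_integral_swap (f := fun s r => {q : ℝ × ℝ | q.1 < q.2}.indicator
        (fun q => gaussSmooth (deriv (deriv Φ)) (q.2 - q.1) (Y q.1) * flux f p q.1) (s, r)) hint]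
  congr 1
  refine setIntegral_congr_fun measurableSet_Ioo fun r hr => ?_
  exact integral_indicator_triangle
    (fun s r => gaussSmooth (deriv (deriv Φ)) (r - s) (Y s) * flux f p s) hr

end path

end DuhamelSolution

/-! ### The contribution of the initial datum. -/

lemma continuousOn_initial_kernel {fI : ℝ → ℝ} (hfI : ContinuousOn fI (Icc (-1) 1)) {t : ℝ}
    (ht : 0 < t) : ContinuousOn (fun q : ℝ × ℝ => neumannKernel q.1 q.2 t * fI q.2)
      (Icc (-1) 1 ×ˢ Icc (-1) 1) := by
  refine ContinuousOn.mul ?_ (hfI.comp continuousOn_snd fun q hq => hq.2)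
  exact (continuousOn_neumannKernel t).comp (f := fun q : ℝ × ℝ => (q.1, q.2, t)) (by fun_prop)
    fun q hq => ⟨hq.1, hq.2, ht, le_rfl⟩

lemma continuousOn_integral_initial {fI : ℝ → ℝ} (hfI : ContinuousOn fI (Icc (-1) 1)) {t : ℝ}
    (ht : 0 < t) :
    ContinuousOn (fun x => ∫ y in (-1 : ℝ)..1, neumannKernel x y t * fI y) (Icc (-1) 1) := by
  have hc := continuousOn_initial_kernel hfI ht
  obtain ⟨C, hC⟩ := (isCompact_Icc.prod isCompact_Icc).exists_bound_of_continuousOn hc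
  simp_rw [intervalIntegral.integral_of_le (by norm_num : (-1 : ℝ) ≤ 1)]
  refine continuousOn_of_dominated (bound := fun _ => C)
    (fun x hx => ?_) (fun x hx => ?_) (integrable_const C) ?_
  · refine (ContinuousOn.aestronglyMeasurable ?_ measurableSet_Icc).mono_set Ioc_subset_Icc_self
    exact hc.comp (f := fun s : ℝ => (x, s)) (by fun_prop) fun s hs => ⟨hx, hs⟩
  · rw [ae_restrict_iff' measurableSet_Ioc]
    exact ae_of_all _ fun y hy => hC (x, y) ⟨hx, Ioc_subset_Icc_self hy⟩
  · rw [ae_restrict_iff' measurableSet_Ioc]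
    refine ae_of_all _ fun y hy => ?_
    exact hc.comp (f := fun x : ℝ => (x, y)) (by fun_prop) fun x hx => ⟨hx, Ioc_subset_Icc_self hy⟩

lemma integrable_prod_of_continuousOn {g : ℝ × ℝ → ℝ} {b c d e : ℝ}
    (hg : ContinuousOn g (Icc b c ×ˢ Icc d e)) :
    Integrable g ((volume.restrict (Ioc b c)).prod (volume.restrict (Ioc d e))) := by
  rw [Measure.prod_restrict]
  exact (hg.integrableOn_compact (isCompact_Icc.prod isCompact_Icc)).mono_set
    (prod_mono Ioc_subset_Icc_self Ioc_subset_Icc_self)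

lemma integral_integral_initial {fI : ℝ → ℝ} (hfI : ContinuousOn fI (Icc (-1) 1)) {t : ℝ}
    (ht : 0 < t) {Φ : ℝ → ℝ} (hΦ : NeumannTest Φ) :
    ∫ x in (-1 : ℝ)..1, (∫ y in (-1 : ℝ)..1, neumannKernel x y t * fI y) * Φ x =
      ∫ y in (-1 : ℝ)..1, gaussSmooth Φ t y * fI y := by
  simp_rw [intervalIntegral.integral_of_le (by norm_num : (-1 : ℝ) ≤ 1), ← integral_mul_const]
  rw [integral_integral_swap (f := fun x y => neumannKernel x y t * fI y * Φ x)
    (integrable_prod_of_continuousOn ((continuousOn_initial_kernel hfI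
    ht).mul (hΦ.continuous.comp continuous_fst).continuousOn))]
  refine setIntegral_congr_fun measurableSet_Ioc fun y hy => ?_
  rw [← integral_neumannKernel_mul hΦ ht (Ioc_subset_Icc_self hy),
    intervalIntegral.integral_of_le (by norm_num : (-1 : ℝ) ≤ 1), ← integral_mul_const]
  congr 1; ext x; ring

lemma continuousOn_gaussSmooth_initial {fI : ℝ → ℝ} (hfI : ContinuousOn fI (Icc (-1) 1)) (t : ℝ)
    {Φ : ℝ → ℝ} (hΦ : NeumannTest Φ) :
    ContinuousOn (fun q : ℝ × ℝ => gaussSmooth Φ q.2 q.1 * fI q.1)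
      (Icc (-1) 1 ×ˢ Icc 0 t) := by
  refine ContinuousOn.mul ?_ (hfI.comp continuousOn_fst fun q hq => hq.1)
  exact ((continuous_gaussSmooth hΦ).comp (continuous_snd.prodMk continuous_fst)).continuousOn

lemma intervalIntegrable_gaussSmooth_initial {fI : ℝ → ℝ} (hfI : ContinuousOn fI (Icc (-1) 1))
    {t : ℝ} (ht : 0 ≤ t) {Φ : ℝ → ℝ} (hΦ : NeumannTest Φ) :
    IntervalIntegrable (fun r => ∫ y in (-1 : ℝ)..1, gaussSmooth Φ r y * fI y) volume 0 t := by
  rw [intervalIntegrable_iff_integrableOn_Ioc_of_le ht]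
  simp_rw [intervalIntegral.integral_of_le (by norm_num : (-1 : ℝ) ≤ 1)]
  exact (integrable_prod_of_continuousOn (continuousOn_gaussSmooth_initial hfI t hΦ)).integral_prod_right

lemma integral_gaussSmooth_initial {fI : ℝ → ℝ} (hfI : ContinuousOn fI (Icc (-1) 1)) {t : ℝ}
    (ht : 0 ≤ t) {Φ : ℝ → ℝ} (hΦ : NeumannTest Φ) :
    ∫ y in (-1 : ℝ)..1, gaussSmooth Φ t y * fI y = (∫ y in (-1 : ℝ)..1, Φ y * fI y) +
      ∫ r in (0 : ℝ)..t, ∫ y in (-1 : ℝ)..1, gaussSmooth (deriv (deriv Φ)) r y * fI y := by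
  have hint := integrable_prod_of_continuousOn (continuousOn_gaussSmooth_initial hfI t
    hΦ.deriv_deriv)
  simp_rw [intervalIntegral.integral_of_le (by norm_num : (-1 : ℝ) ≤ 1),
    intervalIntegral.integral_of_le ht]
  rw [← integral_integral_swap (f := fun y r => gaussSmooth (deriv (deriv Φ)) r y * fI y) hint,
    ← integral_add]
  · refine setIntegral_congr_fun measurableSet_Ioc fun y hy => ?_
    rw [gaussSmooth_eq hΦ ht, intervalIntegral.integral_of_le ht, integral_mul_const]
    ring
  · exact ((hΦ.continuous.continuousOn.mul hfI).integrableOn_compact isCompact_Icc).mono_set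
      Ioc_subset_Icc_self
  · exact hint.integral_prod_left

/-! ### The weak form of the equation and its differentiated version. -/

namespace DuhamelSolution

variable {a κ T : ℝ} {fI : ℝ → ℝ} {f : ℝ → ℝ → ℝ} {p : ℝ → ℝ} {t : ℝ}

lemma continuousOn_source (h : DuhamelSolution a κ T fI f p) :
    ContinuousOn (fun s => p s - offset a κ (p s)) (Ioo 0 T) :=
  h.continuousOn_boundary.sub ((continuous_offset a κ).comp_continuousOn h.continuousOn_boundary)

lemma continuousOn_sink (h : DuhamelSolution a κ T fI f p) :
    ContinuousOn (fun s => p s + offset a κ (p s)) (Ioo 0 T) :=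
  h.continuousOn_boundary.add ((continuous_offset a κ).comp_continuousOn h.continuousOn_boundary)

lemma eq_add_sub (h : DuhamelSolution a κ T fI f p) (ht : t ∈ Ioo 0 T) {x : ℝ}
    (hx : x ∈ Icc (-1 : ℝ) 1) :
    f x t = (∫ y in (-1 : ℝ)..1, neumannKernel x y t * fI y) +
      ((∫ s in (0 : ℝ)..t, neumannKernel x (p s - offset a κ (p s)) (t - s) * flux f p s) -
        ∫ s in (0 : ℝ)..t, neumannKernel x (p s + offset a κ (p s)) (t - s) * flux f p s) := by
  rw [h.duhamel t ht x hx, ← intervalIntegral.integral_sub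
    (h.intervalIntegrable_kernel_path ht h.continuousOn_source (fun s hs => h.source_mem hs) hx)
    (h.intervalIntegrable_kernel_path ht h.continuousOn_sink (fun s hs => h.sink_mem hs) hx)]
  simp_rw [sub_mul]

lemma continuousOn (h : DuhamelSolution a κ T fI f p) (ht : t ∈ Ioo 0 T) :
    ContinuousOn (fun x => f x t) (Icc (-1) 1) := by
  refine ContinuousOn.congr ?_ fun x hx => h.eq_add_sub ht hx
  exact (continuousOn_integral_initial h.continuousOn_initial ht.1).add
    ((h.continuousOn_integral_kernel_path ht h.continuousOn_source fun s hs => h.source_mem hs).sub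
    (h.continuousOn_integral_kernel_path ht h.continuousOn_sink fun s hs => h.sink_mem hs))

lemma pairing_eq (h : DuhamelSolution a κ T fI f p) (ht : t ∈ Ioo 0 T) {Φ : ℝ → ℝ}
    (hΦ : NeumannTest Φ) :
    ∫ x in (-1 : ℝ)..1, f x t * Φ x = (∫ y in (-1 : ℝ)..1, gaussSmooth Φ t y * fI y) +
      ((∫ s in (0 : ℝ)..t, gaussSmooth Φ (t - s) (p s - offset a κ (p s)) * flux f p s) -
        ∫ s in (0 : ℝ)..t, gaussSmooth Φ (t - s) (p s + offset a κ (p s)) * flux f p s) := by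
  have hle : (-1 : ℝ) ≤ 1 := by norm_num
  have hu : uIcc (-1 : ℝ) 1 = Icc (-1) 1 := uIcc_of_le hle
  have hi : ∀ g : ℝ → ℝ, ContinuousOn g (Icc (-1) 1) →
      IntervalIntegrable (fun x => g x * Φ x) volume (-1) 1 := fun g hg =>
    ContinuousOn.intervalIntegrable (by rw [hu]; exact hg.mul hΦ.continuous.continuousOn)
  have e : ∫ x in (-1 : ℝ)..1, f x t * Φ x = ∫ x in (-1 : ℝ)..1,
      ((∫ y in (-1 : ℝ)..1, neumannKernel x y t * fI y) * Φ x +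
      ((∫ s in (0 : ℝ)..t, neumannKernel x (p s - offset a κ (p s)) (t - s) * flux f p s) * Φ x -
      (∫ s in (0 : ℝ)..t, neumannKernel x (p s + offset a κ (p s)) (t - s) * flux f p s) * Φ x)) := by
    refine intervalIntegral.integral_congr fun x hx => ?_
    rw [hu] at hx
    rw [h.eq_add_sub ht hx]; ring
  have i1 := hi _ (continuousOn_integral_initial h.continuousOn_initial ht.1)
  have i2 := hi _ (h.continuousOn_integral_kernel_path ht h.continuousOn_source
    fun s hs => h.source_mem hs)
  have i3 := hi _ (h.continuousOn_integral_kernel_path ht h.continuousOn_sink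
    fun s hs => h.sink_mem hs)
  rw [e, intervalIntegral.integral_add i1 (i2.sub i3), intervalIntegral.integral_sub i2 i3,
    integral_integral_initial h.continuousOn_initial ht.1 hΦ,
    h.integral_integral_kernel_path ht h.continuousOn_source (fun s hs => h.source_mem hs) hΦ,
    h.integral_integral_kernel_path ht h.continuousOn_sink (fun s hs => h.sink_mem hs) hΦ]

lemma intervalIntegrable_path_mul_flux (h : DuhamelSolution a κ T fI f p) (ht : t ∈ Ioo 0 T)
    {Y : ℝ → ℝ} (hY : ContinuousOn Y (Ioo 0 T)) {Φ : ℝ → ℝ} (hΦ : NeumannTest Φ) :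
    IntervalIntegrable (fun s => Φ (Y s) * flux f p s) volume 0 t := by
  obtain ⟨D, hD⟩ := hΦ.exists_bound
  rw [intervalIntegrable_iff_integrableOn_Ioo_of_le ht.1.le]
  refine Integrable.bdd_mul (h.integrableOn_flux ht) (c := D) ?_ (ae_of_all _ fun s => hD _)
  exact ContinuousOn.aestronglyMeasurable (hΦ.continuous.comp_continuousOn
    (hY.mono (Ioo_subset_Ioo_right ht.2.le))) measurableSet_Ioo

/-- The rate of change of the pairing of the solution with a test function. -/
noncomputable def rate (a κ : ℝ) (f : ℝ → ℝ → ℝ) (p : ℝ → ℝ) (Φ : ℝ → ℝ) (r : ℝ) : ℝ :=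
  (∫ x in (-1 : ℝ)..1, f x r * deriv (deriv Φ) x) +
    (Φ (p r - offset a κ (p r)) - Φ (p r + offset a κ (p r))) * flux f p r

/-- In `pairing_eq` each smoothed test function is replaced by `Φ` plus a time integral of the
smoothed `Φ''`. By `pairing_eq` at time `r`, the latter terms regroup into the pairing of `f(·,r)`
with `Φ''`; the former give the initial pairing and the jump term. -/
lemma weak_form (h : DuhamelSolution a κ T fI f p) (ht : t ∈ Ioo 0 T) {Φ : ℝ → ℝ}
    (hΦ : NeumannTest Φ) :
    IntervalIntegrable (rate a κ f p Φ) volume 0 t ∧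
    ∫ x in (-1 : ℝ)..1, f x t * Φ x =
      (∫ y in (-1 : ℝ)..1, Φ y * fI y) + ∫ r in (0 : ℝ)..t, rate a κ f p Φ r := by
  have hΦ2 := hΦ.deriv_deriv
  have j1 := intervalIntegrable_gaussSmooth_initial h.continuousOn_initial ht.1.le hΦ2
  have j2 := h.intervalIntegrable_inner ht h.continuousOn_source hΦ2
  have j3 := h.intervalIntegrable_inner ht h.continuousOn_sink hΦ2
  have j4 := h.intervalIntegrable_path_mul_flux ht h.continuousOn_source hΦ
  have j5 := h.intervalIntegrable_path_mul_flux ht h.continuousOn_sink hΦ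
  have e : ∀ r ∈ Ioc 0 t, rate a κ f p Φ r =
      (∫ y in (-1 : ℝ)..1, gaussSmooth (deriv (deriv Φ)) r y * fI y) +
      ((∫ s in (0 : ℝ)..r, gaussSmooth (deriv (deriv Φ)) (r - s) (p s - offset a κ (p s)) * flux f p s) -
        ∫ s in (0 : ℝ)..r, gaussSmooth (deriv (deriv Φ)) (r - s) (p s + offset a κ (p s)) * flux f p s) +
      (Φ (p r - offset a κ (p r)) * flux f p r - Φ (p r + offset a κ (p r)) * flux f p r) := by
    intro r hr
    rw [rate, h.pairing_eq ⟨hr.1, hr.2.trans_lt ht.2⟩ hΦ2, sub_mul]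
  constructor
  · refine IntervalIntegrable.congr (f := _) ?_ ((j1.add (j2.sub j3)).add (j4.sub j5))
    intro r hr
    rw [uIoc_of_le ht.1.le] at hr
    exact (e r hr).symm
  · rw [h.pairing_eq ht hΦ, integral_gaussSmooth_initial h.continuousOn_initial ht.1.le hΦ,
      h.integral_gaussSmooth_path ht h.continuousOn_source hΦ,
      h.integral_gaussSmooth_path ht h.continuousOn_sink hΦ]
    have e' : ∫ r in (0 : ℝ)..t, rate a κ f p Φ r = _ :=
      intervalIntegral.integral_congr_ae (ae_of_all _ fun r hr =>
        e r (by rwa [uIoc_of_le ht.1.le] at hr))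
    rw [e', intervalIntegral.integral_add (j1.add (j2.sub j3)) (j4.sub j5),
      intervalIntegral.integral_add j1 (j2.sub j3), intervalIntegral.integral_sub j2 j3,
      intervalIntegral.integral_sub j4 j5]
    ring

lemma continuousAt_pairing (h : DuhamelSolution a κ T fI f p) (ht : t ∈ Ioo 0 T) {Φ : ℝ → ℝ}
    (hΦ : NeumannTest Φ) : ContinuousAt (fun t => ∫ x in (-1 : ℝ)..1, f x t * Φ x) t := by
  have hT' : (t + T) / 2 ∈ Ioo 0 T := ⟨by linarith [ht.1, ht.2], by linarith [ht.2]⟩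
  have h1 := intervalIntegral.continuousOn_primitive_interval' (h.weak_form hT' hΦ).1 left_mem_uIcc
  rw [uIcc_of_le hT'.1.le] at h1
  have h2 := (h1.continuousAt (Icc_mem_nhds ht.1 (by linarith [ht.2]))).const_add
    (∫ y in (-1 : ℝ)..1, Φ y * fI y)
  refine h2.congr ?_
  filter_upwards [Ioo_mem_nhds ht.1 ht.2] with s hs
  exact (h.weak_form hs hΦ).2.symm

lemma continuousAt_rate (h : DuhamelSolution a κ T fI f p) (ht : t ∈ Ioo 0 T) {Φ : ℝ → ℝ}
    (hΦ : NeumannTest Φ) : ContinuousAt (rate a κ f p Φ) t := by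
  refine (h.continuousAt_pairing ht hΦ.deriv_deriv).add (ContinuousAt.mul ?_ (h.continuousAt_flux ht))
  have hn := Ioo_mem_nhds ht.1 ht.2
  exact (hΦ.continuous.continuousAt.comp (h.continuousOn_source.continuousAt hn)).sub
    (hΦ.continuous.continuousAt.comp (h.continuousOn_sink.continuousAt hn))

lemma hasDerivAt_pairing (h : DuhamelSolution a κ T fI f p) (ht : t ∈ Ioo 0 T) {Φ : ℝ → ℝ}
    (hΦ : NeumannTest Φ) :
    HasDerivAt (fun t => ∫ x in (-1 : ℝ)..1, f x t * Φ x) (rate a κ f p Φ t) t := by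
  have hmeas : StronglyMeasurableAtFilter (rate a κ f p Φ) (𝓝 t) :=
    ContinuousOn.stronglyMeasurableAtFilter isOpen_Ioo
      (fun s hs => (h.continuousAt_rate hs hΦ).continuousWithinAt) t ht
  have h1 := (intervalIntegral.integral_hasDerivAt_right (h.weak_form ht hΦ).1 hmeas
    (h.continuousAt_rate ht hΦ)).const_add (∫ y in (-1 : ℝ)..1, Φ y * fI y)
  refine h1.congr_of_eventuallyEq ?_
  filter_upwards [Ioo_mem_nhds ht.1 ht.2] with s hs
  exact (h.weak_form hs hΦ).2

end DuhamelSolution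

/-! ### Cutoffs, and classical calculus near the free boundary. -/

/-- The source of all nonconstant test functions: `sin (π x / 2)` is even about both endpoints and
strictly monotone on `[-1,1]`, so it serves there as a coordinate in which `g` is arbitrary. -/
lemma neumannTest_comp_sin {g : ℝ → ℝ} (hg : ContDiff ℝ ∞ g) :
    NeumannTest (fun x => g (Real.sin (Real.pi / 2 * x))) where
  smooth := hg.comp (Real.contDiff_sin.comp (contDiff_const.mul contDiff_id))
  symm_right x := by
    rw [show Real.pi / 2 * (2 - x) = Real.pi - Real.pi / 2 * x by ring, Real.sin_pi_sub]
  symm_left x := by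
    rw [show Real.pi / 2 * (-2 - x) = -(Real.pi / 2 * x + Real.pi) by ring, Real.sin_neg,
      Real.sin_add_pi, neg_neg]

lemma neumannTest_const (c : ℝ) : NeumannTest (fun _ => c) :=
  ⟨contDiff_const, fun _ => rfl, fun _ => rfl⟩

lemma strictMonoOn_sin_half_pi_mul :
    StrictMonoOn (fun x : ℝ => Real.sin (Real.pi / 2 * x)) (Icc (-1) 1) := fun x hx y hy hxy => by
  have hpi := Real.pi_pos
  exact Real.strictMonoOn_sin ⟨by nlinarith [hx.1], by nlinarith [hx.2]⟩
    ⟨by nlinarith [hy.1], by nlinarith [hy.2]⟩ (by nlinarith)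

/-- A Neumann test function that decreases from `1` to `0` between two points. -/
lemma exists_neumannTest_cutoff {b c : ℝ} (hb : -1 ≤ b) (hbc : b < c) (hc : c ≤ 1) :
    ∃ χ, NeumannTest χ ∧ (∀ x ∈ Icc (-1 : ℝ) 1, x < b → χ =ᶠ[𝓝 x] fun _ => 1) ∧
      ∀ x ∈ Icc (-1 : ℝ) 1, c < x → χ =ᶠ[𝓝 x] fun _ => 0 := by
  set S : ℝ → ℝ := fun x => Real.sin (Real.pi / 2 * x) with hS
  have hSc : Continuous S := by fun_prop
  have hbm : b ∈ Icc (-1 : ℝ) 1 := ⟨hb, hbc.le.trans hc⟩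
  have hcm : c ∈ Icc (-1 : ℝ) 1 := ⟨hb.trans hbc.le, hc⟩
  have hSbc : 0 < S c - S b := sub_pos.mpr (strictMonoOn_sin_half_pi_mul hbm hcm hbc)
  have hg : ContDiff ℝ ∞ fun X : ℝ => Real.smoothTransition ((S c - X) / (S c - S b)) :=
    Real.smoothTransition.contDiff.comp ((contDiff_const.sub contDiff_id).div_const _)
  refine ⟨_, neumannTest_comp_sin hg, fun x hx hxb => ?_, fun x hx hxc => ?_⟩
  · have h1 : S x < S b := strictMonoOn_sin_half_pi_mul hx hbm hxb
    filter_upwards [hSc.continuousAt.eventually (gt_mem_nhds h1)] with y hy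
    apply Real.smoothTransition.one_of_one_le
    rw [le_div_iff₀ hSbc]
    linarith
  · have h1 : S c < S x := strictMonoOn_sin_half_pi_mul hcm hx hxc
    filter_upwards [hSc.continuousAt.eventually (lt_mem_nhds h1)] with y hy
    apply Real.smoothTransition.zero_of_nonpos
    exact div_nonpos_of_nonpos_of_nonneg (by linarith) hSbc.le

/-- A nonnegative Neumann test function concentrated near a given point. -/
lemma exists_neumannTest_bump {b c x₀ : ℝ} (hb : -1 ≤ b) (hc : c ≤ 1) (h₀ : x₀ ∈ Ioo b c) :
    ∃ Φ, NeumannTest Φ ∧ (∀ x, 0 ≤ Φ x) ∧ 0 < Φ x₀ ∧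
      ∀ x ∈ Icc (-1 : ℝ) 1, x ∉ Ioo b c → Φ =ᶠ[𝓝 x] fun _ => 0 := by
  set S : ℝ → ℝ := fun x => Real.sin (Real.pi / 2 * x) with hS
  have hSc : Continuous S := by fun_prop
  have hm₀ : x₀ ∈ Icc (-1 : ℝ) 1 := ⟨hb.trans h₀.1.le, h₀.2.le.trans hc⟩
  have hbm : b ∈ Icc (-1 : ℝ) 1 := ⟨hb, (h₀.1.trans h₀.2).le.trans hc⟩
  have hcm : c ∈ Icc (-1 : ℝ) 1 := ⟨hb.trans (h₀.1.trans h₀.2).le, hc⟩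
  have h1 : 0 < S x₀ - S b := sub_pos.mpr (strictMonoOn_sin_half_pi_mul hbm hm₀ h₀.1)
  have h2 : 0 < S c - S x₀ := sub_pos.mpr (strictMonoOn_sin_half_pi_mul hm₀ hcm h₀.2)
  set r := min (S x₀ - S b) (S c - S x₀) with hr
  have hr0 : 0 < r := lt_min h1 h2
  let B : ContDiffBump (S x₀) := ⟨r / 4, r / 2, by linarith, by linarith⟩
  refine ⟨_, neumannTest_comp_sin B.contDiff, fun x => B.nonneg, ?_, fun x hx hxn => ?_⟩
  · exact B.pos_of_mem_ball (Metric.mem_ball_self B.rOut_pos)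
  · have hd : r / 2 < dist (S x) (S x₀) := by
      rw [Real.dist_eq, lt_abs]
      rcases le_or_gt x b with hxb | hxb
      · right
        have := strictMonoOn_sin_half_pi_mul.monotoneOn hx hbm hxb
        have := min_le_left (S x₀ - S b) (S c - S x₀)
        simp only [hS] at *
        linarith
      · left
        have hxc : c ≤ x := not_lt.mp fun h => hxn ⟨hxb, h⟩
        have := strictMonoOn_sin_half_pi_mul.monotoneOn hcm hx hxc
        have := min_le_right (S x₀ - S b) (S c - S x₀)
        simp only [hS] at *
        linarith
    filter_upwards [(hSc.dist continuous_const).continuousAt.eventually (lt_mem_nhds hd)] with y hy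
    exact B.zero_of_le_dist hy.le

lemma hasDerivAt_integral_box {f : ℝ → ℝ → ℝ} {x₀ t₀ ε b c : ℝ} (hε : 0 < ε)
    (hf : SmoothBox f x₀ t₀ ε) (hb : x₀ - ε ≤ b) (hbc : b ≤ c) (hc : c ≤ x₀ + ε) {w : ℝ → ℝ}
    (hw : Continuous w) :
    HasDerivAt (fun s => ∫ x in b..c, f x s * w x) (∫ x in b..c, dt f x t₀ * w x) t₀ := by
  have hsub : Icc b c ⊆ Icc (x₀ - ε) (x₀ + ε) := Icc_subset_Icc hb hc
  have hcont : ∀ {g : ℝ → ℝ → ℝ}, SmoothBox g x₀ t₀ ε → ∀ s ∈ Icc (t₀ - ε) (t₀ + ε),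
      ContinuousOn (fun x => g x s * w x) (Icc b c) := fun hg s hs =>
    ((hg.continuousOn_left hs).mono hsub).mul hw.continuousOn
  have ht₀ : t₀ ∈ Icc (t₀ - ε) (t₀ + ε) := ⟨by linarith, by linarith⟩
  have hc2 : ContinuousOn (fun z : ℝ × ℝ => dt f z.1 z.2 * w z.1)
      (Icc (x₀ - ε) (x₀ + ε) ×ˢ Icc (t₀ - ε) (t₀ + ε)) :=
    hf.dt.continuousOn.mul (hw.comp continuous_fst).continuousOn
  obtain ⟨C, hC⟩ := (isCompact_Icc.prod isCompact_Icc).exists_bound_of_continuousOn hc2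
  have hnhds : Icc (t₀ - ε) (t₀ + ε) ∈ 𝓝 t₀ := Icc_mem_nhds (by linarith) (by linarith)
  refine (intervalIntegral.hasDerivAt_integral_of_dominated_loc_of_deriv_le (μ := volume)
    (F := fun s x => f x s * w x) (F' := fun s x => dt f x s * w x)
    (bound := fun _ => C) hnhds ?_ ?_ ?_ ?_ (by simp) ?_).2
  · filter_upwards [hnhds] with s hs
    rw [uIoc_of_le hbc]
    exact ((hcont hf s hs).aestronglyMeasurable measurableSet_Icc).mono_set Ioc_subset_Icc_self
  · exact ContinuousOn.intervalIntegrable (by rw [uIcc_of_le hbc]; exact hcont hf t₀ ht₀)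
  · rw [uIoc_of_le hbc]
    exact ((hcont hf.dt t₀ ht₀).aestronglyMeasurable measurableSet_Icc).mono_set
      Ioc_subset_Icc_self
  · refine ae_of_all _ fun x hx s hs => ?_
    rw [uIoc_of_le hbc] at hx
    exact hC (x, s) ⟨hsub (Ioc_subset_Icc_self hx), hs⟩
  · refine ae_of_all _ fun x hx s hs => ?_
    rw [uIoc_of_le hbc] at hx
    exact (hasDerivAt_dt (hf x (hsub (Ioc_subset_Icc_self hx)) s hs)).mul_const _

lemma integral_dx_dx_mul {f : ℝ → ℝ → ℝ} {x₀ t₀ ε b c t : ℝ} (hf : SmoothBox f x₀ t₀ ε)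
    (ht : t ∈ Icc (t₀ - ε) (t₀ + ε)) (hb : x₀ - ε ≤ b) (hbc : b ≤ c) (hc : c ≤ x₀ + ε)
    {Φ : ℝ → ℝ} (hΦ : NeumannTest Φ) :
    ∫ x in b..c, dx (dx f) x t * Φ x =
      (dx f c t * Φ c - f c t * deriv Φ c) - (dx f b t * Φ b - f b t * deriv Φ b) +
        ∫ x in b..c, f x t * deriv (deriv Φ) x := by
  have hsub : Icc b c ⊆ Icc (x₀ - ε) (x₀ + ε) := Icc_subset_Icc hb hc
  have hu : uIcc b c = Icc b c := uIcc_of_le hbc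
  have i1 : IntervalIntegrable (fun x => dx (dx f) x t * Φ x) volume b c :=
    ContinuousOn.intervalIntegrable (by
      rw [hu]; exact ((hf.dx.dx.continuousOn_left ht).mono hsub).mul hΦ.continuous.continuousOn)
  have i2 : IntervalIntegrable (fun x => f x t * deriv (deriv Φ) x) volume b c :=
    ContinuousOn.intervalIntegrable (by
      rw [hu]
      exact ((hf.continuousOn_left ht).mono hsub).mul hΦ.deriv_deriv.continuous.continuousOn)
  have key := intervalIntegral.integral_eq_sub_of_hasDerivAt
    (f := fun x => dx f x t * Φ x - f x t * deriv Φ x)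
    (f' := fun x => dx (dx f) x t * Φ x - f x t * deriv (deriv Φ) x) (a := b) (b := c)
    (fun x hx => by
      rw [hu] at hx
      have h1 := hasDerivAt_dx (hf x (hsub hx) t ht)
      have h2 := hasDerivAt_dx (hf.dx x (hsub hx) t ht)
      refine ((h2.mul (hΦ.hasDerivAt x)).sub (h1.mul (hΦ.hasDerivAt_deriv x))).congr_deriv ?_
      ring) (i1.sub i2)
  rw [intervalIntegral.integral_sub i1 i2] at key
  linarith

namespace DuhamelSolution

variable {a κ T : ℝ} {fI : ℝ → ℝ} {f : ℝ → ℝ → ℝ} {p : ℝ → ℝ} {t : ℝ}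

lemma intervalIntegrable_mul (h : DuhamelSolution a κ T fI f p) (ht : t ∈ Ioo 0 T) {w : ℝ → ℝ}
    (hw : Continuous w) {b c : ℝ} (hb : b ∈ Icc (-1 : ℝ) 1) (hc : c ∈ Icc (-1 : ℝ) 1) :
    IntervalIntegrable (fun x => f x t * w x) volume b c :=
  ContinuousOn.intervalIntegrable (((h.continuousOn ht).mono (uIcc_subset_Icc hb hc)).mul
    hw.continuousOn)

/-- Test functions supported within distance `ε` of `p t` see neither source nor sink, and `f` is
smooth there. The weak equation and two integrations by parts then say that the residual is
orthogonal to all such functions. -/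
lemma heat_equation (h : DuhamelSolution a κ T fI f p) (ht : t ∈ Ioo 0 T) {ε : ℝ} (hε : 0 < ε)
    (hbox : SmoothBox f (p t) t ε) (hεo : ε ≤ offset a κ (p t)) {x₀ : ℝ}
    (hx₀ : x₀ ∈ Ioo (p t - ε) (p t + ε)) : dt f x₀ t = dx (dx f) x₀ t := by
  have hsrc := h.source_mem ht
  have hsnk := h.sink_mem ht
  have hp := h.mem_Ioo t ht
  set α := p t - ε with hα
  set β := p t + ε with hβ
  have hα1 : α ∈ Icc (-1 : ℝ) 1 := ⟨by linarith [hsrc.1], by linarith [hp.2]⟩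
  have hβ1 : β ∈ Icc (-1 : ℝ) 1 := ⟨by linarith [hp.1], by linarith [hsnk.2]⟩
  have hαβ : α ≤ β := by linarith
  have htt : t ∈ Icc (t - ε) (t + ε) := ⟨by linarith, by linarith⟩
  have hwc : ContinuousOn (fun x => dt f x t - dx (dx f) x t) (Icc α β) :=
    (hbox.dt.continuousOn_left htt).sub (hbox.dx.dx.continuousOn_left htt)
  -- the weak equation for test functions supported in the box
  have key : ∀ Φ, NeumannTest Φ →
      (∀ x ∈ Icc (-1 : ℝ) 1, x ∉ Ioo α β → Φ =ᶠ[𝓝 x] fun _ => 0) →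
      ∫ x in α..β, (dt f x t - dx (dx f) x t) * Φ x = 0 := by
    intro Φ hΦ h0
    have hz : ∀ x ∈ Icc (-1 : ℝ) 1, x ∉ Ioo α β →
        Φ x = 0 ∧ deriv Φ x = 0 ∧ deriv (deriv Φ) x = 0 := fun x hx hxn => by
      have h1 := h0 x hx hxn
      have h2 : deriv Φ =ᶠ[𝓝 x] fun _ => 0 := by simpa using h1.deriv
      have h3 : deriv (deriv Φ) =ᶠ[𝓝 x] fun _ => 0 := by simpa using h2.deriv
      exact ⟨h1.eq_of_nhds, h2.eq_of_nhds, h3.eq_of_nhds⟩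
    have hred : ∀ w : ℝ → ℝ, Continuous w →
        (∀ x ∈ Icc (-1 : ℝ) 1, x ∉ Ioo α β → w x = 0) → ∀ s ∈ Ioo 0 T,
        ∫ x in (-1 : ℝ)..1, f x s * w x = ∫ x in α..β, f x s * w x := by
      intro w hw hw0 s hs
      have e1 : ∫ x in (-1 : ℝ)..α, f x s * w x = 0 := by
        rw [intervalIntegral.integral_congr (g := fun _ => 0), intervalIntegral.integral_zero]
        intro x hx
        rw [uIcc_of_le hα1.1] at hx
        have := hw0 x ⟨hx.1, hx.2.trans hα1.2⟩ (fun hc => by linarith [hc.1, hx.2])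
        simp [this]
      have e2 : ∫ x in β..1, f x s * w x = 0 := by
        rw [intervalIntegral.integral_congr (g := fun _ => 0), intervalIntegral.integral_zero]
        intro x hx
        rw [uIcc_of_le hβ1.2] at hx
        have := hw0 x ⟨hβ1.1.trans hx.1, hx.2⟩ (fun hc => by linarith [hc.2, hx.1])
        simp [this]
      have l1 : (-1 : ℝ) ∈ Icc (-1 : ℝ) 1 := by norm_num
      have l2 : (1 : ℝ) ∈ Icc (-1 : ℝ) 1 := by norm_num
      rw [← intervalIntegral.integral_add_adjacent_intervals
        (h.intervalIntegrable_mul hs hw l1 hα1) (h.intervalIntegrable_mul hs hw hα1 l2),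
        ← intervalIntegral.integral_add_adjacent_intervals
        (h.intervalIntegrable_mul hs hw hα1 hβ1) (h.intervalIntegrable_mul hs hw hβ1 l2), e1, e2]
      ring
    have d1 := h.hasDerivAt_pairing ht hΦ
    have d2 : HasDerivAt (fun s => ∫ x in (-1 : ℝ)..1, f x s * Φ x)
        (∫ x in α..β, dt f x t * Φ x) t := by
      refine (hasDerivAt_integral_box hε hbox le_rfl hαβ le_rfl hΦ.continuous).congr_of_eventuallyEq ?_
      filter_upwards [Ioo_mem_nhds ht.1 ht.2] with s hs
      exact hred Φ hΦ.continuous (fun x hx hxn => (hz x hx hxn).1) s hs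
    have d3 := d1.unique d2
    -- Since `ε` is at most the offset, source and sink are at worst the endpoints of the interval,
    -- where `Φ` vanishes.
    have hs1 := hz _ hsrc fun hc => by linarith [hc.1]
    have hs2 := hz _ hsnk fun hc => by linarith [hc.2]
    have hz1 := hz _ hα1 fun hc => by linarith [hc.1]
    have hz2 := hz _ hβ1 fun hc => by linarith [hc.2]
    have ibp := integral_dx_dx_mul hbox htt le_rfl hαβ le_rfl hΦ
    rw [rate, hred _ hΦ.deriv_deriv.continuous (fun x hx hxn => (hz x hx hxn).2.2) t ht, hs1.1,
      hs2.1] at d3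
    rw [hz1.1, hz1.2.1, hz2.1, hz2.2.1] at ibp
    simp_rw [sub_mul]
    have hu : uIcc α β = Icc α β := uIcc_of_le hαβ
    rw [intervalIntegral.integral_sub]
    · linarith
    · exact ContinuousOn.intervalIntegrable (by
        rw [hu]; exact (hbox.dt.continuousOn_left htt).mul hΦ.continuous.continuousOn)
    · exact ContinuousOn.intervalIntegrable (by
        rw [hu]; exact (hbox.dx.dx.continuousOn_left htt).mul hΦ.continuous.continuousOn)
  -- a bump function shows that the residual has no sign
  have sign : ∀ σ : ℝ, ¬ 0 < σ * (dt f x₀ t - dx (dx f) x₀ t) := by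
    intro σ hpos
    have hcw : ContinuousAt (fun x => σ * (dt f x t - dx (dx f) x t)) x₀ :=
      (continuousOn_const.mul hwc).continuousAt (Icc_mem_nhds hx₀.1 hx₀.2)
    obtain ⟨δ, hδ, hball⟩ := Metric.eventually_nhds_iff.mp (hcw.eventually (lt_mem_nhds hpos))
    have hx₀b : x₀ ∈ Ioo (max α (x₀ - δ)) (min β (x₀ + δ)) :=
      ⟨max_lt hx₀.1 (by linarith), lt_min hx₀.2 (by linarith)⟩
    obtain ⟨Φ, hΦ, hΦ0, hΦpos, hΦz⟩ := exists_neumannTest_bump (x₀ := x₀)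
      (hα1.1.trans (le_max_left α (x₀ - δ))) ((min_le_left β (x₀ + δ)).trans hβ1.2) hx₀b
    have hk := key Φ hΦ fun x hx hxn => hΦz x hx fun hc =>
      hxn ⟨(le_max_left _ _).trans_lt hc.1, hc.2.trans_le (min_le_left _ _)⟩
    have hint : 0 < ∫ x in α..β, σ * ((dt f x t - dx (dx f) x t) * Φ x) := by
      refine intervalIntegral.integral_pos (by linarith) ?_ ?_ ⟨x₀, ⟨hx₀.1.le, hx₀.2.le⟩, ?_⟩
      · exact continuousOn_const.mul (hwc.mul hΦ.continuous.continuousOn)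
      · intro x hx
        rw [← mul_assoc]
        by_cases hxs : x ∈ Ioo (max α (x₀ - δ)) (min β (x₀ + δ))
        · refine mul_nonneg (hball ?_).le (hΦ0 x)
          rw [Real.dist_eq, abs_lt]
          have := (le_max_right α (x₀ - δ)).trans_lt hxs.1
          have := hxs.2.trans_le (min_le_right β (x₀ + δ))
          constructor <;> linarith
        · rw [(hΦz x ⟨hα1.1.trans hx.1.le, hx.2.trans hβ1.2⟩ hxs).eq_of_nhds, mul_zero]
      · rw [← mul_assoc]; exact mul_pos hpos hΦpos
    rw [intervalIntegral.integral_const_mul, hk, mul_zero] at hint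
    exact lt_irrefl _ hint
  by_contra hne
  rcases lt_or_gt_of_ne (sub_ne_zero.mpr hne) with h1 | h1
  · exact sign (-1) (by linarith)
  · exact sign 1 (by linarith)

end DuhamelSolution

/-! ### Sign of the solution and evolution of its positive and negative parts. -/

namespace DuhamelSolution

variable {a κ T : ℝ} {fI : ℝ → ℝ} {f : ℝ → ℝ → ℝ} {p : ℝ → ℝ} {t : ℝ}

lemma hasDerivAt_slope (h : DuhamelSolution a κ T fI f p) (ht : t ∈ Ioo 0 T) :
    HasDerivAt (fun x => f x t) (-flux f p t) (p t) := by
  obtain ⟨ε, hε, hb⟩ := h.exists_smoothBox ht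
  rw [h.flux_eq_neg_dx ht, neg_neg]
  exact hasDerivAt_dx (hb _ ⟨by linarith, by linarith⟩ _ ⟨by linarith, by linarith⟩)

/-- The negative slope makes `f` positive just left of `p t`; a nonpositive value farther left would
force a second zero. -/
lemma pos_of_lt (h : DuhamelSolution a κ T fI f p) (ht : t ∈ Ioo 0 T) {x : ℝ}
    (hx : x ∈ Icc (-1 : ℝ) 1) (hxp : x < p t) : 0 < f x t := by
  by_contra hneg
  have hp := h.mem_Ioo t ht
  have hslope := (hasDerivAt_iff_tendsto_slope_left_right.mp (h.hasDerivAt_slope ht)).1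
  have hev := hslope.eventually (gt_mem_nhds (neg_lt_zero.mpr (h.flux_pos t ht)))
  obtain ⟨y, hy1, hy2⟩ := (hev.and (Ioo_mem_nhdsLT hxp)).exists
  rw [slope_def_field, h.eq_zero ht] at hy1
  have hy : 0 ≤ f y t := by
    by_contra hc
    have : 0 ≤ (f y t - 0) / (y - p t) :=
      div_nonneg_of_nonpos (by linarith) (by linarith [hy2.2])
    linarith
  obtain ⟨w, hw, hw0⟩ := intermediate_value_Icc hy2.1.le
    ((h.continuousOn ht).mono (Icc_subset_Icc hx.1 (by linarith [hy2.2, hp.2])))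
    ⟨not_lt.mp hneg, hy⟩
  have := h.eq_of_eq_zero ht (x := w) ⟨hx.1.trans hw.1, by linarith [hw.2, hy2.2, hp.2]⟩ hw0
  linarith [hw.2, hy2.2]

lemma neg_of_gt (h : DuhamelSolution a κ T fI f p) (ht : t ∈ Ioo 0 T) {x : ℝ}
    (hx : x ∈ Icc (-1 : ℝ) 1) (hxp : p t < x) : f x t < 0 := by
  by_contra hneg
  have hp := h.mem_Ioo t ht
  have hslope := (hasDerivAt_iff_tendsto_slope_left_right.mp (h.hasDerivAt_slope ht)).2
  have hev := hslope.eventually (gt_mem_nhds (neg_lt_zero.mpr (h.flux_pos t ht)))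
  obtain ⟨y, hy1, hy2⟩ := (hev.and (Ioo_mem_nhdsGT hxp)).exists
  rw [slope_def_field, h.eq_zero ht] at hy1
  have hy : f y t ≤ 0 := by
    by_contra hc
    have : 0 ≤ (f y t - 0) / (y - p t) :=
      div_nonneg (by linarith) (by linarith [hy2.1])
    linarith
  obtain ⟨w, hw, hw0⟩ := intermediate_value_Icc hy2.2.le
    ((h.continuousOn ht).mono (Icc_subset_Icc (by linarith [hy2.1, hp.1]) hx.2))
    ⟨hy, not_lt.mp hneg⟩
  have := h.eq_of_eq_zero ht (x := w) ⟨by linarith [hw.1, hy2.1, hp.1], hw.2.trans hx.2⟩ hw0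
  linarith [hw.1, hy2.1]

/-- A quantitative implicit function argument: near `(p t, t)` the slope in `x` lies between `-2λ`
and `-λ/2`, and `f (p t) s` is `O(s - t)`, so the zero moves by `O(s - t)`. Both the width of the
interval from `p t` to `p s` and the size of `f` on it are then `O(s - t)`, hence the moving
endpoint does not contribute to time derivatives. -/
lemma exists_abs_sub_boundary_le (h : DuhamelSolution a κ T fI f p) (ht : t ∈ Ioo 0 T) :
    ∃ L K, ∀ᶠ s in 𝓝 t, |p s - p t| ≤ K * |s - t| ∧
      ∀ x ∈ uIcc (p t) (p s), |f x s| ≤ L * |p s - p t| := by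
  obtain ⟨ε, hε, hb⟩ := h.exists_smoothBox ht
  have hlam := h.flux_pos t ht
  have hcen : (p t ∈ Icc (p t - ε) (p t + ε)) ∧ t ∈ Icc (t - ε) (t + ε) :=
    ⟨⟨by linarith, by linarith⟩, by linarith, by linarith⟩
  have hc := (hb.dx _ hcen.1 _ hcen.2).continuousAt
  have hval : dx f (p t) t = -flux f p t := by rw [h.flux_eq_neg_dx ht, neg_neg]
  have hev := hc.eventually (Ioo_mem_nhds (a := -(2 * flux f p t)) (b := -(flux f p t / 2))
    (by simp only [hval]; linarith) (by simp only [hval]; linarith))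
  obtain ⟨δ, hδ, hball⟩ := Metric.eventually_nhds_iff.mp hev
  -- a smaller box on which the slope is under control
  set r := min ε (δ / 2) with hr
  have hr0 : 0 < r := lt_min hε (by linarith)
  have hslope : ∀ x ∈ Icc (p t - r) (p t + r), ∀ s ∈ Icc (t - r) (t + r),
      -(2 * flux f p t) < dx f x s ∧ dx f x s < -(flux f p t / 2) := by
    intro x hx s hs
    refine hball (y := (x, s)) ?_
    have hrd := min_le_right ε (δ / 2)
    rw [Prod.dist_eq, max_lt_iff, Real.dist_eq, Real.dist_eq]
    constructor <;> rw [abs_lt] <;> constructor <;> linarith [hx.1, hx.2, hs.1, hs.2]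
  have hb' := hb.mono (min_le_left ε (δ / 2))
  rw [← hr] at hb'
  have hdt := (hasDerivAt_dt (hb _ hcen.1 _ hcen.2))
  obtain ⟨M, hM⟩ := hdt.differentiableAt.isBigO_sub.bound
  refine ⟨2 * flux f p t, 2 / flux f p t * M, ?_⟩
  filter_upwards [hM, (h.continuousAt_boundary ht).eventually
    (Icc_mem_nhds (show p t - r < p t by linarith) (show p t < p t + r by linarith)),
    Icc_mem_nhds (show t - r < t by linarith) (show t < t + r by linarith),
    Ioo_mem_nhds ht.1 ht.2] with s h1 h2 h3 h4
  have hder : ∀ x ∈ Icc (p t - r) (p t + r), HasDerivAt (fun x => f x s) (dx f x s) x :=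
    fun x hx => hasDerivAt_dx (hb' x hx s h3)
  have hsub : ∀ {x y}, x ∈ Icc (p t - r) (p t + r) → y ∈ Icc (p t - r) (p t + r) →
      |f x s - f y s| ≤ 2 * flux f p t * |x - y| := fun {x y} hx hy => by
    have := (convex_Icc (p t - r) (p t + r)).norm_image_sub_le_of_norm_hasDerivWithin_le
      (f := fun x => f x s) (f' := fun x => dx f x s) (C := 2 * flux f p t)
      (fun z hz => (hder z hz).hasDerivWithinAt) (fun z hz => by
        have := hslope z hz s h3
        rw [Real.norm_eq_abs, abs_le]; constructor <;> linarith) hy hx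
    simpa using this
  have hlow : flux f p t / 2 * |p s - p t| ≤ |f (p t) s| := by
    have hp0 := h.eq_zero h4
    have hpt : p t ∈ Icc (p t - r) (p t + r) := ⟨by linarith, by linarith⟩
    rcases lt_trichotomy (p s) (p t) with hlt | heq | hgt
    · obtain ⟨c, hc1, hc2⟩ := exists_hasDerivAt_eq_slope (fun x => f x s) (fun x => dx f x s) hlt
        (fun x hx => (hder x ⟨h2.1.trans hx.1, hx.2.trans hpt.2⟩).continuousAt.continuousWithinAt)
        (fun x hx => hder x ⟨h2.1.trans hx.1.le, hx.2.le.trans hpt.2⟩)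
      have h6 := (hslope c ⟨h2.1.trans hc1.1.le, hc1.2.le.trans hpt.2⟩ s h3).2
      rw [hp0, sub_zero, eq_div_iff (by linarith)] at hc2
      rw [abs_of_neg (by linarith : p s - p t < 0)]
      refine le_trans ?_ (neg_le_abs _)
      nlinarith
    · simp [heq]
    · obtain ⟨c, hc1, hc2⟩ := exists_hasDerivAt_eq_slope (fun x => f x s) (fun x => dx f x s) hgt
        (fun x hx => (hder x ⟨hpt.1.trans hx.1, hx.2.trans h2.2⟩).continuousAt.continuousWithinAt)
        (fun x hx => hder x ⟨hpt.1.trans hx.1.le, hx.2.le.trans h2.2⟩)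
      have h6 := (hslope c ⟨hpt.1.trans hc1.1.le, hc1.2.le.trans h2.2⟩ s h3).2
      rw [hp0, zero_sub, eq_div_iff (by linarith)] at hc2
      rw [abs_of_pos (by linarith : 0 < p s - p t)]
      refine le_trans ?_ (le_abs_self _)
      nlinarith
  constructor
  · rw [h.eq_zero ht, sub_zero, Real.norm_eq_abs, Real.norm_eq_abs] at h1
    rw [div_mul_eq_mul_div, div_mul_eq_mul_div, le_div_iff₀ hlam]
    linarith
  · intro x hx
    have hx' : x ∈ Icc (p t - r) (p t + r) :=
      (uIcc_subset_Icc ⟨by linarith, by linarith⟩ h2) hx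
    have h5 := hsub hx' h2
    rw [h.eq_zero h4, sub_zero] at h5
    refine h5.trans ?_
    have : |x - p s| ≤ |p s - p t| := by
      rw [abs_sub_comm x]; exact abs_sub_right_of_mem_uIcc hx
    gcongr

lemma hasDerivAt_integral_to_boundary (h : DuhamelSolution a κ T fI f p) (ht : t ∈ Ioo 0 T)
    {Φ : ℝ → ℝ} (hΦ : NeumannTest Φ) :
    HasDerivAt (fun s => ∫ x in (p t)..(p s), f x s * Φ x) 0 t := by
  obtain ⟨L, K, hev⟩ := h.exists_abs_sub_boundary_le ht
  obtain ⟨D, hD⟩ := hΦ.exists_bound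
  have hO : (fun s => ∫ x in (p t)..(p s), f x s * Φ x) =O[𝓝 t] fun s => (s - t) ^ 2 := by
    refine Asymptotics.IsBigO.of_bound (|L| * D * K ^ 2) ?_
    filter_upwards [hev] with s hs
    have h1 := intervalIntegral.norm_integral_le_of_norm_le_const (a := p t) (b := p s)
      (f := fun x => f x s * Φ x) (C := |L| * |p s - p t| * D) (fun x hx => by
        rw [norm_mul]
        have := (hs.2 x (uIoc_subset_uIcc hx)).trans
          (mul_le_mul_of_nonneg_right (le_abs_self L) (abs_nonneg (p s - p t)))
        exact mul_le_mul this (hD x) (norm_nonneg _) (by positivity))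
    refine h1.trans ?_
    have hD0 : 0 ≤ D := (abs_nonneg _).trans (hD 0)
    rw [norm_pow, Real.norm_eq_abs]
    calc |L| * |p s - p t| * D * |p s - p t| = |L| * D * |p s - p t| ^ 2 := by ring
      _ ≤ |L| * D * (K * |s - t|) ^ 2 := by gcongr; exact hs.1
      _ = _ := by ring
  have h2 : (fun s : ℝ => (s - t) ^ 2) =o[𝓝 t] fun s => s - t := by
    have := (Asymptotics.isLittleO_pow_id one_lt_two (𝕜 := ℝ)).comp_tendsto
      (show Tendsto (fun s => s - t) (𝓝 t) (𝓝 0) by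
        simpa using (continuous_sub_right t).tendsto t)
    exact this
  rw [hasDerivAt_iff_isLittleO]
  simpa using hO.trans_isLittleO h2

/-- The evolution of the positive part of the solution against a test function. -/
theorem hasDerivAt_left (h : DuhamelSolution a κ T fI f p) (ht : t ∈ Ioo 0 T) {Φ : ℝ → ℝ}
    (hΦ : NeumannTest Φ) :
    HasDerivAt (fun s => ∫ x in (-1 : ℝ)..(p s), f x s * Φ x)
      ((∫ x in (-1 : ℝ)..(p t), f x t * deriv (deriv Φ) x) +
        (Φ (p t - offset a κ (p t)) - Φ (p t)) * flux f p t) t := by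
  obtain ⟨ε₀, hε₀, hbox₀⟩ := h.exists_smoothBox ht
  have hoff := offset_pos h.a_pos h.κ_pos (h.mem_Ioo t ht)
  set ε₁ := min ε₀ (offset a κ (p t)) with hε₁
  have hε₁0 : 0 < ε₁ := lt_min hε₀ hoff
  have hbox₁ : SmoothBox f (p t) t ε₁ := hbox₀.mono (min_le_left _ _)
  have hε₁o : ε₁ ≤ offset a κ (p t) := min_le_right _ _
  -- Halving is needed because `heat_equation` covers only an open interval, whereas the equation is
  -- used below up to the endpoints `α` and `β`.
  set ε := ε₁ / 2 with hεdef
  have hε : 0 < ε := by linarith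
  have hbox : SmoothBox f (p t) t ε := hbox₁.mono (by linarith)
  have hsrc := h.source_mem ht
  have hsnk := h.sink_mem ht
  have hp := h.mem_Ioo t ht
  set α := p t - ε with hα
  set β := p t + ε with hβ
  have hα1 : α ∈ Icc (-1 : ℝ) 1 := ⟨by linarith [hsrc.1], by linarith [hp.2]⟩
  have hβ1 : β ∈ Icc (-1 : ℝ) 1 := ⟨by linarith [hp.1], by linarith [hsnk.2]⟩
  have hpm : p t ∈ Icc (-1 : ℝ) 1 := ⟨hp.1.le, hp.2.le⟩
  have l1 : (-1 : ℝ) ∈ Icc (-1 : ℝ) 1 := by norm_num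
  have l2 : (1 : ℝ) ∈ Icc (-1 : ℝ) 1 := by norm_num
  have htt : t ∈ Icc (t - ε) (t + ε) := ⟨by linarith, by linarith⟩
  have heat : ∀ x ∈ Icc α β, dt f x t = dx (dx f) x t := fun x hx =>
    h.heat_equation ht hε₁0 hbox₁ hε₁o ⟨by linarith [hx.1], by linarith [hx.2]⟩
  -- The cutoff is `1` at the source and `0` at the sink, so the weak form for `Φ χ` keeps only the
  -- source. The error is an integral of `Φ (1 - χ)` left of `p t` minus one of `Φ χ` right of it,
  -- both inside the smooth box. Their boundary terms at `p t` add up to `-Φ(p t) λ`, independently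
  -- of `χ`.
  obtain ⟨χ, hχ, hχ1, hχ0⟩ := exists_neumannTest_cutoff (b := p t - ε / 2) (c := p t + ε / 2)
    (by linarith [hα1.1]) (by linarith) (by linarith [hβ1.2])
  have hΦχ := hΦ.mul hχ
  have hΦ1 := hΦ.mul (Ψ := fun x => 1 - χ x)
    ⟨contDiff_const.sub hχ.smooth, fun x => by rw [hχ.symm_right], fun x => by rw [hχ.symm_left]⟩
  -- near the ends
  have near1 : ∀ x ∈ Icc (-1 : ℝ) 1, x ≤ α →
      (fun x => Φ x * χ x) =ᶠ[𝓝 x] Φ ∧ (fun x => Φ x * (1 - χ x)) =ᶠ[𝓝 x] fun _ => 0 := by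
    intro x hx hxα
    have h1 := hχ1 x hx (by linarith)
    constructor <;> filter_upwards [h1] with y hy <;> rw [hy] <;> ring
  have near0 : ∀ x ∈ Icc (-1 : ℝ) 1, β ≤ x → (fun x => Φ x * χ x) =ᶠ[𝓝 x] fun _ => 0 := by
    intro x hx hxβ
    filter_upwards [hχ0 x hx (by linarith)] with y hy
    rw [hy, mul_zero]
  have hzero : ∀ {g : ℝ → ℝ} {x : ℝ}, g =ᶠ[𝓝 x] (fun _ => 0) →
      g x = 0 ∧ deriv g x = 0 ∧ deriv (deriv g) x = 0 := fun {g x} h1 => by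
    have h2 : deriv g =ᶠ[𝓝 x] fun _ => 0 := by simpa using h1.deriv
    have h3 : deriv (deriv g) =ᶠ[𝓝 x] fun _ => 0 := by simpa using h2.deriv
    exact ⟨h1.eq_of_nhds, h2.eq_of_nhds, h3.eq_of_nhds⟩
  have ii : ∀ {s : ℝ}, s ∈ Ioo 0 T → ∀ {w : ℝ → ℝ}, Continuous w → ∀ {b c : ℝ},
      b ∈ Icc (-1 : ℝ) 1 → c ∈ Icc (-1 : ℝ) 1 →
      IntervalIntegrable (fun x => f x s * w x) volume b c :=
    fun {s} hs {w} hw {b c} hb hc => h.intervalIntegrable_mul hs hw hb hc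
  -- decomposition of the integral up to the boundary
  have hdecomp : ∀ s ∈ Ioo 0 T, ∫ x in (-1 : ℝ)..(p s), f x s * Φ x =
      (∫ x in (-1 : ℝ)..1, f x s * (Φ x * χ x)) + (∫ x in α..(p t), f x s * (Φ x * (1 - χ x))) -
        (∫ x in (p t)..β, f x s * (Φ x * χ x)) + ∫ x in (p t)..(p s), f x s * Φ x := by
    intro s hs
    have hps : p s ∈ Icc (-1 : ℝ) 1 := ⟨(h.mem_Ioo s hs).1.le, (h.mem_Ioo s hs).2.le⟩
    have e1 : ∫ x in (-1 : ℝ)..α, f x s * (Φ x * χ x) = ∫ x in (-1 : ℝ)..α, f x s * Φ x := by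
      refine intervalIntegral.integral_congr fun x hx => ?_
      rw [uIcc_of_le hα1.1] at hx
      have := (near1 x ⟨hx.1, hx.2.trans hα1.2⟩ hx.2).1.eq_of_nhds
      simp only [this]
    have e2 : ∫ x in β..1, f x s * (Φ x * χ x) = 0 := by
      rw [intervalIntegral.integral_congr (g := fun _ => 0), intervalIntegral.integral_zero]
      intro x hx
      rw [uIcc_of_le hβ1.2] at hx
      have := (near0 x ⟨hβ1.1.trans hx.1, hx.2⟩ hx.1).eq_of_nhds
      simp [this]
    have e3 : ∫ x in α..(p t), f x s * (Φ x * (1 - χ x)) =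
        (∫ x in α..(p t), f x s * Φ x) - ∫ x in α..(p t), f x s * (Φ x * χ x) := by
      rw [← intervalIntegral.integral_sub (ii hs hΦ.continuous hα1 hpm)
        (ii hs hΦχ.continuous hα1 hpm)]
      congr 1; ext x; ring
    rw [e3,
      ← intervalIntegral.integral_add_adjacent_intervals (ii hs hΦ.continuous l1 hpm)
        (ii hs hΦ.continuous hpm hps),
      ← intervalIntegral.integral_add_adjacent_intervals (ii hs hΦ.continuous l1 hα1)
        (ii hs hΦ.continuous hα1 hpm),
      ← intervalIntegral.integral_add_adjacent_intervals (ii hs hΦχ.continuous l1 hα1)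
        (ii hs hΦχ.continuous hα1 l2),
      ← intervalIntegral.integral_add_adjacent_intervals (ii hs hΦχ.continuous hα1 hpm)
        (ii hs hΦχ.continuous hpm l2),
      ← intervalIntegral.integral_add_adjacent_intervals (ii hs hΦχ.continuous hpm hβ1)
        (ii hs hΦχ.continuous hβ1 l2), e1, e2]
    ring
  have d1 := h.hasDerivAt_pairing ht hΦχ
  have d2 := hasDerivAt_integral_box (b := α) (c := p t) hε hbox le_rfl (by linarith)
    (by linarith) hΦ1.continuous
  have d3 := hasDerivAt_integral_box (b := p t) (c := β) hε hbox (by linarith) (by linarith)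
    le_rfl hΦχ.continuous
  have d4 := h.hasDerivAt_integral_to_boundary ht hΦ
  have d5 := ((d1.add d2).sub d3).add d4
  refine HasDerivAt.congr_deriv (d5.congr_of_eventuallyEq ?_) ?_
  · filter_upwards [Ioo_mem_nhds ht.1 ht.2] with s hs
    exact hdecomp s hs
  -- evaluation of the derivative
  have c2 : ∫ x in α..(p t), dt f x t * (Φ x * (1 - χ x)) =
      ∫ x in α..(p t), dx (dx f) x t * (Φ x * (1 - χ x)) :=
    intervalIntegral.integral_congr fun x hx => by
      rw [uIcc_of_le (by linarith)] at hx
      simp only [heat x ⟨hx.1, by linarith [hx.2]⟩]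
  have c3 : ∫ x in (p t)..β, dt f x t * (Φ x * χ x) =
      ∫ x in (p t)..β, dx (dx f) x t * (Φ x * χ x) :=
    intervalIntegral.integral_congr fun x hx => by
      rw [uIcc_of_le (by linarith)] at hx
      simp only [heat x ⟨by linarith [hx.1], hx.2⟩]
  have p2 := integral_dx_dx_mul hbox htt (b := α) (c := p t) le_rfl (by linarith) (by linarith) hΦ1
  have p3 := integral_dx_dx_mul hbox htt (b := p t) (c := β) (by linarith) (by linarith) le_rfl hΦχ
  have zα := hzero (near1 α hα1 le_rfl).2
  have zβ := hzero (near0 β hβ1 le_rfl)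
  have zs : Φ (p t - offset a κ (p t)) * χ (p t - offset a κ (p t)) =
      Φ (p t - offset a κ (p t)) := (near1 _ hsrc (by linarith)).1.eq_of_nhds
  have zk : Φ (p t + offset a κ (p t)) * χ (p t + offset a κ (p t)) = 0 :=
    (near0 _ hsnk (by linarith)).eq_of_nhds
  have hdd : deriv (deriv fun x => Φ x * (1 - χ x)) =
      fun x => deriv (deriv Φ) x - deriv (deriv fun x => Φ x * χ x) x := by
    have g1 : (fun x => Φ x * (1 - χ x)) = fun x => Φ x - Φ x * χ x := by ext x; ring
    have g2 : deriv (fun x => Φ x - Φ x * χ x) =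
        fun x => deriv Φ x - deriv (fun x => Φ x * χ x) x := by
      ext x; exact ((hΦ.hasDerivAt x).sub (hΦχ.hasDerivAt x)).deriv
    rw [g1, g2]
    ext x; exact ((hΦ.hasDerivAt_deriv x).sub (hΦχ.hasDerivAt_deriv x)).deriv
  have q1 : ∫ x in (-1 : ℝ)..1, f x t * deriv (deriv fun x => Φ x * χ x) x =
      (∫ x in (-1 : ℝ)..α, f x t * deriv (deriv Φ) x) +
      (∫ x in α..(p t), f x t * deriv (deriv fun x => Φ x * χ x) x) +
      ∫ x in (p t)..β, f x t * deriv (deriv fun x => Φ x * χ x) x := by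
    have e1 : ∫ x in (-1 : ℝ)..α, f x t * deriv (deriv fun x => Φ x * χ x) x =
        ∫ x in (-1 : ℝ)..α, f x t * deriv (deriv Φ) x := by
      refine intervalIntegral.integral_congr fun x hx => ?_
      rw [uIcc_of_le hα1.1] at hx
      have := (near1 x ⟨hx.1, hx.2.trans hα1.2⟩ hx.2).1.deriv.deriv.eq_of_nhds
      simp only [this]
    have e2 : ∫ x in β..1, f x t * deriv (deriv fun x => Φ x * χ x) x = 0 := by
      rw [intervalIntegral.integral_congr (g := fun _ => 0), intervalIntegral.integral_zero]
      intro x hx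
      rw [uIcc_of_le hβ1.2] at hx
      have := (hzero (near0 x ⟨hβ1.1.trans hx.1, hx.2⟩ hx.1)).2.2
      simp [this]
    have hc := hΦχ.deriv_deriv.continuous
    rw [← intervalIntegral.integral_add_adjacent_intervals (ii ht hc l1 hα1) (ii ht hc hα1 l2),
      ← intervalIntegral.integral_add_adjacent_intervals (ii ht hc hα1 hpm) (ii ht hc hpm l2),
      ← intervalIntegral.integral_add_adjacent_intervals (ii ht hc hpm hβ1) (ii ht hc hβ1 l2),
      e1, e2]
    ring
  have q2 : ∫ x in α..(p t), f x t * deriv (deriv fun x => Φ x * (1 - χ x)) x =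
      (∫ x in α..(p t), f x t * deriv (deriv Φ) x) -
        ∫ x in α..(p t), f x t * deriv (deriv fun x => Φ x * χ x) x := by
    rw [← intervalIntegral.integral_sub (ii ht hΦ.deriv_deriv.continuous hα1 hpm)
      (ii ht hΦχ.deriv_deriv.continuous hα1 hpm), hdd]
    congr 1; ext x; ring
  have q3 := intervalIntegral.integral_add_adjacent_intervals
    (ii ht hΦ.deriv_deriv.continuous l1 hα1) (ii ht hΦ.deriv_deriv.continuous hα1 hpm)
  have hlam : dx f (p t) t = -flux f p t := by rw [h.flux_eq_neg_dx ht, neg_neg]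
  have hp0 := h.eq_zero ht
  rw [rate, c2, c3, p2, p3, q1, q2, ← q3, zα.1, zα.2.1, zβ.1, zβ.2.1, zs, zk, hlam, hp0]
  ring

/-- The evolution of the negative part of the solution against a test function. -/
theorem hasDerivAt_right (h : DuhamelSolution a κ T fI f p) (ht : t ∈ Ioo 0 T) {Φ : ℝ → ℝ}
    (hΦ : NeumannTest Φ) :
    HasDerivAt (fun s => ∫ x in (p s)..1, f x s * Φ x)
      ((∫ x in (p t)..1, f x t * deriv (deriv Φ) x) +
        (Φ (p t) - Φ (p t + offset a κ (p t))) * flux f p t) t := by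
  have l1 : (-1 : ℝ) ∈ Icc (-1 : ℝ) 1 := by norm_num
  have l2 : (1 : ℝ) ∈ Icc (-1 : ℝ) 1 := by norm_num
  have e : ∀ s ∈ Ioo 0 T, ∀ w : ℝ → ℝ, Continuous w → ∫ x in (p s)..1, f x s * w x =
      (∫ x in (-1 : ℝ)..1, f x s * w x) - ∫ x in (-1 : ℝ)..(p s), f x s * w x := by
    intro s hs w hw
    have hps : p s ∈ Icc (-1 : ℝ) 1 := ⟨(h.mem_Ioo s hs).1.le, (h.mem_Ioo s hs).2.le⟩
    rw [← intervalIntegral.integral_add_adjacent_intervals (h.intervalIntegrable_mul hs hw l1 hps)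
      (h.intervalIntegrable_mul hs hw hps l2)]
    ring
  refine HasDerivAt.congr_deriv (((h.hasDerivAt_pairing ht hΦ).sub
    (h.hasDerivAt_left ht hΦ)).congr_of_eventuallyEq ?_) ?_
  · filter_upwards [Ioo_mem_nhds ht.1 ht.2] with s hs
    exact e s hs Φ hΦ.continuous
  · rw [e t ht _ hΦ.deriv_deriv.continuous, rate]
    ring

end DuhamelSolution

/-! ### The function `zed` and the comparison of jumps. -/

/-- A smooth substitute for half the square of the distance to the endpoint `1`. -/
noncomputable def zed (x : ℝ) : ℝ := 1 - Real.sin (Real.pi / 2 * x)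

lemma zed_nonneg (x : ℝ) : 0 ≤ zed x := sub_nonneg.mpr (Real.sin_le_one _)

lemma zed_le_two (x : ℝ) : zed x ≤ 2 := by
  unfold zed; linarith [Real.neg_one_le_sin (Real.pi / 2 * x)]

lemma continuous_zed : Continuous zed := by unfold zed; fun_prop

lemma zed_antitoneOn : AntitoneOn zed (Icc (-1) 1) := fun x hx y hy hxy => by
  have := strictMonoOn_sin_half_pi_mul.monotoneOn hx hy hxy
  simp only [zed] at *
  linarith

lemma zed_le_mul (x : ℝ) (hx : x ≤ 1) : zed x ≤ Real.pi / 2 * (1 - x) := by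
  have h1 : zed x = 1 - Real.cos (Real.pi / 2 * (1 - x)) := by
    rw [zed, ← Real.cos_pi_div_two_sub]; ring_nf
  have h2 := Real.one_sub_sq_div_two_le_cos (x := Real.pi / 2 * (1 - x))
  have h3 := Real.neg_one_le_cos (Real.pi / 2 * (1 - x))
  have h4 : 0 ≤ Real.pi / 2 * (1 - x) := mul_nonneg (by positivity) (by linarith)
  rw [h1]
  rcases le_or_gt (Real.pi / 2 * (1 - x)) 2 with h5 | h5
  · nlinarith
  · linarith

lemma zed_eq (x : ℝ) : zed x = 2 * Real.sin (Real.pi / 4 * (1 - x)) ^ 2 := by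
  have h1 : zed x = 1 - Real.cos (2 * (Real.pi / 4 * (1 - x))) := by
    rw [zed, ← Real.cos_pi_div_two_sub]; ring_nf
  rw [h1, Real.cos_two_mul, Real.cos_sq']
  ring

lemma sq_le_zed {x : ℝ} (hx : x ∈ Icc (-1 : ℝ) 1) : (1 - x) ^ 2 / 2 ≤ zed x := by
  have hpi := Real.pi_pos
  have h1 := Real.mul_le_sin (x := Real.pi / 4 * (1 - x)) (by nlinarith [hx.2])
    (by nlinarith [hx.1])
  have h2 : 2 / Real.pi * (Real.pi / 4 * (1 - x)) = (1 - x) / 2 := by field_simp; ring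
  rw [h2] at h1
  have h3 : 0 ≤ (1 - x) / 2 := by linarith [hx.2]
  rw [zed_eq]
  nlinarith

lemma hasDerivAt_zed (x : ℝ) :
    HasDerivAt zed (-(Real.pi / 2 * Real.cos (Real.pi / 2 * x))) x := by
  have h1 : HasDerivAt (fun x : ℝ => Real.pi / 2 * x) (Real.pi / 2) x := by
    simpa using (hasDerivAt_id x).const_mul (Real.pi / 2)
  refine ((h1.sin).const_sub 1).congr_deriv ?_
  ring

/-- With `b = (π/2)²` one has `zed'² = b zed (2 - zed)` and `zed'' = b (1 - zed)`, so the second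
derivative of a function of `zed` is again a function of `zed`. -/
lemma deriv_deriv_comp_zed {G G' G'' : ℝ → ℝ} (h1 : ∀ ζ, 0 ≤ ζ → HasDerivAt G (G' ζ) ζ)
    (h2 : ∀ ζ, 0 ≤ ζ → HasDerivAt G' (G'' ζ) ζ) (x : ℝ) :
    deriv (deriv fun x => G (zed x)) x = (Real.pi / 2) ^ 2 *
      (zed x * (2 - zed x) * G'' (zed x) + (1 - zed x) * G' (zed x)) := by
  have e1 : deriv (fun x => G (zed x)) =
      fun x => G' (zed x) * (-(Real.pi / 2 * Real.cos (Real.pi / 2 * x))) := by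
    ext x; exact ((h1 _ (zed_nonneg x)).comp x (hasDerivAt_zed x)).deriv
  have h3 : HasDerivAt (fun x : ℝ => Real.pi / 2 * x) (Real.pi / 2) x := by
    simpa using (hasDerivAt_id x).const_mul (Real.pi / 2)
  have e2 := (((h2 _ (zed_nonneg x)).comp x (hasDerivAt_zed x)).mul
    ((h3.cos).const_mul (Real.pi / 2)).neg).deriv
  rw [e1]
  refine Eq.trans e2 ?_
  have hs : Real.sin (Real.pi / 2 * x) = 1 - zed x := by unfold zed; ring
  have hc : Real.cos (Real.pi / 2 * x) ^ 2 = zed x * (2 - zed x) := by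
    rw [Real.cos_sq', hs]; ring
  simp only [Function.comp, Pi.neg_apply, hs]
  linear_combination (Real.pi / 2) ^ 2 * G'' (zed x) * hc

lemma neumannTest_comp_zed {G : ℝ → ℝ} (hG : ∀ ζ, 0 ≤ ζ → ContDiffAt ℝ ∞ G ζ) :
    NeumannTest fun x => G (zed x) where
  smooth := contDiff_iff_contDiffAt.mpr fun x => (hG _ (zed_nonneg x)).comp x
    (contDiff_const.sub (Real.contDiff_sin.comp (contDiff_const.mul contDiff_id))).contDiffAt
  symm_right x := by
    have : zed (2 - x) = zed x := by
      rw [zed, show Real.pi / 2 * (2 - x) = Real.pi - Real.pi / 2 * x by ring, Real.sin_pi_sub, zed]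
    rw [this]
  symm_left x := by
    have : zed (-2 - x) = zed x := by
      rw [zed, show Real.pi / 2 * (-2 - x) = -(Real.pi / 2 * x + Real.pi) by ring, Real.sin_neg,
        Real.sin_add_pi, neg_neg, zed]
    rw [this]

/-- Near the endpoint `1`, moving from the boundary to the source increases `zed` by a definite
factor, but at most fourfold. -/
lemma zed_source_near {a κ : ℝ} (hκ : 0 < κ) (hκ1 : κ ≤ 1) {q : ℝ}
    (hq : q ∈ Ioo (-1 : ℝ) 1) (hqa : 1 - q ≤ a) (hq3 : 1 - q ≤ 2 / 3) :
    κ / 2 * zed q ≤ zed (q - offset a κ q) - zed q ∧ zed (q - offset a κ q) ≤ 4 * zed q := by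
  have hpi := Real.pi_pos
  have hq2 := hq.2
  have hoff : offset a κ q = κ * (1 - q) := by
    have h1 : |q - 1| = 1 - q := by rw [abs_sub_comm, abs_of_pos]; linarith
    have h2 : |q + 1| = q + 1 := abs_of_pos (by linarith)
    rw [offset, h1, h2, min_eq_left (by nlinarith : κ * (1 - q) ≤ κ * (q + 1)), min_eq_right]
    nlinarith
  -- In this angle `zed q = 2 sin² θ` and the source sits at angle `(1 + κ) θ`. The bound `1 - q ≤
  -- 2/3` gives `θ ≤ π/6`, so `(2 + κ) θ ≤ π/2` stays where sine increases.
  set θ := Real.pi / 4 * (1 - q) with hθ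
  have hθ0 : 0 < θ := by apply mul_pos <;> linarith
  have hθ6 : θ ≤ Real.pi / 6 := by rw [hθ]; nlinarith
  have e3 : zed (q - offset a κ q) = 2 * Real.sin ((1 + κ) * θ) ^ 2 := by
    rw [zed_eq, hoff, hθ]; ring_nf
  have e1 : zed q = 2 * Real.sin θ ^ 2 := zed_eq q
  have hs0 : 0 < Real.sin θ := Real.sin_pos_of_pos_of_lt_pi hθ0 (by linarith)
  have hmono : ∀ {A B : ℝ}, 0 ≤ A → A ≤ B → B ≤ Real.pi / 2 → Real.sin A ≤ Real.sin B :=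
    fun {A B} hA hAB hB => Real.sin_le_sin_of_le_of_le_pi_div_two (by linarith) hB hAB
  constructor
  · have h1 : Real.sin ((1 + κ) * θ) ^ 2 - Real.sin θ ^ 2 =
        Real.sin ((2 + κ) * θ) * Real.sin (κ * θ) := by
      rw [show (2 + κ) * θ = (1 + κ) * θ + θ by ring, show κ * θ = (1 + κ) * θ - θ by ring,
        Real.sin_add, Real.sin_sub]
      linear_combination (Real.sin θ ^ 2) * (Real.sin_sq_add_cos_sq ((1 + κ) * θ)) -
        Real.sin ((1 + κ) * θ) ^ 2 * (Real.sin_sq_add_cos_sq θ)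
    have h2 : Real.sin θ ≤ Real.sin ((2 + κ) * θ) :=
      hmono hθ0.le (by nlinarith) (by nlinarith)
    have h3 : κ / 2 * Real.sin θ ≤ Real.sin (κ * θ) := by
      have h4 := Real.mul_le_sin (x := κ * θ) (by positivity) (by nlinarith)
      have h5 := Real.sin_le hθ0.le
      have h6 : (1 : ℝ) / 2 ≤ 2 / Real.pi := by
        rw [div_le_div_iff₀ two_pos hpi]; linarith [Real.pi_le_four]
      calc κ / 2 * Real.sin θ ≤ κ / 2 * θ := by gcongr
        _ = 1 / 2 * (κ * θ) := by ring
        _ ≤ 2 / Real.pi * (κ * θ) := by gcongr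
        _ ≤ _ := h4
    rw [e1, e3]
    have h7 : Real.sin θ * (κ / 2 * Real.sin θ) ≤ Real.sin ((2 + κ) * θ) * Real.sin (κ * θ) :=
      mul_le_mul h2 h3 (by positivity) (hs0.le.trans h2)
    nlinarith
  · have h1 : Real.sin ((1 + κ) * θ) ≤ Real.sin (2 * θ) :=
      hmono (by positivity) (by nlinarith) (by linarith)
    have h0 : 0 ≤ Real.sin ((1 + κ) * θ) :=
      Real.sin_nonneg_of_nonneg_of_le_pi (by positivity) (by nlinarith)
    rw [Real.sin_two_mul] at h1
    have h2 : Real.sin ((1 + κ) * θ) ≤ 2 * Real.sin θ :=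
      h1.trans (by nlinarith [Real.cos_le_one θ])
    rw [e1, e3]
    nlinarith

/-- The loss of the concentration functional at a jump is controlled by the gain of the
logarithmic functional and by the increment of `zed`. -/
lemma exists_jump_le {a κ : ℝ} (ha : 0 < a) (hκ : 0 < κ) (hκ1 : κ ≤ 1) :
    ∃ C d₀, 0 < C ∧ 0 < d₀ ∧ ∀ d h q, 0 < d → d ≤ d₀ → 0 < h → h ≤ d / 2 → q ∈ Ioo (-1 : ℝ) 1 →
      zed q / (zed q + h) - zed (q + offset a κ q) / (zed (q + offset a κ q) + h) ≤
        C * ((Real.log (zed (q - offset a κ q) + h) - Real.log (zed (q - offset a κ q) + d)) -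
          (Real.log (zed q + h) - Real.log (zed q + d))) +
        1 / d * (zed (q - offset a κ q) - zed (q + offset a κ q)) := by
  -- By `sq_le_zed`, `zed q ≤ d₀` forces `1 - q ≤ min a (2/3)`, the range of `zed_source_near`.
  refine ⟨40 / κ, (min a (2 / 3)) ^ 2 / 2, by positivity, by positivity,
    fun d h q hd hd₀ hh hhd hq => ?_⟩
  have ho := offset_pos ha hκ hq
  have ho1 := offset_le_right (a := a) hκ1 hq
  have ho2 := offset_le_left (a := a) hκ1 hq
  have hqm : q ∈ Icc (-1 : ℝ) 1 := ⟨hq.1.le, hq.2.le⟩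
  have hsrc : q - offset a κ q ∈ Icc (-1 : ℝ) 1 := ⟨by linarith, by linarith [hq.2]⟩
  have hsnk : q + offset a κ q ∈ Icc (-1 : ℝ) 1 := ⟨by linarith [hq.1], by linarith⟩
  have h31 : zed q ≤ zed (q - offset a κ q) := zed_antitoneOn hsrc hqm (by linarith)
  have h12 : zed (q + offset a κ q) ≤ zed q := zed_antitoneOn hqm hsnk (by linarith)
  have near : zed q ≤ d → κ / 2 * zed q ≤ zed (q - offset a κ q) - zed q ∧
      zed (q - offset a κ q) ≤ 4 * zed q := fun hz => by
    have h1 := (sq_le_zed hqm).trans (hz.trans hd₀)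
    have h2 : 1 - q ≤ min a (2 / 3) :=
      (sq_le_sq₀ (by linarith [hq.2]) (by positivity)).mp (by linarith)
    exact zed_source_near hκ hκ1 hq (h2.trans (min_le_left _ _)) (h2.trans (min_le_right _ _))
  have hz2 := zed_nonneg (q + offset a κ q)
  generalize zed (q + offset a κ q) = z₂ at *
  generalize zed (q - offset a κ q) = z₃ at *
  have hz1 : 0 ≤ zed q := hz2.trans h12
  generalize zed q = z₁ at *
  have hz3 : 0 ≤ z₃ := hz1.trans h31
  have hgain : (Real.log (z₃ + h) - Real.log (z₃ + d)) - (Real.log (z₁ + h) - Real.log (z₁ + d)) =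
      Real.log ((z₃ + h) * (z₁ + d) / ((z₁ + h) * (z₃ + d))) := by
    rw [Real.log_div (by positivity) (by positivity), Real.log_mul (by positivity) (by positivity),
      Real.log_mul (by positivity) (by positivity)]
    ring
  have hrat : (z₃ + h) * (z₁ + d) / ((z₁ + h) * (z₃ + d)) =
      1 + (z₃ - z₁) * (d - h) / ((z₁ + h) * (z₃ + d)) := by
    field_simp; ring
  have hx0 : 0 ≤ (z₃ - z₁) * (d - h) / ((z₁ + h) * (z₃ + d)) :=
    div_nonneg (mul_nonneg (by linarith) (by linarith)) (by positivity)
  rw [hgain, hrat]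
  -- Near the endpoint the logarithmic gain alone pays, because the source is farther out by a
  -- definite factor. Away from it the loss is `h (z₁ - z₂) / ((z₁ + h) (z₂ + h))`, at most `(z₁ -
  -- z₂) / d`.
  rcases le_or_gt z₁ d with hz | hz
  · obtain ⟨n1, n2⟩ := near hz
    have hr1 : z₁ / (z₁ + h) ≤ 1 := (div_le_one (by positivity)).mpr (by linarith)
    have hr0 : 0 ≤ z₁ / (z₁ + h) := by positivity
    -- The factor collects `z₃ - z₁ ≥ κ z₁ / 2`, `d - h ≥ d/2` and `z₃ + d ≤ 5 d`; then `log (1 + y)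
    -- ≥ y/2` for `0 ≤ y ≤ 1` turns `κ/20` into `κ/40`.
    have hx : κ / 20 * (z₁ / (z₁ + h)) ≤ (z₃ - z₁) * (d - h) / ((z₁ + h) * (z₃ + d)) := by
      calc κ / 20 * (z₁ / (z₁ + h)) = (κ / 2 * z₁) * (d / 2) / ((z₁ + h) * (5 * d)) := by
            field_simp; ring
        _ ≤ _ := by
          apply div_le_div₀
          · exact mul_nonneg (by linarith) (by linarith)
          · exact mul_le_mul n1 (by linarith) (by linarith) (by linarith)
          · positivity
          · apply mul_le_mul_of_nonneg_left _ (by positivity); linarith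
    have hlog : κ / 40 * (z₁ / (z₁ + h)) ≤
        Real.log (1 + (z₃ - z₁) * (d - h) / ((z₁ + h) * (z₃ + d))) := by
      set y := κ / 20 * (z₁ / (z₁ + h)) with hy
      have hy0 : 0 ≤ y := by positivity
      have hy1 : y ≤ 1 := by rw [hy]; nlinarith
      calc κ / 40 * (z₁ / (z₁ + h)) = y / 2 := by rw [hy]; ring
        _ ≤ 1 - (1 + y)⁻¹ := by
          rw [← one_div, le_sub_comm, div_le_iff₀ (by linarith)]; nlinarith
        _ ≤ Real.log (1 + y) := Real.one_sub_inv_le_log_of_pos (by linarith)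
        _ ≤ _ := Real.log_le_log (by linarith) (by linarith)
    have h5 : z₁ / (z₁ + h) ≤
        40 / κ * Real.log (1 + (z₃ - z₁) * (d - h) / ((z₁ + h) * (z₃ + d))) := by
      calc z₁ / (z₁ + h) = 40 / κ * (κ / 40 * (z₁ / (z₁ + h))) := by field_simp
        _ ≤ _ := by gcongr
    have h6 : 0 ≤ z₂ / (z₂ + h) := by positivity
    have h7 : 0 ≤ 1 / d * (z₃ - z₂) := mul_nonneg (by positivity) (by linarith)
    linarith
  · have h5 : 0 ≤ 40 / κ * Real.log (1 + (z₃ - z₁) * (d - h) / ((z₁ + h) * (z₃ + d))) :=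
      mul_nonneg (by positivity) (Real.log_nonneg (by linarith))
    have h6 : z₁ / (z₁ + h) - z₂ / (z₂ + h) ≤ 1 / d * (z₃ - z₂) := by
      rw [div_sub_div _ _ (by positivity) (by positivity), div_mul_eq_mul_div, one_mul,
        div_le_div_iff₀ (by positivity) hd]
      have e : (z₁ * (z₂ + h) - (z₁ + h) * z₂) * d = (z₁ - z₂) * (h * d) := by ring
      rw [e]
      apply mul_le_mul (by linarith) _ (by positivity) (by linarith)
      nlinarith
    linarith

/-! ### Pairings with the two parts: conserved masses and the monotone quantity. -/

/-- The pairing of the positive part of the solution with `Φ`. -/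
noncomputable def leftPair (f : ℝ → ℝ → ℝ) (p : ℝ → ℝ) (Φ : ℝ → ℝ) (s : ℝ) : ℝ :=
  ∫ x in (-1 : ℝ)..(p s), f x s * Φ x

/-- The pairing of the negative part of the solution with `Φ`. -/
noncomputable def rightPair (f : ℝ → ℝ → ℝ) (p : ℝ → ℝ) (Φ : ℝ → ℝ) (s : ℝ) : ℝ :=
  -∫ x in (p s)..1, f x s * Φ x

lemma leftPair_const_mul (f : ℝ → ℝ → ℝ) (p : ℝ → ℝ) (c : ℝ) (Φ : ℝ → ℝ) (s : ℝ) :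
    leftPair f p (fun x => c * Φ x) s = c * leftPair f p Φ s := by
  rw [leftPair, leftPair, ← intervalIntegral.integral_const_mul]
  congr 1; ext x; ring

lemma rightPair_const_mul (f : ℝ → ℝ → ℝ) (p : ℝ → ℝ) (c : ℝ) (Φ : ℝ → ℝ) (s : ℝ) :
    rightPair f p (fun x => c * Φ x) s = c * rightPair f p Φ s := by
  rw [rightPair, rightPair, mul_neg, ← intervalIntegral.integral_const_mul]
  congr 2; ext x; ring

/-- A Taylor remainder in the parameter, uniform over the range `[0,2]` of `zed`. Integrated against
the bounded mass it lets the test function depend on time. -/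
lemma exp_neg_mul_expansion {r s z : ℝ} (hr : 0 ≤ r) (hz : 0 ≤ z) (hz2 : z ≤ 2)
    (hs : |s - r| ≤ 1 / 2) :
    |Real.exp (-(s * z)) - Real.exp (-(r * z)) + (s - r) * (z * Real.exp (-(r * z)))| ≤
      4 * (s - r) ^ 2 := by
  have h1 : |-((s - r) * z)| ≤ 1 := by
    rw [abs_neg, abs_mul, abs_of_nonneg hz]; nlinarith [abs_nonneg (s - r)]
  have h2 := Real.abs_exp_sub_one_sub_id_le h1
  have h3 : Real.exp (-(s * z)) = Real.exp (-(r * z)) * Real.exp (-((s - r) * z)) := by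
    rw [← Real.exp_add]; congr 1; ring
  have h4 : Real.exp (-(r * z)) ≤ 1 := by
    rw [Real.exp_le_one_iff]; linarith [mul_nonneg hr hz]
  have h5 : Real.exp (-(s * z)) - Real.exp (-(r * z)) + (s - r) * (z * Real.exp (-(r * z))) =
      Real.exp (-(r * z)) * (Real.exp (-((s - r) * z)) - 1 - -((s - r) * z)) := by
    rw [h3]; ring
  rw [h5, abs_mul, abs_of_pos (Real.exp_pos _)]
  calc _ ≤ 1 * (-((s - r) * z)) ^ 2 := mul_le_mul h4 h2 (abs_nonneg _) zero_le_one
    _ = (s - r) ^ 2 * z ^ 2 := by ring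
    _ ≤ (s - r) ^ 2 * 4 := by
      apply mul_le_mul_of_nonneg_left _ (sq_nonneg _); nlinarith
    _ = _ := by ring

lemma neumannTest_exp (r : ℝ) : NeumannTest fun x => Real.exp (-(r * zed x)) :=
  neumannTest_comp_zed (G := fun ζ => Real.exp (-(r * ζ))) fun ζ _ => by fun_prop

lemma neumannTest_mul_exp (r : ℝ) : NeumannTest fun x => zed x * Real.exp (-(r * zed x)) :=
  neumannTest_comp_zed (G := fun ζ => ζ * Real.exp (-(r * ζ))) fun ζ _ => by fun_prop

lemma neumannTest_zed : NeumannTest zed :=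
  neumannTest_comp_zed (G := fun ζ => ζ) fun ζ _ => by fun_prop

lemma deriv_deriv_exp_zed (r x : ℝ) : deriv (deriv fun x => Real.exp (-(r * zed x))) x =
    (Real.pi / 2) ^ 2 * (zed x * (2 - zed x) * r ^ 2 - (1 - zed x) * r) *
      Real.exp (-(r * zed x)) := by
  have h1 : ∀ ζ : ℝ, HasDerivAt (fun ζ => Real.exp (-(r * ζ))) (-r * Real.exp (-(r * ζ))) ζ :=
    fun ζ => by
      refine (((hasDerivAt_id ζ).const_mul r).neg.exp).congr_deriv ?_
      simp; ring
  rw [deriv_deriv_comp_zed (G' := fun ζ => -r * Real.exp (-(r * ζ)))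
    (G'' := fun ζ => -r * (-r * Real.exp (-(r * ζ)))) (fun ζ _ => h1 ζ)
    (fun ζ _ => (h1 ζ).const_mul (-r))]
  ring

lemma deriv_deriv_zed (x : ℝ) : deriv (deriv zed) x = (Real.pi / 2) ^ 2 * (1 - zed x) := by
  have := deriv_deriv_comp_zed (G := fun ζ => ζ) (G' := fun _ => 1) (G'' := fun _ => 0)
    (fun ζ _ => hasDerivAt_id ζ) (fun ζ _ => hasDerivAt_const ζ 1) x
  simpa using this

namespace DuhamelSolution

variable {a κ T : ℝ} {fI : ℝ → ℝ} {f : ℝ → ℝ → ℝ} {p : ℝ → ℝ} {t : ℝ}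

lemma boundary_mem_Icc (h : DuhamelSolution a κ T fI f p) (ht : t ∈ Ioo 0 T) :
    p t ∈ Icc (-1 : ℝ) 1 := Ioo_subset_Icc_self (h.mem_Ioo t ht)

lemma intervalIntegrable_left (h : DuhamelSolution a κ T fI f p) (ht : t ∈ Ioo 0 T) {w : ℝ → ℝ}
    (hw : Continuous w) : IntervalIntegrable (fun x => f x t * w x) volume (-1) (p t) :=
  h.intervalIntegrable_mul ht hw (by norm_num) (h.boundary_mem_Icc ht)

lemma intervalIntegrable_right (h : DuhamelSolution a κ T fI f p) (ht : t ∈ Ioo 0 T) {w : ℝ → ℝ}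
    (hw : Continuous w) : IntervalIntegrable (fun x => f x t * w x) volume (p t) 1 :=
  h.intervalIntegrable_mul ht hw (h.boundary_mem_Icc ht) (by norm_num)

lemma nonneg_of_le (h : DuhamelSolution a κ T fI f p) (ht : t ∈ Ioo 0 T) {x : ℝ}
    (hx : x ∈ Icc (-1) (p t)) : 0 ≤ f x t := by
  rcases hx.2.eq_or_lt with h1 | h1
  · rw [h1, h.eq_zero ht]
  · exact (h.pos_of_lt ht ⟨hx.1, hx.2.trans (h.boundary_mem_Icc ht).2⟩ h1).le

lemma nonpos_of_ge (h : DuhamelSolution a κ T fI f p) (ht : t ∈ Ioo 0 T) {x : ℝ}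
    (hx : x ∈ Icc (p t) 1) : f x t ≤ 0 := by
  rcases hx.1.eq_or_lt with h1 | h1
  · rw [← h1, h.eq_zero ht]
  · exact (h.neg_of_gt ht ⟨(h.boundary_mem_Icc ht).1.trans hx.1, hx.2⟩ h1).le

lemma leftPair_mono (h : DuhamelSolution a κ T fI f p) (ht : t ∈ Ioo 0 T) {Φ Ψ : ℝ → ℝ}
    (hΦ : Continuous Φ) (hΨ : Continuous Ψ) (hle : ∀ x, Φ x ≤ Ψ x) :
    leftPair f p Φ t ≤ leftPair f p Ψ t :=
  intervalIntegral.integral_mono_on (h.boundary_mem_Icc ht).1 (h.intervalIntegrable_left ht hΦ)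
    (h.intervalIntegrable_left ht hΨ) fun x hx =>
      mul_le_mul_of_nonneg_left (hle x) (h.nonneg_of_le ht hx)

lemma rightPair_mono (h : DuhamelSolution a κ T fI f p) (ht : t ∈ Ioo 0 T) {Φ Ψ : ℝ → ℝ}
    (hΦ : Continuous Φ) (hΨ : Continuous Ψ) (hle : ∀ x ∈ Icc (p t) 1, Φ x ≤ Ψ x) :
    rightPair f p Φ t ≤ rightPair f p Ψ t :=
  neg_le_neg (intervalIntegral.integral_mono_on (h.boundary_mem_Icc ht).2
    (h.intervalIntegrable_right ht hΨ) (h.intervalIntegrable_right ht hΦ) fun x hx =>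
      mul_le_mul_of_nonpos_left (hle x hx) (h.nonpos_of_ge ht hx))

lemma leftPair_add (h : DuhamelSolution a κ T fI f p) (ht : t ∈ Ioo 0 T) {Φ Ψ : ℝ → ℝ}
    (hΦ : Continuous Φ) (hΨ : Continuous Ψ) :
    leftPair f p (fun x => Φ x + Ψ x) t = leftPair f p Φ t + leftPair f p Ψ t := by
  rw [leftPair, leftPair, leftPair, ← intervalIntegral.integral_add
    (h.intervalIntegrable_left ht hΦ) (h.intervalIntegrable_left ht hΨ)]
  congr 1; ext x; ring

lemma rightPair_add (h : DuhamelSolution a κ T fI f p) (ht : t ∈ Ioo 0 T) {Φ Ψ : ℝ → ℝ}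
    (hΦ : Continuous Φ) (hΨ : Continuous Ψ) :
    rightPair f p (fun x => Φ x + Ψ x) t = rightPair f p Φ t + rightPair f p Ψ t := by
  rw [rightPair, rightPair, rightPair, ← neg_add, ← intervalIntegral.integral_add
    (h.intervalIntegrable_right ht hΦ) (h.intervalIntegrable_right ht hΨ)]
  congr 2; ext x; ring

lemma hasDerivAt_leftPair (h : DuhamelSolution a κ T fI f p) (ht : t ∈ Ioo 0 T) {Φ : ℝ → ℝ}
    (hΦ : NeumannTest Φ) :
    HasDerivAt (leftPair f p Φ) (leftPair f p (deriv (deriv Φ)) t +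
        (Φ (p t - offset a κ (p t)) - Φ (p t)) * flux f p t) t :=
  h.hasDerivAt_left ht hΦ

lemma hasDerivAt_rightPair (h : DuhamelSolution a κ T fI f p) (ht : t ∈ Ioo 0 T) {Φ : ℝ → ℝ}
    (hΦ : NeumannTest Φ) :
    HasDerivAt (rightPair f p Φ) (rightPair f p (deriv (deriv Φ)) t -
        (Φ (p t) - Φ (p t + offset a κ (p t))) * flux f p t) t :=
  (h.hasDerivAt_right ht hΦ).neg.congr_deriv (by rw [rightPair]; ring)

/-- The total mass of the positive part. -/
lemma exists_leftPair_one (h : DuhamelSolution a κ T fI f p) :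
    ∃ M, 0 < M ∧ ∀ t ∈ Ioo 0 T, leftPair f p (fun _ => 1) t = M := by
  -- For a constant test function the diffusion term and the jump both vanish.
  have hd : ∀ t ∈ Ioo 0 T, HasDerivAt (leftPair f p fun _ => 1) 0 t := fun t ht =>
    (h.hasDerivAt_leftPair ht (neumannTest_const 1)).congr_deriv (by simp [leftPair])
  have hm : T / 2 ∈ Ioo 0 T := ⟨by linarith [h.T_pos], by linarith [h.T_pos]⟩
  refine ⟨_, ?_, fun t ht => isOpen_Ioo.is_const_of_deriv_eq_zero isPreconnected_Ioo
    (fun s hs => (hd s hs).differentiableAt.differentiableWithinAt)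
    (fun s hs => (hd s hs).deriv) ht hm⟩
  have hp := h.mem_Ioo _ hm
  refine intervalIntegral.integral_pos hp.1 ?_ ?_ ⟨-1, ⟨le_rfl, hp.1.le⟩, ?_⟩
  · simpa using (h.continuousOn hm).mono (Icc_subset_Icc le_rfl hp.2.le)
  · intro x hx
    simpa using h.nonneg_of_le hm (Ioc_subset_Icc_self hx)
  · simpa using h.pos_of_lt hm (by norm_num) hp.1

/-- The total mass of the negative part. -/
lemma exists_rightPair_one (h : DuhamelSolution a κ T fI f p) :
    ∃ M, 0 < M ∧ ∀ t ∈ Ioo 0 T, rightPair f p (fun _ => 1) t = M := by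
  have hd : ∀ t ∈ Ioo 0 T, HasDerivAt (rightPair f p fun _ => 1) 0 t := fun t ht =>
    (h.hasDerivAt_rightPair ht (neumannTest_const 1)).congr_deriv (by simp [rightPair])
  have hm : T / 2 ∈ Ioo 0 T := ⟨by linarith [h.T_pos], by linarith [h.T_pos]⟩
  refine ⟨_, ?_, fun t ht => isOpen_Ioo.is_const_of_deriv_eq_zero isPreconnected_Ioo
    (fun s hs => (hd s hs).differentiableAt.differentiableWithinAt)
    (fun s hs => (hd s hs).deriv) ht hm⟩
  have hp := h.mem_Ioo _ hm
  rw [rightPair, ← intervalIntegral.integral_neg]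
  refine intervalIntegral.integral_pos hp.2 ?_ ?_ ⟨1, ⟨hp.2.le, le_rfl⟩, ?_⟩
  · have := ((h.continuousOn hm).mono (Icc_subset_Icc hp.1.le le_rfl)).neg
    simp only [mul_one]
    exact this
  · intro x hx
    simpa using h.nonpos_of_ge hm (Ioc_subset_Icc_self hx)
  · simpa using h.neg_of_gt hm (x := 1) (by norm_num) hp.2

/-- A bounded nondecreasing quantity whose growth dominates the flux, weighted by the distance
between source and sink. -/
lemma exists_monotone_quantity (h : DuhamelSolution a κ T fI f p) :
    ∃ S S' : ℝ → ℝ, ∃ B, (∀ t ∈ Ioo 0 T, HasDerivAt S (S' t) t) ∧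
      (∀ t ∈ Ioo 0 T, (zed (p t - offset a κ (p t)) - zed (p t + offset a κ (p t))) * flux f p t
        ≤ S' t) ∧
      MonotoneOn S (Ioo 0 T) ∧ ∀ t ∈ Ioo 0 T, |S t| ≤ B := by
  obtain ⟨M, hM0, hM⟩ := h.exists_leftPair_one
  obtain ⟨N, hN0, hN⟩ := h.exists_rightPair_one
  set b := (Real.pi / 2) ^ 2 with hb
  have hb0 : 0 < b := by positivity
  -- As `zed'' = b (1 - zed)` lies in `[-b, b]`, diffusion lowers the difference of pairings at rate
  -- at most `b (M + N)`. The linear term compensates this and leaves only the jumps, which have a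
  -- sign.
  set S : ℝ → ℝ := fun t => leftPair f p zed t - rightPair f p zed t + b * (M + N) * t with hS
  set S' : ℝ → ℝ := fun t => (leftPair f p (deriv (deriv zed)) t +
      (zed (p t - offset a κ (p t)) - zed (p t)) * flux f p t) -
    (rightPair f p (deriv (deriv zed)) t -
      (zed (p t) - zed (p t + offset a κ (p t))) * flux f p t) + b * (M + N) with hS'
  have hd : ∀ t ∈ Ioo 0 T, HasDerivAt S (S' t) t := fun t ht => by
    have h1 : HasDerivAt (fun t => b * (M + N) * t) (b * (M + N)) t := by
      simpa using (hasDerivAt_id t).const_mul (b * (M + N))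
    exact ((h.hasDerivAt_leftPair ht neumannTest_zed).sub
      (h.hasDerivAt_rightPair ht neumannTest_zed)).add h1
  have hzc := neumannTest_zed.deriv_deriv.continuous
  have hge : ∀ t ∈ Ioo 0 T,
      (zed (p t - offset a κ (p t)) - zed (p t + offset a κ (p t))) * flux f p t ≤ S' t := by
    intro t ht
    have h1 := h.leftPair_mono ht (Φ := fun _ => -b * 1) continuous_const hzc (fun x => by
      rw [deriv_deriv_zed]; nlinarith [zed_le_two x])
    have h2 := h.rightPair_mono ht (Ψ := fun _ => b * 1) hzc continuous_const (fun x _ => by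
      rw [deriv_deriv_zed]; nlinarith [zed_nonneg x])
    rw [leftPair_const_mul, hM t ht] at h1
    rw [rightPair_const_mul, hN t ht] at h2
    simp only [hS']
    linarith
  have hW : ∀ t ∈ Ioo 0 T,
      0 ≤ (zed (p t - offset a κ (p t)) - zed (p t + offset a κ (p t))) * flux f p t := by
    intro t ht
    have ho := offset_pos h.a_pos h.κ_pos (h.mem_Ioo t ht)
    exact mul_nonneg (sub_nonneg.mpr (zed_antitoneOn (h.source_mem ht) (h.sink_mem ht)
      (by linarith))) (h.flux_pos t ht).le
  refine ⟨S, S', 2 * M + 2 * N + b * (M + N) * T, hd, hge, ?_, fun t ht => ?_⟩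
  · refine monotoneOn_of_deriv_nonneg (convex_Ioo 0 T)
      (fun t ht => (hd t ht).continuousAt.continuousWithinAt)
      (fun t ht => (hd t (interior_subset ht)).differentiableAt.differentiableWithinAt)
      (fun t ht => ?_)
    rw [(hd t (interior_subset ht)).deriv]
    exact (hW t (interior_subset ht)).trans (hge t (interior_subset ht))
  · have h1 := h.leftPair_mono ht (Ψ := fun _ => 2 * 1) continuous_zed continuous_const
      (fun x => by linarith [zed_le_two x])
    have h2 := h.leftPair_mono ht (Φ := fun _ => 0 * 1) continuous_const continuous_zed
      (fun x => by linarith [zed_nonneg x])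
    have h3 := h.rightPair_mono ht (Ψ := fun _ => 2 * 1) continuous_zed continuous_const
      (fun x _ => by linarith [zed_le_two x])
    have h4 := h.rightPair_mono ht (Φ := fun _ => 0 * 1) continuous_const continuous_zed
      (fun x _ => by linarith [zed_nonneg x])
    rw [leftPair_const_mul, hM t ht] at h1 h2
    rw [rightPair_const_mul, hN t ht] at h3 h4
    have h5 : b * (M + N) * t ≤ b * (M + N) * T := by
      apply mul_le_mul_of_nonneg_left ht.2.le; positivity
    have h6 : 0 ≤ b * (M + N) * t := by have := ht.1; positivity
    rw [abs_le]
    simp only [hS]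
    constructor <;> linarith

lemma hasDerivAt_leftPair_exp (h : DuhamelSolution a κ T fI f p) (ht : t ∈ Ioo 0 T) {r : ℝ → ℝ}
    {r' : ℝ} (hr0 : 0 ≤ r t) (hr : HasDerivAt r r' t) :
    HasDerivAt (fun s => leftPair f p (fun x => Real.exp (-(r s * zed x))) s)
      (leftPair f p (deriv (deriv fun x => Real.exp (-(r t * zed x)))) t +
        (Real.exp (-(r t * zed (p t - offset a κ (p t)))) - Real.exp (-(r t * zed (p t)))) *
          flux f p t - r' * leftPair f p (fun x => zed x * Real.exp (-(r t * zed x))) t) t := by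
  obtain ⟨M, hM0, hM⟩ := h.exists_leftPair_one
  set E : ℝ → ℝ → ℝ := fun s x => Real.exp (-(r s * zed x)) with hE
  set Z : ℝ → ℝ := fun x => zed x * Real.exp (-(r t * zed x)) with hZ
  have hEc : ∀ s, Continuous (E s) := fun s => (neumannTest_exp (r s)).continuous
  have hZc : Continuous Z := (neumannTest_mul_exp (r t)).continuous
  -- The remainder after freezing the test function at time `t` and adding its first-order change.
  -- It is `O((s - t)²)`, so the derivative is that of two pairings with fixed test functions.
  set R : ℝ → ℝ := fun s => leftPair f p (E s) s - leftPair f p (E t) s +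
    (r s - r t) * leftPair f p Z s with hR
  have hRd : HasDerivAt R 0 t := by
    have hO : R =O[𝓝 t] fun s => (s - t) ^ 2 := by
      have h1 : R =O[𝓝 t] fun s => (r s - r t) ^ 2 := by
        refine Asymptotics.IsBigO.of_bound (4 * M) ?_
        have hcl := (hr.continuousAt.sub_const (r t)).abs
        filter_upwards [hcl.eventually (Iic_mem_nhds (show |r t - r t| < 1 / 2 by simp)),
          Ioo_mem_nhds ht.1 ht.2] with s hs hsT
        have e1 : R s = leftPair f p (fun x => (E s x + (-1) * E t x) + (r s - r t) * Z x) s := by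
          have c1 : Continuous fun x => -1 * E t x := continuous_const.mul (hEc t)
          rw [h.leftPair_add (Φ := fun x => E s x + -1 * E t x)
              (Ψ := fun x => (r s - r t) * Z x) hsT ((hEc s).add c1) (continuous_const.mul hZc),
            h.leftPair_add (Φ := E s) (Ψ := fun x => -1 * E t x) hsT (hEc s) c1,
            leftPair_const_mul, leftPair_const_mul]
          simp only [hR]; ring
        have hc : Continuous fun x => (E s x + (-1) * E t x) + (r s - r t) * Z x :=
          ((hEc s).add (continuous_const.mul (hEc t))).add (continuous_const.mul hZc)
        have hb : ∀ x, |(E s x + (-1) * E t x) + (r s - r t) * Z x| ≤ 4 * (r s - r t) ^ 2 :=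
          fun x => by
            have := exp_neg_mul_expansion hr0 (zed_nonneg x) (zed_le_two x) hs
            convert this using 2
            simp only [hE, hZ]; ring
        have u1 := h.leftPair_mono hsT (Ψ := fun _ => 4 * (r s - r t) ^ 2 * 1) hc continuous_const
          (fun x => by linarith [(abs_le.mp (hb x)).2])
        have u2 := h.leftPair_mono hsT (Φ := fun _ => -(4 * (r s - r t) ^ 2) * 1) continuous_const
          hc (fun x => by linarith [(abs_le.mp (hb x)).1])
        rw [leftPair_const_mul, hM s hsT] at u1 u2
        rw [e1, Real.norm_eq_abs, Real.norm_of_nonneg (sq_nonneg _), abs_le]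
        constructor <;> linarith
      exact h1.trans (hr.differentiableAt.isBigO_sub.pow 2)
    have h2 : (fun s : ℝ => (s - t) ^ 2) =o[𝓝 t] fun s => s - t :=
      (Asymptotics.isLittleO_pow_id one_lt_two (𝕜 := ℝ)).comp_tendsto
        (show Tendsto (fun s => s - t) (𝓝 t) (𝓝 0) by
          simpa using (continuous_sub_right t).tendsto t)
    have hR0 : R t = 0 := by simp [hR]
    rw [hasDerivAt_iff_isLittleO]
    simpa [hR0] using hO.trans_isLittleO h2
  have d1 := h.hasDerivAt_leftPair ht (neumannTest_exp (r t))
  have d2 := h.hasDerivAt_leftPair ht (neumannTest_mul_exp (r t))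
  have d3 := (d1.sub ((hr.sub_const (r t)).mul d2)).add hRd
  refine HasDerivAt.congr_deriv (d3.congr_of_eventuallyEq (Eventually.of_forall fun s => ?_)) ?_
  · simp only [hR, hE, hZ, Pi.add_apply, Pi.sub_apply, Pi.mul_apply]; ring
  · simp only [hZ]; ring

end DuhamelSolution

/-! ### A Gaussian bound on the positive part near the endpoint. -/

namespace DuhamelSolution

variable {a κ T : ℝ} {fI : ℝ → ℝ} {f : ℝ → ℝ → ℝ} {p : ℝ → ℝ} {t : ℝ}

lemma zed_boundary_le_source (h : DuhamelSolution a κ T fI f p) (ht : t ∈ Ioo 0 T) :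
    zed (p t) ≤ zed (p t - offset a κ (p t)) :=
  zed_antitoneOn (h.source_mem ht) (h.boundary_mem_Icc ht)
    (by linarith [offset_pos h.a_pos h.κ_pos (h.mem_Ioo t ht)])

lemma leftPair_nonneg (h : DuhamelSolution a κ T fI f p) (ht : t ∈ Ioo 0 T) {Φ : ℝ → ℝ}
    (hΦ : Continuous Φ) (h0 : ∀ x, 0 ≤ Φ x) : 0 ≤ leftPair f p Φ t := by
  have := h.leftPair_mono ht (Φ := fun _ => 0 * 1) continuous_const hΦ (by simpa using h0)
  rwa [leftPair_const_mul, zero_mul] at this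

/-- The pairing with a Gaussian that focuses at the final time grows at most as fast as the
corresponding pairing of a solution of the heat equation. -/
lemma exists_hasDerivAt_leftPair_gaussian (h : DuhamelSolution a κ T fI f p) (ht : t ∈ Ioo 0 T)
    {τ : ℝ} (hτ : t < τ) :
    ∃ D, HasDerivAt (fun s => leftPair f p
        (fun x => Real.exp (-(1 / (2 * (Real.pi / 2) ^ 2 * (τ - s)) * zed x))) s) D t ∧
      D ≤ ((Real.pi / 2) ^ 2 / 4 - 1 / (2 * (τ - t))) * leftPair f p
        (fun x => Real.exp (-(1 / (2 * (Real.pi / 2) ^ 2 * (τ - t)) * zed x))) t := by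
  set b := (Real.pi / 2) ^ 2 with hb
  have hb0 : 0 < b := by positivity
  have hθ : 0 < τ - t := sub_pos.mpr hτ
  -- Near `1`, `zed x` is about `b (1 - x)² / 2`, so `r zed` is about `(1 - x)² / (4 (τ - s))`: this
  -- is the exponent of the backward heat kernel that focuses at `(1, τ)`.
  set r : ℝ → ℝ := fun s => 1 / (2 * b * (τ - s)) with hr
  have hr0 : 0 < r t := by simp only [hr]; positivity
  have hrd : HasDerivAt r (2 * b * r t ^ 2) t := by
    have h1 : HasDerivAt (fun s => 2 * b * (τ - s)) (-(2 * b)) t := by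
      simpa using ((hasDerivAt_id t).const_sub τ).const_mul (2 * b)
    have h2 := h1.inv (by positivity)
    simp only [hr, one_div]
    refine h2.congr_deriv ?_
    field_simp
  have hbr : b * r t = 1 / (2 * (τ - t)) := by simp only [hr]; field_simp
  refine ⟨_, h.hasDerivAt_leftPair_exp ht hr0.le hrd, ?_⟩
  have hjump : (Real.exp (-(r t * zed (p t - offset a κ (p t)))) - Real.exp (-(r t * zed (p t)))) *
      flux f p t ≤ 0 := by
    refine mul_nonpos_of_nonpos_of_nonneg (sub_nonpos.mpr (Real.exp_le_exp.mpr ?_))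
      (h.flux_pos t ht).le
    nlinarith [h.zed_boundary_le_source ht]
  set E : ℝ → ℝ := fun x => Real.exp (-(r t * zed x)) with hE
  set Z : ℝ → ℝ := fun x => zed x * Real.exp (-(r t * zed x)) with hZ
  have hEc : Continuous E := (neumannTest_exp (r t)).continuous
  have hEc' : Continuous (deriv (deriv E)) := (neumannTest_exp (r t)).deriv_deriv.continuous
  have hZc : Continuous Z := (neumannTest_mul_exp (r t)).continuous
  have e1 : leftPair f p (deriv (deriv E)) t - 2 * b * r t ^ 2 * leftPair f p Z t =
      leftPair f p (fun x => deriv (deriv E) x + -(2 * b * r t ^ 2) * Z x) t := by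
    rw [h.leftPair_add (Φ := deriv (deriv E)) (Ψ := fun x => -(2 * b * r t ^ 2) * Z x) ht hEc'
      (continuous_const.mul hZc), leftPair_const_mul]
    ring
  -- Since `r' = 2 b r²`, the terms `2 b r² z` cancel. What remains is `b (r z - r² z² - r) = b/4 -
  -- b r - b (r z - 1/2)²` times the exponential.
  have e2 := h.leftPair_mono ht (Φ := fun x => deriv (deriv E) x + -(2 * b * r t ^ 2) * Z x)
    (Ψ := fun x => (b / 4 - b * r t) * E x) (hEc'.add (continuous_const.mul hZc))
    (continuous_const.mul hEc) (fun x => by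
      simp only [hE, hZ, deriv_deriv_exp_zed]
      rw [← hb]
      have h1 := Real.exp_pos (-(r t * zed x))
      nlinarith [mul_nonneg h1.le (mul_nonneg hb0.le (sq_nonneg (r t * zed x - 1 / 2)))])
  rw [leftPair_const_mul] at e2
  rw [← hbr]
  linarith

/-- A Gaussian bound for the concentration of the positive part at the endpoint `1`. -/
lemma exists_leftPair_exp_le (h : DuhamelSolution a κ T fI f p) :
    ∃ C, 0 < C ∧ ∀ t ∈ Ico (T / 2) T, ∀ r, 0 < r →
      leftPair f p (fun x => Real.exp (-(r * zed x))) t ≤ C / √r := by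
  obtain ⟨M, hM0, hM⟩ := h.exists_leftPair_one
  have hT := h.T_pos
  set b := (Real.pi / 2) ^ 2 with hb
  have hb0 : 0 < b := by positivity
  refine ⟨Real.exp (b / 4 * T) * (M / √(T / 4)) / √(2 * b), by positivity, fun t ht r hr => ?_⟩
  -- The focusing time `τ = t + σ` is the one for which the moving Gaussian has parameter exactly
  -- `r` at time `t`.
  set σ := 1 / (2 * b * r) with hσ
  have hσ0 : 0 < σ := by positivity
  set τ := t + σ with hτ
  set L : ℝ → ℝ := fun s => leftPair f p
    (fun x => Real.exp (-(1 / (2 * b * (τ - s)) * zed x))) s with hL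
  have hI : ∀ s ∈ Icc (T / 4) t, s ∈ Ioo 0 T ∧ s < τ := fun s hs =>
    ⟨⟨by linarith [hs.1], by linarith [hs.2, ht.2]⟩, by linarith [hs.2]⟩
  have hd : ∀ s ∈ Icc (T / 4) t, ∃ D ≤ 0, HasDerivAt
      (fun s => Real.exp (-(b / 4) * s) * (√(τ - s))⁻¹ * L s) D s := by
    intro s hs
    obtain ⟨D, hD, hDle⟩ := h.exists_hasDerivAt_leftPair_gaussian (hI s hs).1 (hI s hs).2
    have hθ : 0 < τ - s := sub_pos.mpr (hI s hs).2
    have h1 : HasDerivAt (fun s => Real.exp (-(b / 4) * s))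
        (Real.exp (-(b / 4) * s) * (-(b / 4))) s := by
      simpa using ((hasDerivAt_id s).const_mul (-(b / 4))).exp
    have h2 : HasDerivAt (fun s => (√(τ - s))⁻¹) ((√(τ - s))⁻¹ * (1 / (2 * (τ - s)))) s := by
      have h3 := ((hasDerivAt_id s).const_sub τ).sqrt hθ.ne'
      refine (h3.inv (Real.sqrt_pos.mpr hθ).ne').congr_deriv ?_
      simp only [id, Real.sq_sqrt hθ.le]
      field_simp
    refine ⟨_, ?_, (h1.mul h2).mul hD⟩
    have h4 : 0 < Real.exp (-(b / 4) * s) * (√(τ - s))⁻¹ := by positivity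
    have h5 : _ * D ≤ _ * ((b / 4 - 1 / (2 * (τ - s))) * L s) :=
      mul_le_mul_of_nonneg_left hDle h4.le
    simp only [Pi.mul_apply]
    linarith
  -- The differential inequality for `L` in integrated form. At time `T/4` the value is harmless, as
  -- `L ≤ M` and `τ - T/4 ≥ T/4`; at time `t` the factor `σ^(-1/2)`, proportional to `√r`, yields
  -- the decay.
  have hanti : AntitoneOn (fun s => Real.exp (-(b / 4) * s) * (√(τ - s))⁻¹ * L s)
      (Icc (T / 4) t) := by
    refine antitoneOn_of_deriv_nonpos (convex_Icc _ _)
      (fun s hs => ?_) (fun s hs => ?_) (fun s hs => ?_)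
    · obtain ⟨D, -, hD⟩ := hd s hs
      exact hD.continuousAt.continuousWithinAt
    · obtain ⟨D, -, hD⟩ := hd s (interior_subset hs)
      exact hD.differentiableAt.differentiableWithinAt
    · obtain ⟨D, hD0, hD⟩ := hd s (interior_subset hs)
      rwa [hD.deriv]
  have hle : T / 4 ≤ t := by linarith [ht.1]
  have h1 := hanti ⟨le_rfl, hle⟩ ⟨hle, le_rfl⟩ hle
  have hL0 : ∀ s ∈ Icc (T / 4) t, 0 ≤ L s := fun s hs =>
    h.leftPair_nonneg (hI s hs).1 (neumannTest_exp _).continuous fun x => (Real.exp_pos _).le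
  have hLM : L (T / 4) ≤ M := by
    have hm := (hI _ ⟨le_rfl, hle⟩).1
    rw [← hM _ hm]
    refine h.leftPair_mono hm (neumannTest_exp _).continuous continuous_const fun x => ?_
    rw [Real.exp_le_one_iff, neg_nonpos]
    exact mul_nonneg (by rw [one_div]; exact inv_nonneg.mpr (mul_nonneg (by positivity)
      (sub_nonneg.mpr (hI _ ⟨le_rfl, hle⟩).2.le))) (zed_nonneg x)
  have hLt : L t = leftPair f p (fun x => Real.exp (-(r * zed x))) t := by
    have : 1 / (2 * b * (τ - t)) = r := by rw [hτ, hσ]; field_simp; ring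
    simp only [hL, this]
  have h2 : Real.exp (-(b / 4) * (T / 4)) * (√(τ - T / 4))⁻¹ * L (T / 4) ≤
      M / √(T / 4) := by
    have e1 : Real.exp (-(b / 4) * (T / 4)) ≤ 1 := by
      rw [Real.exp_le_one_iff]; nlinarith
    have e2 : (√(τ - T / 4))⁻¹ ≤ (√(T / 4))⁻¹ := by
      apply inv_anti₀ (by positivity)
      exact Real.sqrt_le_sqrt (by linarith [ht.1])
    calc _ ≤ 1 * (√(T / 4))⁻¹ * M := by
          have := hL0 _ ⟨le_rfl, hle⟩
          gcongr
      _ = _ := by rw [one_mul]; exact (div_eq_inv_mul _ _).symm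
  have h3 : Real.exp (-(b / 4) * T) * (√σ)⁻¹ * L t ≤ M / √(T / 4) := by
    have hL0 : 0 ≤ L t := hL0 t ⟨hle, le_rfl⟩
    have : τ - t = σ := by rw [hτ]; ring
    simp only [this] at h1
    refine le_trans ?_ (h1.trans h2)
    gcongr ?_ * _ * _
    rw [Real.exp_le_exp]
    nlinarith [ht.2]
  rw [← hLt]
  have hs : √σ = 1 / (√(2 * b) * √r) := by
    rw [hσ, Real.sqrt_div zero_le_one, Real.sqrt_one, Real.sqrt_mul (by positivity)]
  have he : Real.exp (-(b / 4) * T) = (Real.exp (b / 4 * T))⁻¹ := by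
    rw [← Real.exp_neg]; ring_nf
  rw [he, mul_assoc, inv_mul_le_iff₀ (Real.exp_pos _), inv_mul_le_iff₀ (by positivity), hs] at h3
  refine h3.trans_eq ?_
  field_simp

end DuhamelSolution

/-! ### Nonconcentration, and the logarithmic and ratio test functions. -/

/-- A negative power is dominated by a lacunary sum of exponentials. -/
lemma rpow_neg_quarter_le_sum {z h : ℝ} (hz : 0 ≤ z) (hz2 : z ≤ 2) (hh : 0 < h) {J : ℕ}
    (hJ : (1 / 16 : ℝ) ^ J ≤ h) :
    (z + h) ^ (-(1 / 4) : ℝ) ≤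
      Real.exp 16 * ∑ j ∈ Finset.range (J + 1), 2 ^ j * Real.exp (-(16 ^ j * z)) := by
  classical
  have hx : 0 < z + h := by linarith
  have hex : ∃ j : ℕ, (1 / 16 : ℝ) ^ j ≤ z + h := ⟨J, by linarith⟩
  -- At the first `j` with `16^(-j) ≤ z + h` the power is at most `2^j`. Minimality gives `16^j z ≤
  -- 16` (for `j = 0` this is `z ≤ 2`), so the exponential with this index is at least `exp (-16)`
  -- and a single term of the sum suffices.
  set j := Nat.find hex with hj
  have hjs : (1 / 16 : ℝ) ^ j ≤ z + h := Nat.find_spec hex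
  have hjJ : j ≤ J := Nat.find_min' hex (by linarith)
  have h16 : 16 ^ j * z ≤ 16 := by
    rcases Nat.eq_zero_or_pos j with h0 | h0
    · rw [h0]; linarith
    · have h1 : z + h < (1 / 16 : ℝ) ^ (j - 1) := not_le.mp (Nat.find_min hex (by omega))
      have h2 : (16 : ℝ) ^ j * (1 / 16) ^ (j - 1) = 16 := by
        obtain ⟨k, hk⟩ := Nat.exists_eq_succ_of_ne_zero h0.ne'
        rw [hk, Nat.succ_sub_one, Nat.succ_eq_add_one, pow_succ, mul_right_comm, ← mul_pow]
        norm_num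
      refine le_of_le_of_eq ?_ h2
      exact mul_le_mul_of_nonneg_left (by linarith) (by positivity)
  have hpow : (z + h) ^ (-(1 / 4) : ℝ) ≤ 2 ^ j := by
    refine (Real.rpow_le_rpow_of_nonpos (by positivity) hjs (by norm_num)).trans_eq ?_
    have h3 : (1 / 16 : ℝ) ^ j = (2 : ℝ) ^ (-(4 * (j : ℝ))) := by
      rw [Real.rpow_neg zero_le_two, Real.rpow_mul zero_le_two, one_div, inv_pow]
      norm_num
    rw [h3, ← Real.rpow_mul zero_le_two, ← Real.rpow_natCast]
    congr 1; ring
  have hterm : 2 ^ j ≤ Real.exp 16 * (2 ^ j * Real.exp (-(16 ^ j * z))) := by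
    rw [mul_left_comm, ← Real.exp_add]
    exact le_mul_of_one_le_right (by positivity) (Real.one_le_exp (by linarith))
  refine hpow.trans (hterm.trans (mul_le_mul_of_nonneg_left ?_ (Real.exp_pos _).le))
  exact Finset.single_le_sum (f := fun j : ℕ => (2 : ℝ) ^ j * Real.exp (-(16 ^ j * z)))
    (fun i _ => by positivity) (Finset.mem_range.mpr (by omega))

/-- Used with `w = δ (zed + h)^(-1/4)`: it bounds the logarithm by the quarter power that
nonconcentration controls, with the small factor `δ`. -/
lemma log_one_add_pow_four_le {w : ℝ} (hw : 0 ≤ w) : Real.log (1 + w ^ 4) ≤ 4 * w := by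
  rw [Real.log_le_iff_le_exp (by positivity), show 4 * w = ((4 : ℕ) : ℝ) * w by norm_num,
    Real.exp_nat_mul]
  have h1 : (1 + w) ^ 4 ≤ Real.exp w ^ 4 := by
    gcongr; linarith [Real.add_one_le_exp w]
  have h2 : 1 + w ^ 4 ≤ (1 + w) ^ 4 := by
    have : 0 ≤ 4 * w + 6 * w ^ 2 + 4 * w ^ 3 := by positivity
    nlinarith
  exact h2.trans h1

lemma rpow_neg_quarter_pow_four {x : ℝ} (hx : 0 < x) : (x ^ (-(1 / 4) : ℝ)) ^ 4 = 1 / x := by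
  rw [← Real.rpow_natCast, ← Real.rpow_mul hx.le]
  norm_num [Real.rpow_neg_one]

lemma rpow_neg_quarter_le {z η : ℝ} (hz : 0 ≤ z) (hη : 0 < η) :
    (z + η ^ 4) ^ (-(1 / 4) : ℝ) ≤ 1 / η := by
  have h1 : (η ^ 4 : ℝ) ^ (-(1 / 4) : ℝ) = 1 / η := by
    rw [← Real.rpow_natCast, ← Real.rpow_mul hη.le]
    norm_num [Real.rpow_neg_one]
  rw [← h1]
  exact Real.rpow_le_rpow_of_nonpos (by positivity) (by linarith) (by norm_num)

/-- The logarithmic test function. -/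
noncomputable def logTest (h d x : ℝ) : ℝ := Real.log (zed x + h) - Real.log (zed x + d)

/-- The concentration test function. -/
noncomputable def ratioTest (h x : ℝ) : ℝ := zed x / (zed x + h)

lemma neumannTest_logTest {h d : ℝ} (hh : 0 < h) (hd : 0 < d) : NeumannTest (logTest h d) :=
  neumannTest_comp_zed (G := fun ζ => Real.log (ζ + h) - Real.log (ζ + d)) fun ζ hζ =>
    ((contDiffAt_id.add contDiffAt_const).log (by simp only [id]; positivity)).sub
      ((contDiffAt_id.add contDiffAt_const).log (by simp only [id]; positivity))

lemma neumannTest_ratioTest {h : ℝ} (hh : 0 < h) : NeumannTest (ratioTest h) :=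
  neumannTest_comp_zed (G := fun ζ => ζ / (ζ + h)) fun ζ hζ =>
    contDiffAt_id.div (contDiffAt_id.add contDiffAt_const) (show ζ + h ≠ 0 by positivity)

lemma logTest_nonpos {h d : ℝ} (hh : 0 < h) (hhd : h ≤ d) (x : ℝ) : logTest h d x ≤ 0 := by
  have := zed_nonneg x
  exact sub_nonpos.mpr (Real.log_le_log (by linarith) (by linarith))

lemma neg_le_logTest {h δ : ℝ} (hh : 0 < h) (hδ : 0 < δ) (x : ℝ) :
    -(4 * δ) * (zed x + h) ^ (-(1 / 4) : ℝ) ≤ logTest h (δ ^ 4) x := by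
  have hz := zed_nonneg x
  have hx : 0 < zed x + h := by linarith
  have hq : 0 < (zed x + h) ^ (-(1 / 4) : ℝ) := Real.rpow_pos_of_pos hx _
  have h1 := log_one_add_pow_four_le (mul_pos hδ hq).le
  rw [mul_pow, rpow_neg_quarter_pow_four hx] at h1
  have h2 : Real.log (zed x + δ ^ 4) - Real.log (zed x + h) ≤
      Real.log (1 + δ ^ 4 * (1 / (zed x + h))) := by
    rw [← Real.log_div (by positivity) hx.ne']
    apply Real.log_le_log (by positivity)
    rw [div_le_iff₀ hx]
    field_simp
    linarith
  unfold logTest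
  linarith

/-- The natural lower bound is `-3 b / (zed + h)` with `h = η⁴` and `b = (π/2)²`. Estimating three
of its four quarter powers by `1/η` leaves a controlled quarter power times `η / h`, smaller by the
factor `η` than the diffusion rate `1/h` of the ratio functional. -/
lemma le_deriv_deriv_logTest {η d : ℝ} (hη : 0 < η) (hd : η ^ 4 ≤ d) (x : ℝ) :
    -(3 * (Real.pi / 2) ^ 2 * η / η ^ 4) * (zed x + η ^ 4) ^ (-(1 / 4) : ℝ) ≤
      deriv (deriv (logTest (η ^ 4) d)) x := by
  set h := η ^ 4 with hh'
  have hh : 0 < h := by positivity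
  have hd0 : 0 < d := hh.trans_le hd
  have hG : ∀ c : ℝ, 0 < c → ∀ ζ : ℝ, 0 ≤ ζ →
      HasDerivAt (fun ζ => Real.log (ζ + c)) (1 / (ζ + c)) ζ := fun c hc ζ hζ =>
    ((hasDerivAt_id ζ).add_const c).log (by simp only [id]; positivity)
  have hG' : ∀ c : ℝ, 0 < c → ∀ ζ : ℝ, 0 ≤ ζ →
      HasDerivAt (fun ζ => 1 / (ζ + c)) (-(1 / (ζ + c) ^ 2)) ζ := fun c hc ζ hζ => by
    simp only [one_div]
    refine (((hasDerivAt_id ζ).add_const c).fun_inv (by simp only [id]; positivity)).congr_deriv ?_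
    simp only [id]; field_simp
  have e := deriv_deriv_comp_zed (G := fun ζ => Real.log (ζ + h) - Real.log (ζ + d))
    (G' := fun ζ => 1 / (ζ + h) - 1 / (ζ + d))
    (G'' := fun ζ => -(1 / (ζ + h) ^ 2) - -(1 / (ζ + d) ^ 2))
    (fun ζ hζ => (hG h hh ζ hζ).sub (hG d hd0 ζ hζ))
    (fun ζ hζ => (hG' h hh ζ hζ).sub (hG' d hd0 ζ hζ)) x
  rw [show logTest h d = fun x => Real.log (zed x + h) - Real.log (zed x + d) from rfl, e]
  have hz := zed_nonneg x
  have hz2 := zed_le_two x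
  set z := zed x
  have hx : 0 < z + h := by positivity
  have hxd : 0 < z + d := by positivity
  set A := 1 / (z + h) with hA
  set B := 1 / (z + d) with hB
  have hA0 : 0 < A := by positivity
  have hB0 : 0 < B := by positivity
  have hBA : B ≤ A := one_div_le_one_div_of_le hx (by linarith)
  have hzA : z * A ≤ 1 := by
    rw [hA, mul_one_div, div_le_one hx]; linarith
  have eA : 1 / (z + h) ^ 2 = A ^ 2 := by rw [hA, one_div_pow]
  have eB : 1 / (z + d) ^ 2 = B ^ 2 := by rw [hB, one_div_pow]
  set q := (z + h) ^ (-(1 / 4) : ℝ) with hq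
  have hq0 : 0 < q := Real.rpow_pos_of_pos hx _
  have hq4 : q ^ 4 = A := rpow_neg_quarter_pow_four hx
  have hqη : q ≤ 1 / η := rpow_neg_quarter_le hz hη
  have h3 : A ≤ η / h * q := by
    rw [← hq4, pow_succ]
    apply mul_le_mul_of_nonneg_right _ hq0.le
    calc q ^ 3 ≤ (1 / η) ^ 3 := by gcongr
      _ = η / h := by rw [hh']; field_simp
  have h4 : -(3 * A) ≤
      z * (2 - z) * (-(1 / (z + h) ^ 2) - -(1 / (z + d) ^ 2)) + (1 - z) * (A - B) := by
    rw [eA, eB]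
    have f1 : z * (2 - z) * A ^ 2 ≤ 2 * A := by
      have : z * A * ((2 - z) * A) ≤ 1 * (2 * A) :=
        mul_le_mul hzA (by nlinarith) (mul_nonneg (by linarith) hA0.le) zero_le_one
      nlinarith
    have f2 : 0 ≤ z * (2 - z) * B ^ 2 :=
      mul_nonneg (mul_nonneg hz (by linarith)) (sq_nonneg B)
    have f3 : -A ≤ (1 - z) * (A - B) := by nlinarith
    nlinarith
  calc -(3 * (Real.pi / 2) ^ 2 * η / h) * q = (Real.pi / 2) ^ 2 * -(3 * (η / h * q)) := by ring
    _ ≤ (Real.pi / 2) ^ 2 * -(3 * A) := by gcongr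
    _ ≤ _ := mul_le_mul_of_nonneg_left h4 (by positivity)

/-- Diffusion pushes mass out of the region where `zed` is small against `h`, at a rate of order
`1/h`. Over the common denominator `h (z + h)³` the left numerator is `h³ - 4 h² z - 11 h z² - 6
z³`; the constant `7` is the one that makes it agree with the lower bound `h² (h - 4 z)` of the
right one to first order in `z`. -/
lemma le_deriv_deriv_ratioTest {h : ℝ} (hh : 0 < h) (hh1 : h ≤ 1) (x : ℝ) :
    (Real.pi / 2) ^ 2 / h * (1 + -7 * ratioTest h x) ≤ deriv (deriv (ratioTest h)) x := by
  have hG : ∀ ζ : ℝ, 0 ≤ ζ → HasDerivAt (fun ζ => ζ / (ζ + h)) (h / (ζ + h) ^ 2) ζ :=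
    fun ζ hζ => by
      refine ((hasDerivAt_id ζ).fun_div ((hasDerivAt_id ζ).add_const h)
        (by simp only [id]; positivity)).congr_deriv ?_
      simp only [id]; ring
  have hG' : ∀ ζ : ℝ, 0 ≤ ζ →
      HasDerivAt (fun ζ => h / (ζ + h) ^ 2) (-(2 * h) / (ζ + h) ^ 3) ζ := fun ζ hζ => by
    refine ((hasDerivAt_const ζ h).fun_div (((hasDerivAt_id ζ).add_const h).fun_pow 2)
      (by simp only [id]; positivity)).congr_deriv ?_
    simp only [id]; field_simp; ring
  rw [show ratioTest h = fun x => zed x / (zed x + h) from rfl,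
    deriv_deriv_comp_zed (G := fun ζ => ζ / (ζ + h)) hG hG' x]
  have hz := zed_nonneg x
  have hz2 := zed_le_two x
  simp only
  set z := zed x
  have hx : 0 < z + h := by positivity
  rw [div_mul_eq_mul_div, mul_div_assoc]
  refine mul_le_mul_of_nonneg_left ?_ (by positivity)
  have e1 : (1 + -7 * (z / (z + h))) / h =
      ((h - 6 * z) * (z + h) ^ 2) / (h * (z + h) ^ 3) := by field_simp; ring
  have e2 : z * (2 - z) * (-(2 * h) / (z + h) ^ 3) + (1 - z) * (h / (z + h) ^ 2) =
      (h ^ 2 * (h - 3 * z + z ^ 2 - z * h)) / (h * (z + h) ^ 3) := by field_simp; ring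
  rw [e1, e2]
  apply div_le_div_of_nonneg_right _ (by positivity)
  have h1 : h ^ 2 * (h - 4 * z) ≤ h ^ 2 * (h - 3 * z + z ^ 2 - z * h) := by
    apply mul_le_mul_of_nonneg_left _ (sq_nonneg h); nlinarith
  refine le_trans ?_ h1
  have : 0 ≤ 11 * h * z ^ 2 + 6 * z ^ 3 := by positivity
  nlinarith

namespace DuhamelSolution

variable {a κ T : ℝ} {fI : ℝ → ℝ} {f : ℝ → ℝ → ℝ} {p : ℝ → ℝ} {t : ℝ}

lemma leftPair_sum (h : DuhamelSolution a κ T fI f p) (ht : t ∈ Ioo 0 T) {Φ : ℕ → ℝ → ℝ}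
    (hΦ : ∀ j, Continuous (Φ j)) (c : ℕ → ℝ) (n : ℕ) :
    leftPair f p (fun x => ∑ j ∈ Finset.range n, c j * Φ j x) t =
      ∑ j ∈ Finset.range n, c j * leftPair f p (Φ j) t := by
  induction n with
  | zero => simp [leftPair]
  | succ n ih =>
    simp only [Finset.sum_range_succ]
    rw [h.leftPair_add (Φ := fun x => ∑ j ∈ Finset.range n, c j * Φ j x)
      (Ψ := fun x => c n * Φ n x) ht
      (continuous_finsetSum _ fun j _ => continuous_const.mul (hΦ j))
      (continuous_const.mul (hΦ n)), ih, leftPair_const_mul]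

lemma continuous_rpow_zed {h : ℝ} (hh : 0 < h) :
    Continuous fun x => (zed x + h) ^ (-(1 / 4) : ℝ) :=
  (continuous_zed.add continuous_const).rpow_const fun x => Or.inl
    (add_pos_of_nonneg_of_pos (zed_nonneg x) hh).ne'

/-- The positive part does not concentrate at the endpoint `1`. -/
lemma exists_leftPair_rpow_le (h : DuhamelSolution a κ T fI f p) :
    ∃ N, 0 < N ∧ ∀ t ∈ Ico (T / 2) T, ∀ h, 0 < h →
      leftPair f p (fun x => (zed x + h) ^ (-(1 / 4) : ℝ)) t ≤ N := by
  obtain ⟨C, hC0, hC⟩ := h.exists_leftPair_exp_le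
  refine ⟨Real.exp 16 * (C * 2), by positivity, fun t ht η hη => ?_⟩
  have htT : t ∈ Ioo 0 T := ⟨by linarith [ht.1, h.T_pos], ht.2⟩
  obtain ⟨J, hJ⟩ := exists_pow_lt_of_lt_one hη (by norm_num : (1 / 16 : ℝ) < 1)
  have hc : ∀ j : ℕ, Continuous fun x => Real.exp (-((16 : ℝ) ^ j * zed x)) := fun j =>
    (neumannTest_exp _).continuous
  have h1 := h.leftPair_mono htT (Ψ := fun x => Real.exp 16 *
      ∑ j ∈ Finset.range (J + 1), (2 : ℝ) ^ j * Real.exp (-(16 ^ j * zed x)))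
    (continuous_rpow_zed hη)
    (continuous_const.mul (continuous_finsetSum _ fun j _ => continuous_const.mul (hc j)))
    fun x => rpow_neg_quarter_le_sum (zed_nonneg x) (zed_le_two x) hη hJ.le
  rw [leftPair_const_mul, h.leftPair_sum htT hc (fun j => (2 : ℝ) ^ j)] at h1
  refine h1.trans (mul_le_mul_of_nonneg_left ?_ (Real.exp_pos _).le)
  -- The weight `2^j` against the Gaussian decay `16^(-j/2) = 4^(-j)` leaves a geometric series.
  -- This is where the exponent `1/4` has to be less than `1/2`.
  have h2 : ∀ j ∈ Finset.range (J + 1),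
      (2 : ℝ) ^ j * leftPair f p (fun x => Real.exp (-((16 : ℝ) ^ j * zed x))) t ≤
        C * (1 / 2) ^ j := fun j _ => by
    have hs : √((16 : ℝ) ^ j) = 2 ^ j * 2 ^ j := by
      rw [Real.sqrt_eq_iff_mul_self_eq (by positivity) (by positivity)]
      rw [← mul_pow, ← mul_pow]; norm_num
    have h3 := hC t ht (16 ^ j) (by positivity)
    rw [hs] at h3
    calc _ ≤ (2 : ℝ) ^ j * (C / (2 ^ j * 2 ^ j)) := by gcongr
      _ = _ := by rw [one_div, inv_pow]; field_simp
  refine (Finset.sum_le_sum h2).trans ?_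
  rw [← Finset.mul_sum]
  apply mul_le_mul_of_nonneg_left _ hC0.le
  have := Summable.sum_le_tsum (Finset.range (J + 1)) (fun i _ => by positivity)
    summable_geometric_two
  rwa [tsum_geometric_two] at this

end DuhamelSolution

/-! ### The free boundary stays away from the endpoint. -/

/-- A linear differential inequality forces exponential relaxation towards the equilibrium. -/
lemma sub_mul_exp_le_of_hasDerivAt {Y Y' : ℝ → ℝ} {k m t₀ t : ℝ} (ht : t₀ ≤ t)
    (hd : ∀ s ∈ Icc t₀ t, HasDerivAt Y (Y' s) s) (hY : ∀ s ∈ Icc t₀ t, k * (m - Y s) ≤ Y' s) :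
    m - (m - Y t₀) * Real.exp (-(k * (t - t₀))) ≤ Y t := by
  have h1 : ∀ s ∈ Icc t₀ t, HasDerivAt (fun s => (Y s - m) * Real.exp (k * s))
      ((Y' s + k * (Y s - m)) * Real.exp (k * s)) s := fun s hs => by
    have h2 : HasDerivAt (fun s => Real.exp (k * s)) (Real.exp (k * s) * k) s := by
      simpa using ((hasDerivAt_id s).const_mul k).exp
    refine (((hd s hs).sub_const m).mul h2).congr_deriv ?_
    ring
  have hmono : MonotoneOn (fun s => (Y s - m) * Real.exp (k * s)) (Icc t₀ t) := by
    refine monotoneOn_of_deriv_nonneg (convex_Icc _ _)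
      (fun s hs => (h1 s hs).continuousAt.continuousWithinAt)
      (fun s hs => (h1 s (interior_subset hs)).differentiableAt.differentiableWithinAt)
      (fun s hs => ?_)
    rw [(h1 s (interior_subset hs)).deriv]
    exact mul_nonneg (by linarith [hY s (interior_subset hs)]) (Real.exp_pos _).le
  have h3 := hmono ⟨le_rfl, ht⟩ ⟨ht, le_rfl⟩ ht
  simp only at h3
  have h4 : Real.exp (k * t₀) = Real.exp (-(k * (t - t₀))) * Real.exp (k * t) := by
    rw [← Real.exp_add]; ring_nf
  rw [h4, ← mul_assoc, mul_le_mul_iff_left₀ (Real.exp_pos _)] at h3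
  linarith

/-- A bounded nondecreasing function on `(0,T)` varies little near `T`. -/
lemma exists_forall_sub_le_of_monotoneOn {S : ℝ → ℝ} {T B ε : ℝ} (hT : 0 < T) (hε : 0 < ε)
    (hS : MonotoneOn S (Ioo 0 T)) (hB : ∀ t ∈ Ioo 0 T, |S t| ≤ B) :
    ∃ t₀ ∈ Ico (T / 2) T, ∀ t ∈ Ico t₀ T, S t - S t₀ ≤ ε := by
  have hbdd : BddAbove (S '' Ioo 0 T) :=
    ⟨B, by rintro _ ⟨t, ht, rfl⟩; exact (le_abs_self _).trans (hB t ht)⟩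
  have hm : T / 2 ∈ Ioo 0 T := ⟨by linarith, by linarith⟩
  obtain ⟨_, ⟨s, hs, rfl⟩, hlt⟩ := exists_lt_of_lt_csSup
    (⟨_, mem_image_of_mem S hm⟩ : (S '' Ioo 0 T).Nonempty) (sub_lt_self (sSup (S '' Ioo 0 T)) hε)
  refine ⟨max s (T / 2), ⟨le_max_right _ _, max_lt hs.2 hm.2⟩, fun t ht => ?_⟩
  have h0 : max s (T / 2) ∈ Ioo 0 T := ⟨lt_max_of_lt_left hs.1, max_lt hs.2 hm.2⟩
  have h1 := hS hs h0 (le_max_left _ _)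
  have h2 := le_csSup hbdd (mem_image_of_mem S (⟨h0.1.trans_le ht.1, ht.2⟩ : t ∈ Ioo 0 T))
  linarith

namespace DuhamelSolution

variable {a κ T : ℝ} {fI : ℝ → ℝ} {f : ℝ → ℝ → ℝ} {p : ℝ → ℝ} {t : ℝ}

/-- The logarithmic functional of the positive part is small with `δ`, uniformly in `h`. -/
lemma neg_le_leftPair_logTest (h : DuhamelSolution a κ T fI f p) (ht : t ∈ Ioo 0 T) {η δ N : ℝ}
    (hη : 0 < η) (hδ : 0 < δ)
    (hN : leftPair f p (fun x => (zed x + η) ^ (-(1 / 4) : ℝ)) t ≤ N) :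
    -(4 * δ * N) ≤ leftPair f p (logTest η (δ ^ 4)) t := by
  have h1 := h.leftPair_mono ht
    (Φ := fun x => -(4 * δ) * (zed x + η) ^ (-(1 / 4) : ℝ))
    (continuous_const.mul (continuous_rpow_zed hη))
    (neumannTest_logTest hη (by positivity)).continuous (neg_le_logTest hη hδ)
  rw [leftPair_const_mul] at h1
  have : 4 * δ * leftPair f p (fun x => (zed x + η) ^ (-(1 / 4) : ℝ)) t ≤ 4 * δ * N := by gcongr
  linarith

lemma leftPair_logTest_nonpos (h : DuhamelSolution a κ T fI f p) (ht : t ∈ Ioo 0 T) {η d : ℝ}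
    (hη : 0 < η) (hηd : η ≤ d) : leftPair f p (logTest η d) t ≤ 0 := by
  have h1 := h.leftPair_mono ht (Ψ := fun _ => 0 * 1)
    (neumannTest_logTest hη (hη.trans_le hηd)).continuous continuous_const
    (fun x => by simpa using logTest_nonpos hη hηd x)
  rwa [leftPair_const_mul, zero_mul] at h1

/-- The free boundary stays away from the endpoint `1`. -/
theorem exists_boundary_le (h : DuhamelSolution a κ T fI f p) :
    ∃ ε > 0, ∃ t₂ ∈ Ioo 0 T, ∀ t ∈ Ico t₂ T, p t ≤ 1 - ε := by
  obtain ⟨M, hM0, hM⟩ := h.exists_rightPair_one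
  obtain ⟨S, S', B, hSd, hSW, hSm, hSB⟩ := h.exists_monotone_quantity
  obtain ⟨N, hN0, hN⟩ := h.exists_leftPair_rpow_le
  obtain ⟨C, d₀, hC0, hd₀, hjump⟩ := exists_jump_le h.a_pos h.κ_pos h.κ_le
  have hT := h.T_pos
  have hpi := Real.pi_pos
  set b := (Real.pi / 2) ^ 2 with hb
  have hb0 : 0 < b := by positivity
  -- The number `31 = 7 * 4 + 3` adds up the errors in the inequality for `Y`: replacing `E` by `Y`
  -- costs `4 C N δ` with weight `7`, and the diffusion of the logarithmic functional costs `3 C N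
  -- δ`. Half of `M` survives, so the equilibrium is `m = M / 14`.
  obtain ⟨δ, hδ0, hδ1, hδd, hδM⟩ : ∃ δ : ℝ, 0 < δ ∧ δ ≤ 1 ∧ δ ^ 4 ≤ d₀ ∧
      31 * (C * N) * δ ≤ M / 2 := by
    refine ⟨min 1 (min d₀ (M / 2 / (31 * (C * N)))), by positivity, min_le_left _ _, ?_, ?_⟩
    · refine le_trans (pow_le_of_le_one (by positivity) (min_le_left _ _) (by norm_num)) ?_
      exact (min_le_right _ _).trans (min_le_left _ _)
    · rw [mul_comm, ← le_div_iff₀ (by positivity)]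
      exact (min_le_right _ _).trans (min_le_right _ _)
  set d := δ ^ 4 with hd
  have hd0 : 0 < d := by positivity
  set m := M / 14 with hm
  have hm0 : 0 < m := by positivity
  obtain ⟨t₀, ht₀, hSt₀⟩ := exists_forall_sub_le_of_monotoneOn hT
    (ε := d * (m / 4)) (by positivity) hSm hSB
  have ht₀T : t₀ ∈ Ioo 0 T := ⟨by linarith [ht₀.1], ht₀.2⟩
  have hgap : 0 < T - t₀ := sub_pos.mpr ht₀.2
  -- The scale `h = η⁴` is chosen last: the relaxation time, of order `h`, has to fit into half of
  -- the remaining time `T - t₀`. The bounds on `A` do not deteriorate as `h` decreases.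
  obtain ⟨η, hη0, hηδ, hηd, hηt⟩ : ∃ η : ℝ, 0 < η ∧ η ≤ δ ∧ η ^ 4 ≤ d / 2 ∧
      η ^ 4 ≤ b * (T - t₀) / 2 := by
    have hle : ∀ c : ℝ, 0 < c → min (δ) (min (d / 2) (b * (T - t₀) / 2)) ≤ c →
        min (δ) (min (d / 2) (b * (T - t₀) / 2)) ^ 4 ≤ c := fun c hc hle =>
      (pow_le_of_le_one (by positivity) ((min_le_left _ _).trans hδ1) (by norm_num)).trans hle
    exact ⟨min δ (min (d / 2) (b * (T - t₀) / 2)), by positivity, min_le_left _ _,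
      hle _ (by positivity) ((min_le_right _ _).trans (min_le_left _ _)),
      hle _ (by positivity) ((min_le_right _ _).trans (min_le_right _ _))⟩
  have hh1 : η ^ 4 ≤ 1 := pow_le_one₀ hη0.le (hηδ.trans hδ1)
  set k := η ^ 4 with hk
  have hk0 : 0 < k := by positivity
  have hkd : k ≤ d := by linarith
  have hIoo : ∀ s ∈ Ico t₀ T, s ∈ Ioo 0 T := fun s hs => ⟨ht₀T.1.trans_le hs.1, hs.2⟩
  have hψ := neumannTest_ratioTest hk0
  have hφ := neumannTest_logTest hk0 hd0
  set A : ℝ → ℝ := leftPair f p (logTest k d) with hA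
  set E : ℝ → ℝ := rightPair f p (ratioTest k) with hE
  have hAle : ∀ s ∈ Ico t₀ T, A s ≤ 0 := fun s hs =>
    h.leftPair_logTest_nonpos (hIoo s hs) hk0 hkd
  have hAge : ∀ s ∈ Ico t₀ T, -(4 * δ * N) ≤ A s := fun s hs =>
    h.neg_le_leftPair_logTest (hIoo s hs) hk0 hδ0 (hN s ⟨ht₀.1.trans hs.1, hs.2⟩ k hk0)
  -- The coefficients are those of `exists_jump_le`, so all jump terms together are nonnegative and
  -- only diffusion enters the lower bound for `Y'`.
  set Y : ℝ → ℝ := fun s => E s + C * A s + 1 / d * (S s - S t₀) with hY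
  set Y' : ℝ → ℝ := fun s =>
    (rightPair f p (deriv (deriv (ratioTest k))) s -
        (ratioTest k (p s) - ratioTest k (p s + offset a κ (p s))) * flux f p s) +
      C * (leftPair f p (deriv (deriv (logTest k d))) s +
        (logTest k d (p s - offset a κ (p s)) - logTest k d (p s)) * flux f p s) +
      1 / d * S' s with hY'
  have hYd : ∀ s ∈ Ico t₀ T, HasDerivAt Y (Y' s) s := fun s hs =>
    ((h.hasDerivAt_rightPair (hIoo s hs) hψ).add
      ((h.hasDerivAt_leftPair (hIoo s hs) hφ).const_mul C)).add
      (((hSd s (hIoo s hs)).sub_const (S t₀)).const_mul (1 / d))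
  have hYge : ∀ s ∈ Ico t₀ T, 7 * b / k * (m - Y s) ≤ Y' s := by
    intro s hs
    have hsT := hIoo s hs
    have h1 := h.rightPair_mono hsT (Φ := fun x => b / k * (1 + -7 * ratioTest k x))
      (continuous_const.mul (continuous_const.add (continuous_const.mul hψ.continuous)))
      hψ.deriv_deriv.continuous fun x _ => le_deriv_deriv_ratioTest hk0 hh1 x
    rw [rightPair_const_mul, h.rightPair_add (Φ := fun _ => 1) (Ψ := fun x => -7 * ratioTest k x)
      hsT continuous_const (continuous_const.mul hψ.continuous), rightPair_const_mul,
      hM s hsT] at h1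
    have h2 := h.leftPair_mono hsT
      (Φ := fun x => -(3 * b * η / k) * (zed x + k) ^ (-(1 / 4) : ℝ))
      (continuous_const.mul (continuous_rpow_zed hk0))
      hφ.deriv_deriv.continuous fun x => le_deriv_deriv_logTest hη0 hkd x
    rw [leftPair_const_mul] at h2
    have h3 : 3 * b * η / k * leftPair f p (fun x => (zed x + k) ^ (-(1 / 4) : ℝ)) s ≤
        3 * b * δ / k * N := by
      have h0 := h.leftPair_nonneg hsT (continuous_rpow_zed hk0)
        fun x => Real.rpow_nonneg (add_nonneg (zed_nonneg x) hk0.le) _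
      gcongr
      exact hN s ⟨ht₀.1.trans hs.1, hs.2⟩ k hk0
    have h4 : -(3 * b * δ / k * N) ≤ leftPair f p (deriv (deriv (logTest k d))) s := by
      linarith
    have h5 := mul_le_mul_of_nonneg_right
      (hjump d k (p s) hd0 hδd hk0 hηd (h.mem_Ioo s hsT)) (h.flux_pos s hsT).le
    have h6 := mul_le_mul_of_nonneg_left (hSW s hsT) (by positivity : 0 ≤ 1 / d)
    have h7 := mul_le_mul_of_nonneg_left h4 hC0.le
    have h8 : E s ≤ Y s + 4 * (C * N) * δ := by
      have h9 : S t₀ ≤ S s := hSm ht₀T hsT hs.1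
      have h10 := mul_le_mul_of_nonneg_left (hAge s hs) hC0.le
      have h11 : 0 ≤ 1 / d * (S s - S t₀) := mul_nonneg (by positivity) (by linarith)
      simp only [hY]
      linarith
    have h12 : b / k * (7 * (m - Y s)) ≤ b / k * (M + -7 * E s - 3 * (C * N) * δ) := by
      apply mul_le_mul_of_nonneg_left _ (by positivity)
      linarith
    have h13 : C * -(3 * b * δ / k * N) = -(b / k * (3 * (C * N) * δ)) := by ring
    have h14 : 7 * b / k * (m - Y s) = b / k * (7 * (m - Y s)) := by ring
    have h15 : (zed (p s) / (zed (p s) + k) -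
        zed (p s + offset a κ (p s)) / (zed (p s + offset a κ (p s)) + k)) =
        ratioTest k (p s) - ratioTest k (p s + offset a κ (p s)) := rfl
    have h16 : Real.log (zed (p s - offset a κ (p s)) + k) -
        Real.log (zed (p s - offset a κ (p s)) + d) - (Real.log (zed (p s) + k) -
        Real.log (zed (p s) + d)) =
        logTest k d (p s - offset a κ (p s)) - logTest k d (p s) := rfl
    rw [h15, h16] at h5
    simp only [hY']
    rw [h14]
    rw [h13] at h7
    linarith
  have hY0 : -m ≤ Y t₀ := by
    have hself : t₀ ∈ Ico t₀ T := ⟨le_rfl, ht₀.2⟩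
    have h1 : 0 ≤ E t₀ := by
      have h2 := h.rightPair_mono ht₀T (Φ := fun _ => 0 * 1) continuous_const hψ.continuous
        fun x _ => by
          rw [zero_mul]
          exact div_nonneg (zed_nonneg x) (by linarith [zed_nonneg x])
      rwa [rightPair_const_mul, zero_mul] at h2
    have h3 := mul_le_mul_of_nonneg_left (hAge t₀ hself) hC0.le
    simp only [hY, sub_self, mul_zero, add_zero]
    linarith
  -- After the midpoint `Y ≥ 3m/4`, hence `E ≥ m/2 = M/28`. The ratio at `p t` is then at least
  -- `1/28`, that is `27 zed (p t) ≥ k`, and `zed_le_mul` converts this to a distance.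
  refine ⟨2 * k / (27 * Real.pi), by positivity, (t₀ + T) / 2,
    ⟨by linarith [ht₀T.1], by linarith⟩, fun t ht => ?_⟩
  have htI : t ∈ Ico t₀ T := ⟨by linarith [ht.1], ht.2⟩
  have htT := hIoo t htI
  have hsub : ∀ s ∈ Icc t₀ t, s ∈ Ico t₀ T := fun s hs => ⟨hs.1, hs.2.trans_lt ht.2⟩
  have hrelax := sub_mul_exp_le_of_hasDerivAt htI.1 (fun s hs => hYd s (hsub s hs))
    (fun s hs => hYge s (hsub s hs))
  have hexp : Real.exp (-(7 * b / k * (t - t₀))) ≤ 1 / 8 := by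
    have h1 : 7 ≤ 7 * b / k * (t - t₀) := by
      rw [div_mul_eq_mul_div, le_div_iff₀ hk0]
      have : b * ((T - t₀) / 2) ≤ b * (t - t₀) :=
        mul_le_mul_of_nonneg_left (by linarith [ht.1]) hb0.le
      linarith
    rw [Real.exp_neg, one_div]
    exact inv_anti₀ (by norm_num) (by linarith [Real.add_one_le_exp (7 * b / k * (t - t₀))])
  have hYt : 3 / 4 * m ≤ Y t := by
    have h1 : (m - Y t₀) * Real.exp (-(7 * b / k * (t - t₀))) ≤ 2 * m * (1 / 8) :=
      mul_le_mul (by linarith) hexp (Real.exp_pos _).le (by linarith)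
    linarith
  have hEt : m / 2 ≤ E t := by
    have h1 : C * A t ≤ 0 := mul_nonpos_of_nonneg_of_nonpos hC0.le (hAle t htI)
    have h2 : 1 / d * (S t - S t₀) ≤ m / 4 := by
      rw [one_div, inv_mul_le_iff₀ hd0]
      exact hSt₀ t htI
    simp only [hY] at hYt
    linarith
  have hEle : E t ≤ ratioTest k (p t) * M := by
    have h1 := h.rightPair_mono htT (Ψ := fun _ => ratioTest k (p t) * 1) hψ.continuous
      continuous_const fun x hx => by
        have hz : zed x ≤ zed (p t) := zed_antitoneOn (h.boundary_mem_Icc htT)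
          ⟨(h.boundary_mem_Icc htT).1.trans hx.1, hx.2⟩ hx.1
        have h0 := zed_nonneg x
        have h0' := zed_nonneg (p t)
        rw [mul_one, ratioTest, ratioTest, div_le_div_iff₀ (by linarith) (by linarith)]
        nlinarith
    rwa [rightPair_const_mul, hM t htT] at h1
  have hz : k ≤ 27 * zed (p t) := by
    have h0 := zed_nonneg (p t)
    have hzk : 0 < zed (p t) + k := by linarith
    have h1 : 1 / 28 ≤ ratioTest k (p t) := by
      by_contra hcon
      have := mul_lt_mul_of_pos_right (not_le.mp hcon) hM0
      linarith
    rw [ratioTest, le_div_iff₀ hzk] at h1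
    linarith
  have hz2 := zed_le_mul (p t) (h.boundary_mem_Icc htT).2
  have : 2 * k / (27 * Real.pi) ≤ 1 - p t := by
    rw [div_le_iff₀ (by positivity)]
    linarith
  linarith

end DuhamelSolution

/-! ### Reflection symmetry and integrability of the flux. -/

lemma flux_neg (f : ℝ → ℝ → ℝ) (p : ℝ → ℝ) (t : ℝ) :
    flux (fun x t => -f (-x) t) (fun t => -p t) t = flux f p t := by
  unfold flux
  have h1 : deriv (fun x => -f (-x) t) (-p t) = -deriv (fun x => f (-x) t) (-p t) :=
    deriv.fun_neg
  rw [h1, deriv_comp_neg (fun x => f x t), neg_neg, neg_neg]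

/-- The difference equals `2 cos (π q / 2) sin (π o / 2)`, and Jordan's inequality bounds both
factors. Thus the weight on the flux degenerates only at the endpoints. -/
lemma mul_le_zed_sub_zed {q o : ℝ} (hq : q ∈ Icc (-1 : ℝ) 1) (ho : o ∈ Icc (0 : ℝ) 1) :
    2 * (1 - |q|) * o ≤ zed (q - o) - zed (q + o) := by
  have hpi := Real.pi_pos
  have hlow : ∀ x ∈ Icc (0 : ℝ) 1, x ≤ Real.sin (Real.pi / 2 * x) := fun x hx => by
    have h1 := Real.mul_le_sin (x := Real.pi / 2 * x) (mul_nonneg (by positivity) hx.1)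
      (by nlinarith [hx.2])
    have h2 : 2 / Real.pi * (Real.pi / 2 * x) = x := by field_simp
    rwa [h2] at h1
  have habs : |q| ≤ 1 := abs_le.mpr hq
  have h1 : 1 - |q| ≤ Real.cos (Real.pi / 2 * q) := by
    have h2 := hlow (1 - |q|) ⟨by linarith, by linarith [abs_nonneg q]⟩
    rwa [show Real.pi / 2 * (1 - |q|) = Real.pi / 2 - Real.pi / 2 * |q| by ring,
      Real.sin_pi_div_two_sub, ← abs_of_pos (by positivity : 0 < Real.pi / 2), ← abs_mul,
      Real.cos_abs] at h2
  have h3 : zed (q - o) - zed (q + o) =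
      2 * (Real.cos (Real.pi / 2 * q) * Real.sin (Real.pi / 2 * o)) := by
    rw [zed, zed, mul_add, mul_sub, Real.sin_add, Real.sin_sub]; ring
  have h4 := mul_le_mul h1 (hlow o ho) ho.1 ((sub_nonneg.mpr habs).trans h1)
  rw [h3]
  linarith

namespace DuhamelSolution

variable {a κ T : ℝ} {fI : ℝ → ℝ} {f : ℝ → ℝ → ℝ} {p : ℝ → ℝ} {t : ℝ}

/-- Solutions are mapped to solutions by the reflection `f ↦ -f(-x)`. -/
lemma reflect (h : DuhamelSolution a κ T fI f p) :
    DuhamelSolution a κ T (fun x => -fI (-x)) (fun x t => -f (-x) t) (fun t => -p t) where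
  a_pos := h.a_pos
  κ_pos := h.κ_pos
  κ_le := h.κ_le
  T_pos := h.T_pos
  continuousOn_initial := (h.continuousOn_initial.comp continuous_neg.continuousOn
    fun x hx => ⟨by linarith [hx.2], by linarith [hx.1]⟩).fun_neg
  zeroSet t ht := by
    have h0 := h.zeroSet t ht
    ext x
    have h1 : -x ∈ {x ∈ Icc (-1 : ℝ) 1 | f x t = 0} ↔ -x ∈ ({p t} : Set ℝ) := by rw [h0]
    simp only [mem_ofPred_eq, mem_Icc, mem_singleton_iff, neg_eq_zero] at h1 ⊢
    rw [← neg_eq_iff_eq_neg, ← h1]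
    constructor <;> rintro ⟨⟨h2, h3⟩, h4⟩ <;> exact ⟨⟨by linarith, by linarith⟩, h4⟩
  mem_Ioo t ht := ⟨by linarith [(h.mem_Ioo t ht).2], by linarith [(h.mem_Ioo t ht).1]⟩
  smooth t ht := by
    obtain ⟨U, hU, hf⟩ := h.smooth t ht
    have hc : Continuous fun z : ℝ × ℝ => (-z.1, z.2) := by fun_prop
    have hs : ContDiff ℝ ∞ fun z : ℝ × ℝ => (-z.1, z.2) := by fun_prop
    refine ⟨(fun z : ℝ × ℝ => (-z.1, z.2)) ⁻¹' U, hc.continuousAt.preimage_mem_nhds ?_, ?_⟩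
    · simpa using hU
    · exact (hf.comp hs.contDiffOn fun z hz => hz).neg
  flux_pos t ht := by rw [flux_neg]; exact h.flux_pos t ht
  bounded T' hT' := by
    obtain ⟨C, hC⟩ := h.bounded T' hT'
    refine ⟨C, fun t ht x hx => ?_⟩
    rw [abs_neg]
    exact hC t ht (-x) ⟨by linarith [hx.2], by linarith [hx.1]⟩
  flux_integrable T' hT' := by
    simp only [funext (flux_neg f p)]
    exact h.flux_integrable T' hT'
  duhamel t ht x hx := by
    have h1 := h.duhamel t ht (-x) ⟨by linarith [hx.2], by linarith [hx.1]⟩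
    have h2 : (∫ y in (-1 : ℝ)..1, neumannKernel x y t * -fI (-y)) =
        -∫ y in (-1 : ℝ)..1, neumannKernel (-x) y t * fI y := by
      have h3 := intervalIntegral.integral_comp_neg (a := -1) (b := 1)
        fun y => neumannKernel (-x) y t * fI y
      simp only [neumannKernel_neg, neg_neg] at h3
      rw [← h3, ← intervalIntegral.integral_neg]
      congr 1; ext y; ring
    rw [h1, h2, neg_add]
    -- Reflection exchanges source and sink, and the sign of `-f` restores their difference.
    refine congrArg₂ (· + ·) rfl (intervalIntegral.integral_neg.symm.trans
      (intervalIntegral.integral_congr fun s _ => ?_))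
    rw [flux_neg, offset_neg, ← neumannKernel_neg (-x), ← neumannKernel_neg (-x)]
    simp only [neg_neg, neg_add, neg_sub]
    ring_nf

/-- The free boundary stays in a compact subset of `(-1,1)`. -/
lemma exists_abs_boundary_le (h : DuhamelSolution a κ T fI f p) :
    ∃ ε > 0, ∃ t₂ ∈ Ioo 0 T, ∀ t ∈ Ico t₂ T, |p t| ≤ 1 - ε := by
  obtain ⟨ε₁, hε₁, t₁, ht₁, h₁⟩ := h.exists_boundary_le
  obtain ⟨ε₂, hε₂, t₂, ht₂, h₂⟩ := h.reflect.exists_boundary_le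
  refine ⟨min ε₁ ε₂, lt_min hε₁ hε₂, max t₁ t₂, ⟨lt_max_of_lt_left ht₁.1, max_lt ht₁.2 ht₂.2⟩,
    fun t ht => abs_le.mpr ⟨?_, ?_⟩⟩
  · have := h₂ t ⟨(le_max_right _ _).trans ht.1, ht.2⟩
    linarith [min_le_right ε₁ ε₂]
  · have := h₁ t ⟨(le_max_left _ _).trans ht.1, ht.2⟩
    linarith [min_le_left ε₁ ε₂]

/-- The flux through the free boundary is integrable up to the final time. -/
theorem integrableOn_flux_Ioo (h : DuhamelSolution a κ T fI f p) :
    IntegrableOn (flux f p) (Ioo 0 T) := by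
  obtain ⟨ε, hε, t₂, ht₂, hp⟩ := h.exists_abs_boundary_le
  obtain ⟨S, S', B, hSd, hSW, -, hSB⟩ := h.exists_monotone_quantity
  have hT := h.T_pos
  have ha := h.a_pos
  have hκ := h.κ_pos
  -- A lower bound for the weight when `|p| ≤ 1 - ε`: there the offset is at least `min a (κ ε)`.
  set w := 2 * ε * min a (κ * ε) with hw
  have hw0 : 0 < w := by positivity
  have hIoo : ∀ t ∈ Ico t₂ T, t ∈ Ioo 0 T := fun t ht => ⟨ht₂.1.trans_le ht.1, ht.2⟩
  have hle : ∀ t ∈ Ico t₂ T, flux f p t ≤ 1 / w * S' t := by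
    intro t ht
    have htT := hIoo t ht
    have hpt := abs_le.mp (hp t ht)
    have ho0 := offset_pos ha hκ (h.mem_Ioo t htT)
    have ho1 := offset_le_right (a := a) h.κ_le (h.mem_Ioo t htT)
    have ho2 := offset_le_left (a := a) h.κ_le (h.mem_Ioo t htT)
    have hoε : min a (κ * ε) ≤ offset a κ (p t) := by
      refine min_le_min le_rfl (le_min ?_ ?_)
      · refine mul_le_mul_of_nonneg_left ?_ hκ.le
        rw [abs_sub_comm]
        exact le_trans (by linarith) (le_abs_self _)
      · exact mul_le_mul_of_nonneg_left (le_trans (by linarith) (le_abs_self _)) hκ.le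
    have h1 := mul_le_zed_sub_zed (h.boundary_mem_Icc htT) (o := offset a κ (p t))
      ⟨ho0.le, by linarith⟩
    have h2 : w ≤ 2 * (1 - |p t|) * offset a κ (p t) := by
      have := hp t ht
      exact mul_le_mul (by linarith) hoε (by positivity) (by linarith)
    have h3 := mul_le_mul_of_nonneg_right (h2.trans h1) (h.flux_pos t htT).le
    rw [one_div, le_inv_mul_iff₀ hw0]
    exact h3.trans (hSW t htT)
  -- Integrability is known only up to times before `T`, so `T` is approached by a sequence on which
  -- the integrals are uniformly bounded. The shift by `2` keeps the term `n = 0` positive.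
  have hmem : ∀ n : ℕ, T - T / (n + 2) ∈ Ioo 0 T := fun n => by
    have h1 : 0 < T / ((n : ℝ) + 2) := by positivity
    have h2 : T / ((n : ℝ) + 2) < T := by
      rw [div_lt_iff₀ (by positivity)]
      nlinarith [(Nat.cast_nonneg n : (0 : ℝ) ≤ n)]
    constructor <;> linarith
  have hlim : Tendsto (fun n : ℕ => T - T / ((n : ℝ) + 2)) atTop (𝓝 T) := by
    have h1 : Tendsto (fun n : ℕ => T / ((n : ℝ) + 2)) atTop (𝓝 0) :=
      tendsto_const_nhds.div_atTop
        (tendsto_atTop_add_const_right _ _ tendsto_natCast_atTop_atTop)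
    simpa using tendsto_const_nhds.sub h1
  have htail : IntegrableOn (flux f p) (Ioc t₂ T) := by
    refine integrableOn_Ioc_of_intervalIntegral_norm_bounded_right (I := 1 / w * (2 * B))
      (fun n : ℕ => (h.flux_integrable _ (hmem n)).mono_set (Ioc_subset_Ioc_left ht₂.1.le)) hlim ?_
    filter_upwards [hlim.eventually (lt_mem_nhds ht₂.2)] with n hn
    set t := T - T / ((n : ℝ) + 2) with ht
    have hsub : ∀ s ∈ Icc t₂ t, s ∈ Ico t₂ T := fun s hs => ⟨hs.1, hs.2.trans_lt (hmem n).2⟩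
    have hd : ∀ s ∈ Icc t₂ t, HasDerivAt (fun s => 1 / w * S s) (1 / w * S' s) s :=
      fun s hs => (hSd s (hIoo s (hsub s hs))).const_mul _
    have h1 : (∫ s in t₂..t, flux f p s) ≤ 1 / w * S t - 1 / w * S t₂ := by
      refine intervalIntegral.integral_le_sub_of_hasDeriv_right_of_le hn.le
        (fun s hs => (hd s hs).continuousAt.continuousWithinAt)
        (fun s hs => (hd s (Ioo_subset_Icc_self hs)).hasDerivWithinAt) ?_
        (fun s hs => hle s (hsub s (Ioo_subset_Icc_self hs)))
      exact (h.flux_integrable t (hmem n)).mono_set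
        fun s hs => ⟨ht₂.1.trans_le hs.1, hs.2⟩
    have h2 : (∫ s in Ioc t₂ t, ‖flux f p s‖) = ∫ s in t₂..t, flux f p s := by
      rw [intervalIntegral.integral_of_le hn.le]
      refine setIntegral_congr_fun measurableSet_Ioc fun s hs => ?_
      exact Real.norm_of_nonneg (h.flux_pos s (hIoo s (hsub s (Ioc_subset_Icc_self hs)))).le
    have h3 := abs_le.mp (hSB t (hmem n))
    have h4 := abs_le.mp (hSB t₂ ht₂)
    rw [h2]
    refine h1.trans ?_
    rw [← mul_sub]
    exact mul_le_mul_of_nonneg_left (by linarith) (by positivity)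
  refine ((h.flux_integrable t₂ ht₂).union htail).mono_set ?_
  rw [Ioc_union_Ioc_eq_Ioc ht₂.1.le ht₂.2.le]
  exact Ioo_subset_Ioc_self

end DuhamelSolution

end PriceFormation

theorem mainTheorem4 (a κ : ℝ) (ha : 0 < a) (ha1 : a < 1) (hκ : 0 < κ) (hκ1 : κ ≤ 1)
    (fI : ℝ → ℝ) (pI : ℝ) (hI : PriceFormation.IsInitialDatum a fI pI)
    (T : ℝ) (hT : 0 < T) (f : ℝ → ℝ → ℝ) (p : ℝ → ℝ)
    (hsol : PriceFormation.IsSolutionOn a κ fI T f p) :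
    IntegrableOn (PriceFormation.flux f p) (Ioo 0 T) :=
  PriceFormation.DuhamelSolution.integrableOn_flux_Ioo
    { a_pos := ha
      κ_pos := hκ
      κ_le := hκ1
      T_pos := hT
      continuousOn_initial := hI.contDiffOn.continuousOn
      zeroSet := hsol.zeroSet
      mem_Ioo := hsol.mem_Ioo
      smooth := hsol.smooth
      flux_pos := hsol.flux_pos
      bounded := hsol.bounded
      flux_integrable := hsol.flux_integrable
      duhamel := hsol.duhamel }
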